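/- Let $d\ge 2$, $p\in[1,2]$, $1/p+1/q=1$ (so $q\in[2,\infty]$), and let $M,M_2,\mu,\varepsilon,R>0$ with $\mu\ge\varepsilon/R^2$. Put $\gamma=\varepsilon/(2M_2)$. There are an absolute constant $C>0$ and an absolute exponent $k\in\mathbb N$ such that for all such $d,p,q,M,M_2,\mu,\varepsilon,R$ one can choose the parameters of the restarted batched accelerated gradient method described below, depending only on these numbers, so that the method makes at most $$C\,\frac{d^{1/4}\sqrt{MM_2}}{\sqrt{\mu\varepsilon}}\;\Lambda^k=\tilde O\!\left(\frac{d^{1/4}\sqrt{MM_2}}{\sqrt{\mu\varepsilon}}\right)\ \text{successive iterations}$$ and at most $$C\,\frac{\min\{q,\ln d\}\,d^{2/q}M_2^2}{\mu\varepsilon}\;\Lambda^k=\tilde O\!\left(\frac{\min\{q,\ln d\}\,d^{2/q}M_2^2}{\mu\varepsilon}\right)\ \text{evaluations of } f,\qquad \Lambda=\ln\frac{2d\,\mu R^2}{\varepsilon},$$ and has the following property. Let $Q\subseteq\mathbb R^d$ be closed and convex, let $Q_\gamma$ be the set of points at Euclidean distance at most $\gamma$ from $Q$, and let $f:\mathbb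 R^d\to\mathbb R$ be convex on $Q_\gamma$, satisfy $|f(y)-f(x)|\le M\|y-x\|_p$ and $|f(y)-f(x)|\le M_2\|y-x\|_2$ for all $x,y\in Q_\gamma$, and be $\mu$-strongly convex on $Q$ with respect to $\|\cdot\|_p$. Let $x_*$ be a minimizer of $f$ on $Q$ and let $x^0\in Q$ with $\|x^0-x_*\|_p\le R$. Then the output $\bar x$ of the method started at $x^0$ satisfies $\mathbb E f(\bar x)-f(x_*)\le\varepsilon$. The method applies an accelerated gradient method to the smoothed function $f_\gamma(x)=\mathbb E_u f(x+\gamma u)$, $u$ uniform on the Euclidean unit ball, through the stochastic gradients $g(x,e)=d\,\frac{f(x+\gamma e)-f(x-\gamma e)}{2\gamma}\,e$, with all directions $e$ independent and uniform on the Euclidean unit sphere. It has finitely many stages; a stage has a number $n$ of iterations, a batch size $B\ge1$ and a regularization $\beta>0$, starts at the output $c$ of the preceding stage (at $x^0$ for the first stage), sets $x_0=z_0=c$, and for $t=0,\dots,n-1$ computes $$y_t=\tfrac{t}{t+2}x_t+\tfrac{2}{t+2}z_t,\qquad g_t=\frac1B\sum_{j=1}^{B}g(y_t,e_{t,j}),$$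 $$z_{t+1}=\arg\min_{z\in Q}\Big\{\sum_{i=0}^{t}(i+1)\langle g_i,z\rangle+\tfrac{\beta}{2}\|z-c\|_a^2\Big\},\qquad x_{t+1}=\tfrac{t}{t+2}x_t+\tfrac{2}{t+2}z_{t+1},$$ and returns $x_n$; the exponent $a\in(1,2]$ of the prox function is the same in all stages. The parameters of the method are $a$, the number of stages, and $n,B,\beta$ for each stage. -/

import Mathlib

open MeasureTheory ProbabilityTheory Set
open scoped ENNReal

noncomputable section

namespace ZO

/-- `ℝ^d`; its built-in norm is the Euclidean one. -/
abbrev Vec (d : ℕ) : Type := EuclideanSpace ℝ (Fin d)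

/-- The Euclidean unit sphere of `ℝ^d`. -/
abbrev Sph (d : ℕ) : Type := Metric.sphere (0 : Vec d) 1

/-- The `ℓ_p` norm of a vector of `ℝ^d`. -/
def normLp {d : ℕ} (p : ℝ≥0∞) (x : Vec d) : ℝ :=
  ‖(WithLp.toLp p (WithLp.ofLp x) : PiLp p fun _ : Fin d => ℝ)‖

/-- The uniform distribution on the Euclidean unit sphere: normalized surface measure. -/
def unifSphere (d : ℕ) : Measure (Sph d) :=
  ((volume : Measure (Vec d)).toSphere univ)⁻¹ • (volume : Measure (Vec d)).toSphere

/-- `f` is `K`-Lipschitz on `s` with respect to the `ℓ_p` norm. -/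
def LipschitzLp {d : ℕ} (p : ℝ≥0∞) (K : ℝ) (s : Set (Vec d)) (f : Vec d → ℝ) : Prop :=
  ∀ x ∈ s, ∀ y ∈ s, |f y - f x| ≤ K * normLp p (y - x)

/-- `f` is `μ`-strongly convex on the convex set `s` with respect to the `ℓ_p` norm. -/
def StrongConvexLp {d : ℕ} (p : ℝ≥0∞) (μ : ℝ) (s : Set (Vec d)) (f : Vec d → ℝ) : Prop :=
  Convex ℝ s ∧ ∀ x ∈ s, ∀ y ∈ s, ∀ t : ℝ, 0 ≤ t → t ≤ 1 →
    f (t • x + (1 - t) • y) ≤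
      t * f x + (1 - t) * f y - μ / 2 * (t * (1 - t)) * normLp p (x - y) ^ 2

/-- The two-point randomized gradient
`d * (f (x + γ e) - f (x - γ e)) / (2 γ) * e`, computed from two values of `f`. For `e` uniform on
the sphere it is the stochastic gradient of the smoothed function `f_γ x = E f (x + γ u)`,
`u` uniform on the Euclidean unit ball. -/
def zoGrad {d : ℕ} (f : Vec d → ℝ) (γ : ℝ) (x : Vec d) (e : Sph d) : Vec d :=
  ((d : ℝ) * ((f (x + γ • (e : Vec d)) - f (x - γ • (e : Vec d))) / (2 * γ))) • (e : Vec d)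

/-- A minimizer of `φ` over `s`. -/
def argminOn {d : ℕ} (φ : Vec d → ℝ) (s : Set (Vec d)) : Vec d :=
  Classical.epsilon fun z => z ∈ s ∧ IsMinOn φ s z

/-- State of the accelerated gradient method: the main iterate `x`, the prox iterate `z` and the
weighted sum `G` of the stochastic gradients computed so far. -/
structure State (d : ℕ) where
  x : Vec d
  z : Vec d
  G : Vec d

/-- Iteration number `k` (from `0`) of the batched accelerated gradient method on the
feasible set `Q`, with stochastic first-order oracle `g`, prox function `‖v - c‖_a ^ 2 / 2` centred
at `c`, regularization `β`, batch size `B`, and directions `e 0, …, e (B - 1)`. The weights are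
`α_k = k + 1`, with sums `A_k = (k + 1) (k + 2) / 2`, so that `α_k / A_k = 2 / (k + 2)`. -/
def accStep {d : ℕ} (Q : Set (Vec d)) (g : Vec d → Sph d → Vec d) (a : ℝ≥0∞) (c : Vec d)
    (β : ℝ) (B : ℕ) (k : ℕ) (e : ℕ → Sph d) (σ : State d) : State d :=
  let y : Vec d := ((k : ℝ) / (k + 2)) • σ.x + ((2 : ℝ) / (k + 2)) • σ.z
  let G : Vec d := σ.G + ((k : ℝ) + 1) • ((B : ℝ)⁻¹ • ∑ j ∈ Finset.range B, g y (e j))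
  let z : Vec d := argminOn (fun v => inner ℝ G v + β * (normLp a (v - c) ^ 2 / 2)) Q
  { x := ((k : ℝ) / (k + 2)) • σ.x + ((2 : ℝ) / (k + 2)) • z
    z := z
    G := G }

/-- The state after `n` iterations of the batched accelerated gradient method started at `c`. -/
def accRun {d : ℕ} (Q : Set (Vec d)) (g : Vec d → Sph d → Vec d) (a : ℝ≥0∞) (c : Vec d)
    (β : ℝ) (B : ℕ) (e : ℕ → ℕ → Sph d) : ℕ → State d
  | 0 => { x := c, z := c, G := 0 }
  | k + 1 => accStep Q g a c β B k (e k) (accRun Q g a c β B e k)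

/-- Parameters of the restarted method: the exponent of the prox function, the number of stages,
and for each stage its number of iterations, its batch size and its regularization. -/
structure Params where
  proxExp : ℝ≥0∞
  one_lt_proxExp : 1 < proxExp
  proxExp_le_two : proxExp ≤ 2
  stages : ℕ
  iters : ℕ → ℕ
  batch : ℕ → ℕ
  batch_pos : ∀ s, 0 < batch s
  reg : ℕ → ℝ
  reg_pos : ∀ s, 0 < reg s

/-- The point after `s` stages of the restarted batched accelerated gradient method started at
`x₀`: each stage runs the accelerated method from the output of the previous one.
`e s k j` is the `j`-th random direction of iteration `k` of stage `s`. -/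
def restarted {d : ℕ} (Q : Set (Vec d)) (g : Vec d → Sph d → Vec d) (x₀ : Vec d) (π : Params)
    (e : ℕ → ℕ → ℕ → Sph d) : ℕ → Vec d
  | 0 => x₀
  | s + 1 => (accRun Q g π.proxExp (restarted Q g x₀ π e s) (π.reg s) (π.batch s) (e s)
      (π.iters s)).x

/-- Output of the gradient-free method: the restarted batched accelerated gradient method fed with
the two-point randomized gradients of `f` with smoothing parameter `γ`. -/
def output {d : ℕ} (Q : Set (Vec d)) (f : Vec d → ℝ) (γ : ℝ) (x₀ : Vec d) (π : Params)
    (e : ℕ → ℕ → ℕ → Sph d) : Vec d :=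
  restarted Q (zoGrad f γ) x₀ π e π.stages

/-- The total number of successive iterations. -/
def numIters (π : Params) : ℕ := ∑ s ∈ Finset.range π.stages, π.iters s

/-- The total number of evaluations of `f`: each iteration of stage `s` evaluates `batch s`
two-point gradients, and each of them takes two values of `f`. -/
def numCalls (π : Params) : ℕ :=
  ∑ s ∈ Finset.range π.stages, π.iters s * (2 * π.batch s)

/-- `min {q, ln d}`, for `q ∈ [1, ∞]`. -/
def minQLog (q : ℝ≥0∞) (d : ℕ) : ℝ := (min q (ENNReal.ofReal (Real.log d))).toReal

end ZO

end

namespace ZO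

variable {d : ℕ}

/-! Each stage runs accelerated dual averaging on the smoothed function F = f_γ. On Q one has f ≤ F
≤ f + ε/2 (`le_ballAvg`, `ballAvg_le`), because γ = ε/(2M₂). The mean of the two-point gradient is
the gradient of F (`tendsto_slope_ballAvg`, by the divergence theorem on the ball). That gradient
varies by at most (√d/γ) M ‖x-y‖_p in the Euclidean norm, with √d and not d because E⟨e,v⟩² = ‖v‖²/d
on the sphere. So F has a quadratic upper model with L = √d M/γ, whose square root produces the
d^{1/4} in the iteration count.

The noise is measured in ℓ_{2m} with m of order ln d. The two-point gradient is d φ(e) e with φ odd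
and M₂-Lipschitz. Gaussian Poincaré, transferred to the sphere, gives E φ² = O(M₂²/d), and ‖e‖²_{2m}
is of order m/d apart from a negligible tail. Hence the second moment of the gradient is O(m M₂²)
(`integral_normLp_zoGrad_sq_le`). The ℓ_{2m} norm is 2-uniformly smooth (`normLp_uniformSmooth`), so
averaging B independent gradients divides the variance by B up to a factor of order m. Pairing with
ℓ_p costs d^{1/q}, hence d^{2/q} in the number of calls.

The prox function is strongly convex because ℓ_a is 2-uniformly convex for 1 < a ≤ 2
(`normLp_uniformConvex`). The exponent a = max(p, 1 + 1/(1 + ln d)) remains usable at p = 1 at a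
logarithmic price (`exists_proxExp`). The estimate sequence argument (`accelerated_estimate`) then
bounds the gap of a stage by its initial squared distance to the minimizer plus noise. Strong
convexity turns the gap back into a distance, so every restart divides the squared distance by 8 up
to an error of order ε (`restarted_expected_gap`).

Two regimes need separate treatment. If the sample budget is below the accelerated iteration count,
F is treated as merely Lipschitz and the batch size is 1 (`exists_iters_batch`). If one of the
claimed rates may fall below a constant, the starting point is already ε-optimal and no stage is run
(`gap_le_of_lipschitzLp`). -/

/-! ### The two-point inequality for powers between 1 and 2. -/

/-- The difference of the two sides has derivative b((1+x)^{b-1} + (1-x)^{b-1} - 2). The two powers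
have product (1-x²)^{b-1} ≥ 1, so by AM-GM their sum is at least 2. -/
theorem two_mul_le_rpow_sub_rpow {b t : ℝ} (hb : 0 < b) (hb1 : b ≤ 1) (ht : t ∈ Icc (0 : ℝ) 1) :
    2 * b * t ≤ (1 + t) ^ b - (1 - t) ^ b := by
  have hmono : MonotoneOn (fun t : ℝ => (1 + t) ^ b - (1 - t) ^ b - 2 * b * t) (Icc 0 1) := by
    have hd : ∀ x ∈ Ioo (0 : ℝ) 1,
        HasDerivAt (fun t : ℝ => (1 + t) ^ b - (1 - t) ^ b - 2 * b * t)
          (b * ((1 + x) ^ (b - 1) + (1 - x) ^ (b - 1) - 2)) x := by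
      intro x hx
      have h1 : HasDerivAt (fun t : ℝ => (1 + t) ^ b) (1 * b * (1 + x) ^ (b - 1)) x :=
        ((hasDerivAt_id x).const_add 1).rpow_const (Or.inl (by simp; linarith [hx.1]))
      have h2 : HasDerivAt (fun t : ℝ => (1 - t) ^ b) (-1 * b * (1 - x) ^ (b - 1)) x :=
        ((hasDerivAt_id x).const_sub 1).rpow_const (Or.inl (by simp; linarith [hx.2]))
      have h3 : HasDerivAt (fun t : ℝ => 2 * b * t) (2 * b) x := by
        simpa using (hasDerivAt_id x).const_mul (2 * b)
      convert! (h1.sub h2).sub h3 using 1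
      ring
    apply monotoneOn_of_deriv_nonneg (convex_Icc 0 1)
    · refine ContinuousOn.sub (ContinuousOn.sub ?_ ?_) (by fun_prop)
      · exact ContinuousOn.rpow_const (by fun_prop) (fun x _ => Or.inr hb.le)
      · exact ContinuousOn.rpow_const (by fun_prop) (fun x _ => Or.inr hb.le)
    · rw [interior_Icc]
      exact fun x hx => (hd x hx).differentiableAt.differentiableWithinAt
    · rw [interior_Icc]
      intro x hx
      rw [(hd x hx).deriv]
      have p1 : 0 < 1 + x := by linarith [hx.1]
      have p2 : 0 < 1 - x := by linarith [hx.2]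
      have hprod : 1 ≤ (1 + x) ^ (b - 1) * (1 - x) ^ (b - 1) := by
        rw [← Real.mul_rpow p1.le p2.le]
        exact Real.one_le_rpow_of_pos_of_le_one_of_nonpos (by positivity)
          (by nlinarith [sq_nonneg x]) (by linarith)
      have q1 := Real.rpow_pos_of_pos p1 (b - 1)
      have q2 := Real.rpow_pos_of_pos p2 (b - 1)
      refine mul_nonneg hb.le ?_
      nlinarith [sq_nonneg ((1 + x) ^ (b - 1) - (1 - x) ^ (b - 1))]
  have h := hmono (left_mem_Icc.2 zero_le_one) ht ht.1
  simp at h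
  linarith

/-- Differentiating in t reduces this to `two_mul_le_rpow_sub_rpow` with exponent a - 1. -/
theorem one_add_le_rpow_add_rpow {a t : ℝ} (ha : 1 < a) (ha2 : a ≤ 2) (ht : t ∈ Icc (0 : ℝ) 1) :
    1 + a / 2 * ((a - 1) * t ^ 2) ≤ ((1 + t) ^ a + (1 - t) ^ a) / 2 := by
  have hmono : MonotoneOn (fun t : ℝ => ((1 + t) ^ a + (1 - t) ^ a) / 2
      - a / 2 * ((a - 1) * t ^ 2)) (Icc 0 1) := by
    have hd : ∀ x ∈ Ioo (0 : ℝ) 1,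
        HasDerivAt (fun t : ℝ => ((1 + t) ^ a + (1 - t) ^ a) / 2 - a / 2 * ((a - 1) * t ^ 2))
          (a / 2 * ((1 + x) ^ (a - 1) - (1 - x) ^ (a - 1) - 2 * (a - 1) * x)) x := by
      intro x hx
      have h1 : HasDerivAt (fun t : ℝ => (1 + t) ^ a) (1 * a * (1 + x) ^ (a - 1)) x :=
        ((hasDerivAt_id x).const_add 1).rpow_const (Or.inl (by simp; linarith [hx.1]))
      have h2 : HasDerivAt (fun t : ℝ => (1 - t) ^ a) (-1 * a * (1 - x) ^ (a - 1)) x :=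
        ((hasDerivAt_id x).const_sub 1).rpow_const (Or.inl (by simp; linarith [hx.2]))
      have h3 : HasDerivAt (fun t : ℝ => a / 2 * ((a - 1) * t ^ 2))
          (a / 2 * ((a - 1) * (2 * x))) x := by
        simpa using (((hasDerivAt_id x).pow 2).const_mul (a - 1)).const_mul (a / 2)
      convert! ((h1.add h2).div_const 2).sub h3 using 1
      ring
    apply monotoneOn_of_deriv_nonneg (convex_Icc 0 1)
    · refine ContinuousOn.sub (ContinuousOn.div_const (ContinuousOn.add ?_ ?_) _) (by fun_prop)
      · exact ContinuousOn.rpow_const (by fun_prop) (fun x _ => Or.inr (by linarith))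
      · exact ContinuousOn.rpow_const (by fun_prop) (fun x _ => Or.inr (by linarith))
    · rw [interior_Icc]
      exact fun x hx => (hd x hx).differentiableAt.differentiableWithinAt
    · rw [interior_Icc]
      intro x hx
      rw [(hd x hx).deriv]
      have := two_mul_le_rpow_sub_rpow (b := a - 1) (by linarith) (by linarith)
        (Ioo_subset_Icc_self hx)
      exact mul_nonneg (by linarith) (by linarith)
  have h := hmono (left_mem_Icc.2 zero_le_one) ht ht.1
  simp at h
  linarith

/-- By homogeneity one may take s = 1. Bernoulli's inequality with exponent a/2 ≤ 1 linearizes the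
left side, and `one_add_le_rpow_add_rpow` finishes. -/
theorem rpow_two_point_of_le {a s t : ℝ} (ha : 1 < a) (ha2 : a ≤ 2) (ht : 0 ≤ t) (hts : t ≤ s) :
    (s ^ 2 + (a - 1) * t ^ 2) ^ (a / 2) ≤ ((s + t) ^ a + (s - t) ^ a) / 2 := by
  rcases (ht.trans hts).eq_or_lt with rfl | hs
  · obtain rfl : t = 0 := le_antisymm hts ht
    simp [Real.zero_rpow (by linarith : a / 2 ≠ 0), Real.zero_rpow (by linarith : a ≠ 0)]
  set u := t / s with hu
  have hu1 : u ∈ Icc (0 : ℝ) 1 := ⟨by positivity, by rw [hu, div_le_one hs]; exact hts⟩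
  have htu : t = s * u := by rw [hu]; field_simp
  have e1 : (s + t) ^ a = s ^ a * (1 + u) ^ a := by
    rw [← Real.mul_rpow hs.le (by linarith [hu1.1]), htu]; ring_nf
  have e2 : (s - t) ^ a = s ^ a * (1 - u) ^ a := by
    rw [← Real.mul_rpow hs.le (by linarith [hu1.2]), htu]; ring_nf
  have hpos : 0 ≤ (a - 1) * u ^ 2 := mul_nonneg (by linarith) (sq_nonneg _)
  have e3 : (s ^ 2 + (a - 1) * t ^ 2) ^ (a / 2) = s ^ a * (1 + (a - 1) * u ^ 2) ^ (a / 2) := by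
    rw [show s ^ 2 + (a - 1) * t ^ 2 = s ^ 2 * (1 + (a - 1) * u ^ 2) by rw [htu]; ring,
      Real.mul_rpow (by positivity) (by linarith), ← Real.rpow_natCast_mul hs.le]
    congr 2; push_cast; ring
  rw [e1, e2, e3, ← mul_add, mul_div_assoc]
  gcongr
  refine le_trans ?_ (one_add_le_rpow_add_rpow ha ha2 hu1)
  exact rpow_one_add_le_one_add_mul_self (by linarith) (by linarith) (by linarith)

/-- The two-point inequality behind the 2-uniform convexity of `ℓ_a`, `1 < a ≤ 2`. -/
theorem rpow_two_point {a : ℝ} (ha : 1 < a) (ha2 : a ≤ 2) (s t : ℝ) :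
    (s ^ 2 + (a - 1) * t ^ 2) ^ (a / 2) ≤ (|s + t| ^ a + |s - t| ^ a) / 2 := by
  have key : ∀ s t : ℝ, 0 ≤ s → 0 ≤ t →
      (s ^ 2 + (a - 1) * t ^ 2) ^ (a / 2) ≤ (|s + t| ^ a + |s - t| ^ a) / 2 := by
    intro s t hs ht
    rcases le_total t s with h | h
    · rw [abs_of_nonneg (by linarith), abs_of_nonneg (by linarith : 0 ≤ s - t)]
      exact rpow_two_point_of_le ha ha2 ht h
    · rw [abs_of_nonneg (by linarith), abs_of_nonpos (by linarith : s - t ≤ 0), neg_sub, add_comm s]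
      -- For s ≤ t, exchanging s and t only increases the left side: the change is (2 - a)(t² - s²)
      -- ≥ 0.
      refine le_trans ?_ (rpow_two_point_of_le ha ha2 hs h)
      apply Real.rpow_le_rpow
      · have := sq_nonneg t
        have : 0 ≤ (a - 1) * t ^ 2 := mul_nonneg (by linarith) this
        positivity
      · nlinarith [mul_nonneg (by linarith : 0 ≤ 2 - a) (by nlinarith : 0 ≤ t ^ 2 - s ^ 2)]
      · linarith
  have h := key |s| |t| (abs_nonneg _) (abs_nonneg _)
  rw [sq_abs, sq_abs] at h
  refine h.trans (le_of_eq ?_)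
  rcases abs_cases s with ⟨hs, _⟩ | ⟨hs, _⟩ <;> rcases abs_cases t with ⟨ht, _⟩ | ⟨ht, _⟩ <;>
    rw [hs, ht]
  · rw [← sub_eq_add_neg, sub_neg_eq_add, add_comm]
  · rw [show -s + t = -(s - t) by ring, show -s - t = -(s + t) by ring, abs_neg, abs_neg, add_comm]
  · rw [show -s + -t = -(s + t) by ring, show -s - -t = -(s - t) by ring, abs_neg, abs_neg]

/-! ### The ℓ_p norms on ℝ^d and 2-uniform convexity. -/

theorem normLp_nonneg (p : ℝ≥0∞) (hp : 1 ≤ p) (x : Vec d) : 0 ≤ normLp p x := by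
  have := Fact.mk hp
  exact norm_nonneg (WithLp.toLp p (WithLp.ofLp x) : PiLp p fun _ : Fin d => ℝ)

@[simp] theorem normLp_zero (p : ℝ≥0∞) (hp : 1 ≤ p) : normLp p (0 : Vec d) = 0 := by
  have := Fact.mk hp
  exact norm_zero (E := PiLp p fun _ : Fin d => ℝ)

theorem normLp_smul (p : ℝ≥0∞) (hp : 1 ≤ p) (t : ℝ) (x : Vec d) :
    normLp p (t • x) = |t| * normLp p x := by
  have := Fact.mk hp
  exact norm_smul t (WithLp.toLp p (WithLp.ofLp x) : PiLp p fun _ : Fin d => ℝ)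

theorem normLp_add_le (p : ℝ≥0∞) (hp : 1 ≤ p) (x y : Vec d) :
    normLp p (x + y) ≤ normLp p x + normLp p y := by
  have := Fact.mk hp
  exact norm_add_le (WithLp.toLp p (WithLp.ofLp x) : PiLp p fun _ : Fin d => ℝ)
    (WithLp.toLp p (WithLp.ofLp y))

theorem normLp_neg (p : ℝ≥0∞) (hp : 1 ≤ p) (x : Vec d) : normLp p (-x) = normLp p x := by
  have := normLp_smul p hp (-1) x
  simpa using this

theorem normLp_sub_comm (p : ℝ≥0∞) (hp : 1 ≤ p) (x y : Vec d) :
    normLp p (x - y) = normLp p (y - x) := by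
  rw [← normLp_neg p hp, neg_sub]

theorem continuous_normLp (p : ℝ≥0∞) (hp : 1 ≤ p) : Continuous (normLp p : Vec d → ℝ) := by
  have := Fact.mk hp
  have h1 : Continuous fun x : Vec d =>
      (WithLp.toLp p (WithLp.ofLp x) : PiLp p fun _ : Fin d => ℝ) :=
    (PiLp.continuous_toLp p _).comp (PiLp.continuous_ofLp 2 _)
  exact continuous_norm.comp h1

theorem normLp_two (x : Vec d) : normLp 2 x = ‖x‖ := rfl

theorem normLp_eq_sum {p : ℝ≥0∞} (hp : 1 ≤ p) (hpt : p ≠ ∞) (x : Vec d) :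
    normLp p x = (∑ i, |x i| ^ p.toReal) ^ (1 / p.toReal) :=
  PiLp.norm_eq_sum (ENNReal.toReal_pos (by positivity) hpt)
    (WithLp.toLp p (WithLp.ofLp x) : PiLp p fun _ : Fin d => ℝ)

theorem one_le_toReal {p : ℝ≥0∞} (hp : 1 ≤ p) (hpt : p ≠ ∞) : 1 ≤ p.toReal := by
  simpa using ENNReal.toReal_mono hpt hp

theorem normLp_rpow {p : ℝ≥0∞} (hp : 1 ≤ p) (hpt : p ≠ ∞) (x : Vec d) :
    normLp p x ^ p.toReal = ∑ i, |x i| ^ p.toReal := by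
  have h1 := one_le_toReal hp hpt
  rw [normLp_eq_sum hp hpt, ← Real.rpow_mul (Finset.sum_nonneg fun i _ => by positivity)]
  rw [one_div_mul_cancel (by positivity), Real.rpow_one]

theorem abs_apply_le_normLp {p : ℝ≥0∞} (hp : 1 ≤ p) (hpt : p ≠ ∞) (x : Vec d) (i : Fin d) :
    |x i| ≤ normLp p x := by
  have h1 := one_le_toReal hp hpt
  rw [← Real.rpow_le_rpow_iff (abs_nonneg _) (normLp_nonneg p hp x) (by linarith : 0 < p.toReal),
    normLp_rpow hp hpt]
  exact Finset.single_le_sum (f := fun i => |x i| ^ p.toReal) (fun i _ => by positivity)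
    (Finset.mem_univ i)

theorem normLp_antitone {p a : ℝ≥0∞} (hp : 1 ≤ p) (hpa : p ≤ a) (ha : a ≠ ∞) (x : Vec d) :
    normLp a x ≤ normLp p x := by
  have hpt : p ≠ ∞ := ne_top_of_le_ne_top ha hpa
  have h1 := one_le_toReal hp hpt
  have h2 : p.toReal ≤ a.toReal := ENNReal.toReal_mono ha hpa
  have hn := normLp_nonneg p hp x
  rw [← Real.rpow_le_rpow_iff (normLp_nonneg a (hp.trans hpa) x) hn
    (by linarith : 0 < a.toReal), normLp_rpow (hp.trans hpa) ha]
  have hsplit : ∀ y : ℝ, 0 ≤ y → y ^ a.toReal = y ^ p.toReal * y ^ (a.toReal - p.toReal) := by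
    intro y hy
    rw [← Real.rpow_add_of_nonneg hy (by linarith) (by linarith)]; ring_nf
  rw [hsplit _ hn, normLp_rpow hp hpt, Finset.sum_mul]
  refine Finset.sum_le_sum fun i _ => ?_
  rw [hsplit _ (abs_nonneg _)]
  gcongr
  exact abs_apply_le_normLp hp hpt x i

theorem normLp_le_card_rpow_mul {p a : ℝ≥0∞} (hp : 1 ≤ p) (hpa : p ≤ a) (ha : a ≠ ∞) (x : Vec d) :
    normLp p x ≤ (d : ℝ) ^ (1 / p.toReal - 1 / a.toReal) * normLp a x := by
  have hpt : p ≠ ∞ := ne_top_of_le_ne_top ha hpa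
  have h1 := one_le_toReal hp hpt
  have h2 : p.toReal ≤ a.toReal := ENNReal.toReal_mono ha hpa
  have hn := normLp_nonneg p hp x
  have hn' := normLp_nonneg a (hp.trans hpa) x
  have ha0 : 0 < a.toReal := by linarith
  have hp0 : 0 < p.toReal := by linarith
  rw [← Real.rpow_le_rpow_iff hn (by positivity) ha0,
    Real.mul_rpow (by positivity) hn', normLp_rpow (hp.trans hpa) ha]
  have h := Real.rpow_sum_le_const_mul_sum_rpow_of_nonneg (s := Finset.univ)
    (f := fun i => |x i| ^ p.toReal) (p := a.toReal / p.toReal)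
    ((one_le_div hp0).2 h2) (fun i _ => by positivity)
  rw [← normLp_rpow hp hpt, ← Real.rpow_mul hn, mul_div_cancel₀ _ hp0.ne'] at h
  refine h.trans (le_of_eq ?_)
  rw [← Real.rpow_mul (by positivity)]
  congr 1
  · simp only [Finset.card_univ, Fintype.card_fin]
    congr 1; field_simp
  · refine Finset.sum_congr rfl fun i _ => ?_
    rw [← Real.rpow_mul (abs_nonneg _), mul_div_cancel₀ _ hp0.ne']

theorem inner_eq_sum (u v : Vec d) : inner ℝ u v = ∑ i, u i * v i := by
  simp [PiLp.inner_apply, mul_comm]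

/-- Hölder between ℓ_∞ and ℓ_1, with ‖u‖_∞ ≤ ‖u‖_a and ‖v‖_1 ≤ d^{1-1/p} ‖v‖_p. It allows the noise
to be measured in an even exponent 2m unrelated to p; the factor is d^{1/q}. -/
theorem abs_inner_le_normLp {p a : ℝ≥0∞} (hp : 1 ≤ p) (hpt : p ≠ ∞) (ha : 1 ≤ a) (hat : a ≠ ∞)
    (u v : Vec d) :
    |inner ℝ u v| ≤ (d : ℝ) ^ (1 - 1 / p.toReal) * normLp a u * normLp p v := by
  have h1 : normLp 1 v = ∑ i, |v i| := by simp [normLp_eq_sum (le_refl 1) (by simp)]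
  have h2 := normLp_le_card_rpow_mul le_rfl hp hpt v
  rw [ENNReal.toReal_one, div_one, h1] at h2
  rw [inner_eq_sum]
  calc |∑ i, u i * v i| ≤ ∑ i, |u i * v i| := Finset.abs_sum_le_sum_abs _ _
    _ ≤ ∑ i, normLp a u * |v i| := by
        refine Finset.sum_le_sum fun i _ => ?_
        rw [abs_mul]
        gcongr
        exact abs_apply_le_normLp ha hat u i
    _ = normLp a u * ∑ i, |v i| := by rw [Finset.mul_sum]
    _ ≤ normLp a u * ((d : ℝ) ^ (1 - 1 / p.toReal) * normLp p v) := by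
        gcongr; exact normLp_nonneg a ha u
    _ = _ := by ring

/-- 2-uniform convexity of the `ℓ_a` norm, `1 < a ≤ 2`. -/
theorem normLp_uniformConvex {a : ℝ≥0∞} (ha : 1 < a) (ha2 : a ≤ 2) (s t : Vec d) :
    normLp a s ^ 2 + (a.toReal - 1) * normLp a t ^ 2 ≤
      (normLp a (s + t) ^ 2 + normLp a (s - t) ^ 2) / 2 := by
  have hat : a ≠ ∞ := ne_top_of_le_ne_top (by simp) ha2
  set r := a.toReal with hr
  have hr1 : 1 < r := by simpa using (ENNReal.toReal_lt_toReal (by simp) hat).2 ha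
  have hr2 : r ≤ 2 := by simpa using (ENNReal.toReal_le_toReal hat (by simp)).2 ha2
  have hr0 : 0 < r := by linarith
  set θ : ℝ≥0∞ := ENNReal.ofReal (2 / r) with hθ
  have hθr : θ.toReal = 2 / r := ENNReal.toReal_ofReal (by positivity)
  have hθ1 : 1 ≤ θ := by
    rw [hθ, ← ENNReal.ofReal_one]
    exact ENNReal.ofReal_le_ofReal ((one_le_div hr0).2 hr2)
  have hθt : θ ≠ ∞ := ENNReal.ofReal_ne_top
  have hc : 0 ≤ r - 1 := by linarith
  -- The triangle inequality for these vectors of ℝ² in ℓ_{2/r}, where 2/r ≥ 1, is the Minkowski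
  -- inequality that carries the scalar two-point bound from the coordinates to the norms.
  let w : Fin d → Vec 2 := fun i => !₂[abs (s i) ^ r, (Real.sqrt (r - 1) * |t i|) ^ r]
  have hpow : ∀ y : ℝ, 0 ≤ y → (y ^ r) ^ (2 / r) = y ^ 2 := by
    intro y hy
    rw [← Real.rpow_mul hy, mul_div_cancel₀ _ hr0.ne', Real.rpow_two]
  have hinv : 1 / (2 / r) = r / 2 := by field_simp
  have htri : normLp θ (∑ i, w i) ≤ ∑ i, normLp θ (w i) := by
    have : ∀ S : Finset (Fin d), normLp θ (∑ i ∈ S, w i) ≤ ∑ i ∈ S, normLp θ (w i) := by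
      intro S
      induction S using Finset.induction_on with
      | empty => simp [normLp_zero θ hθ1]
      | insert i S hi ih =>
        rw [Finset.sum_insert hi, Finset.sum_insert hi]
        exact (normLp_add_le θ hθ1 _ _).trans (by linarith)
    exact this _
  have hw : ∀ i, normLp θ (w i) = (s i ^ 2 + (r - 1) * t i ^ 2) ^ (r / 2) := by
    intro i
    rw [normLp_eq_sum hθ1 hθt, hθr, hinv]
    congr 1
    simp only [Fin.sum_univ_two, w]
    simp only [Matrix.cons_val_zero, Matrix.cons_val_one]
    rw [abs_of_nonneg (Real.rpow_nonneg (abs_nonneg (s i)) r),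
      abs_of_nonneg (Real.rpow_nonneg (by positivity : 0 ≤ √(r - 1) * |t i|) r),
          hpow _ (abs_nonneg _),
      hpow _ (by positivity), mul_pow, Real.sq_sqrt hc, sq_abs, sq_abs]
  have hsum : normLp θ (∑ i, w i) =
      (normLp a s ^ 2 + (r - 1) * normLp a t ^ 2) ^ (r / 2) := by
    rw [normLp_eq_sum hθ1 hθt, hθr, hinv]
    congr 1
    simp only [Fin.sum_univ_two, w]
    simp only [WithLp.ofLp_sum, Finset.sum_apply, Matrix.cons_val_zero,
      Matrix.cons_val_one]
    have e2 : ∑ i, (Real.sqrt (r - 1) * |t i|) ^ r = (Real.sqrt (r - 1) * normLp a t) ^ r := by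
      rw [Real.mul_rpow (by positivity) (normLp_nonneg a ha.le t), normLp_rpow ha.le hat,
        Finset.mul_sum]
      exact Finset.sum_congr rfl fun i _ => Real.mul_rpow (by positivity) (by positivity)
    rw [e2, ← normLp_rpow ha.le hat, abs_of_nonneg (Real.rpow_nonneg (normLp_nonneg a ha.le _) _),
      abs_of_nonneg (Real.rpow_nonneg (mul_nonneg (by positivity) (normLp_nonneg a ha.le _)) _),
      hpow _ (normLp_nonneg a ha.le _), hpow _ (mul_nonneg (by positivity)
      (normLp_nonneg a ha.le _)), mul_pow, Real.sq_sqrt hc]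
  have hX := normLp_nonneg a ha.le (s + t)
  have hY := normLp_nonneg a ha.le (s - t)
  have h1 : (normLp a s ^ 2 + (r - 1) * normLp a t ^ 2) ^ (r / 2) ≤
      (normLp a (s + t) ^ r + normLp a (s - t) ^ r) / 2 := by
    rw [← hsum]
    refine htri.trans ?_
    rw [normLp_rpow ha.le hat, normLp_rpow ha.le hat, ← Finset.sum_add_distrib, Finset.sum_div]
    refine Finset.sum_le_sum fun i _ => ?_
    rw [hw]
    exact rpow_two_point hr1 hr2 (s i) (t i)
  -- Power mean inequality, from convexity of x ↦ x^{2/r}.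
  have h2 : ((normLp a (s + t) ^ r + normLp a (s - t) ^ r) / 2) ^ (2 / r) ≤
      (normLp a (s + t) ^ 2 + normLp a (s - t) ^ 2) / 2 := by
    have := (convexOn_rpow ((one_le_div hr0).2 hr2)).2 (mem_Ici.2 (Real.rpow_nonneg hX r))
      (mem_Ici.2 (Real.rpow_nonneg hY r)) (by norm_num : (0 : ℝ) ≤ 1 / 2)
      (by norm_num : (0 : ℝ) ≤ 1 / 2) (by norm_num)
    simp only [smul_eq_mul] at this
    rw [hpow _ hX, hpow _ hY] at this
    rwa [← mul_add, ← mul_add, one_div_mul_eq_div, one_div_mul_eq_div] at this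
  refine le_trans ?_ h2
  have hbase : 0 ≤ normLp a s ^ 2 + (r - 1) * normLp a t ^ 2 := by positivity
  calc normLp a s ^ 2 + (r - 1) * normLp a t ^ 2
      = ((normLp a s ^ 2 + (r - 1) * normLp a t ^ 2) ^ (r / 2)) ^ (2 / r) := by
        rw [← Real.rpow_mul hbase, show r / 2 * (2 / r) = 1 by field_simp, Real.rpow_one]
    _ ≤ _ := by
        apply Real.rpow_le_rpow (by positivity) h1 (by positivity)

/-! ### The dual averaging step: existence, growth, continuity. -/

/-- The objective minimized in a dual averaging step. -/
noncomputable def proxObj (a : ℝ≥0∞) (β : ℝ) (c G v : Vec d) : ℝ :=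
  inner ℝ G v + β * (normLp a (v - c) ^ 2 / 2)

/-- The dual averaging step on `Q`. -/
noncomputable def proxPt (Q : Set (Vec d)) (a : ℝ≥0∞) (β : ℝ) (c G : Vec d) : Vec d :=
  argminOn (fun v => inner ℝ G v + β * (normLp a (v - c) ^ 2 / 2)) Q

theorem norm_le_normLp {a : ℝ≥0∞} (ha : 1 ≤ a) (ha2 : a ≤ 2) (x : Vec d) : ‖x‖ ≤ normLp a x := by
  rw [← normLp_two]; exact normLp_antitone ha ha2 (by simp) x

theorem continuous_proxObj {a : ℝ≥0∞} (ha : 1 ≤ a) (β : ℝ) (c G : Vec d) :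
    Continuous (proxObj a β c G) := by
  have h := (continuous_normLp (d := d) a ha).comp (continuous_sub_right c)
  unfold proxObj
  exact (continuous_const.inner continuous_id).add
    (continuous_const.mul ((h.pow 2).div_const 2))

/-- Coercivity: since ‖·‖_2 ≤ ‖·‖_a for a ≤ 2, the quadratic term dominates the linear one outside a
large ball. -/
theorem exists_isMinOn_proxObj {Q : Set (Vec d)} (hQ : IsClosed Q) (hne : Q.Nonempty) {a : ℝ≥0∞}
    (ha : 1 ≤ a) (ha2 : a ≤ 2) {β : ℝ} (hβ : 0 < β) (c G : Vec d) :
    ∃ z ∈ Q, IsMinOn (proxObj a β c G) Q z := by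
  obtain ⟨x₀, hx₀⟩ := hne
  refine (continuous_proxObj ha β c G).continuousOn.exists_isMinOn' hQ hx₀ ?_
  refine Filter.Eventually.filter_mono inf_le_left ?_
  have ht := tendsto_norm_cocompact_atTop (E := Vec d)
  filter_upwards [ht.eventually_ge_atTop (2 * ‖c‖), ht.eventually_ge_atTop (8 / β * (‖G‖ + 1)),
    ht.eventually_ge_atTop (proxObj a β c G x₀)] with v h1 h2 h3
  refine h3.trans ?_
  have h4 : ‖v‖ / 2 ≤ normLp a (v - c) := by
    refine le_trans ?_ (norm_le_normLp ha ha2 _)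
    have := norm_sub_norm_le v c
    linarith
  have h5 : -(‖G‖ * ‖v‖) ≤ inner ℝ G v := (abs_le.1 (abs_real_inner_le_norm G v)).1
  have h6 : (‖v‖ / 2) ^ 2 ≤ normLp a (v - c) ^ 2 := by gcongr
  have h7 : ‖G‖ + 1 ≤ β / 8 * ‖v‖ := by
    calc ‖G‖ + 1 = β / 8 * (8 / β * (‖G‖ + 1)) := by field_simp
      _ ≤ _ := by gcongr
  unfold proxObj
  have h8 := mul_le_mul_of_nonneg_right h7 (norm_nonneg v)
  have h9 := mul_le_mul_of_nonneg_left h6 hβ.le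
  nlinarith [norm_nonneg v]

theorem proxPt_spec {Q : Set (Vec d)} (hQ : IsClosed Q) (hne : Q.Nonempty) {a : ℝ≥0∞}
    (ha : 1 ≤ a) (ha2 : a ≤ 2) {β : ℝ} (hβ : 0 < β) (c G : Vec d) :
    proxPt Q a β c G ∈ Q ∧ IsMinOn (proxObj a β c G) Q (proxPt Q a β c G) :=
  Classical.epsilon_spec (p := fun z => z ∈ Q ∧ IsMinOn (proxObj a β c G) Q z)
    (exists_isMinOn_proxObj hQ hne ha ha2 hβ c G)

/-- Quadratic growth of the dual averaging objective around its minimizer. -/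
theorem proxObj_growth {Q : Set (Vec d)} (hQ : Convex ℝ Q) {a : ℝ≥0∞} (ha : 1 < a) (ha2 : a ≤ 2)
    {β : ℝ} (hβ : 0 ≤ β) {c G w z : Vec d} (hw : w ∈ Q) (hmin : IsMinOn (proxObj a β c G) Q w)
    (hz : z ∈ Q) :
    proxObj a β c G w + β * (a.toReal - 1) / 4 * normLp a (z - w) ^ 2 ≤ proxObj a β c G z := by
  have hmid : (1 / 2 : ℝ) • z + (1 / 2 : ℝ) • w ∈ Q :=
    hQ hz hw (by norm_num) (by norm_num) (by norm_num)
  have h1 := hmin hmid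
  simp only [mem_ofPred_eq] at h1
  -- Uniform convexity around the midpoint of z - c and w - c, with half difference (z - w)/2. The
  -- gain β(a-1)/8 at the midpoint doubles to β(a-1)/4 when solved for the value at z.
  have h2 := normLp_uniformConvex ha ha2 ((1 / 2 : ℝ) • (z - c) + (1 / 2 : ℝ) • (w - c))
    ((1 / 2 : ℝ) • (z - w))
  have e1 : (1 / 2 : ℝ) • (z - c) + (1 / 2 : ℝ) • (w - c) + (1 / 2 : ℝ) • (z - w) = z - c := by
    module
  have e2 : (1 / 2 : ℝ) • (z - c) + (1 / 2 : ℝ) • (w - c) - (1 / 2 : ℝ) • (z - w) = w - c := by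
    module
  have e3 : (1 / 2 : ℝ) • z + (1 / 2 : ℝ) • w - c
      = (1 / 2 : ℝ) • (z - c) + (1 / 2 : ℝ) • (w - c) := by module
  rw [e1, e2, normLp_smul a ha.le _ (z - w), abs_of_pos (by norm_num)] at h2
  unfold proxObj at h1 ⊢
  rw [e3, inner_add_right, inner_smul_right, inner_smul_right] at h1
  nlinarith [mul_le_mul_of_nonneg_left h2 hβ]

theorem le_add_sqrt_of_sq_le {r A B : ℝ} (hA : 0 ≤ A) (hB : 0 ≤ B) (h : r ^ 2 ≤ A * r + B) :
    r ≤ A + √B := by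
  by_contra! hlt
  have h1 := Real.sq_sqrt hB
  have h2 := Real.sqrt_nonneg B
  nlinarith

/-- Adding the quadratic growth at the two minimizers bounds r = ‖z' - z‖_a by r² ≤ A r + B, where A
and B tend to 0 as the data converge. Continuity matters because it makes every iterate a continuous
function on a compact product of spheres, hence measurable and integrable. -/
theorem continuous_proxPt {Q : Set (Vec d)} (hQ : IsClosed Q) (hQc : Convex ℝ Q)
    (hne : Q.Nonempty) {a : ℝ≥0∞} (ha : 1 < a) (ha2 : a ≤ 2) {β : ℝ} (hβ : 0 < β) :
    Continuous fun u : Vec d × Vec d => proxPt Q a β u.1 u.2 := by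
  have har : 0 < a.toReal - 1 := by
    have : (1 : ℝ) < a.toReal := by
      simpa using (ENNReal.toReal_lt_toReal (by simp) (ne_top_of_le_ne_top (by simp) ha2)).2 ha
    linarith
  rw [continuous_iff_continuousAt]
  rintro ⟨c, G⟩
  set z := proxPt Q a β c G with hz
  set κ := β * (a.toReal - 1) / 4 with hκ
  have hκ0 : 0 < κ := by positivity
  set δ : Vec d × Vec d → ℝ := fun u => normLp a (c - u.1) with hδ
  have hδc : Continuous δ :=
    (continuous_normLp (d := d) a ha.le).comp (continuous_const.sub continuous_fst)
  set A : Vec d × Vec d → ℝ := fun u => (‖G - u.2‖ + β * δ u) / (2 * κ) with hA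
  set B : Vec d × Vec d → ℝ := fun u =>
    (β * δ u * (2 * normLp a (z - c) + δ u)) / (2 * κ) with hB
  have hAc : Continuous A := by fun_prop
  have hBc : Continuous B := by fun_prop
  have hδ0 : δ (c, G) = 0 := by simp [hδ, normLp_zero a ha.le]
  have hlim : Filter.Tendsto (fun u => A u + √(B u)) (nhds (c, G)) (nhds 0) := by
    have h : Filter.Tendsto (fun u => A u + √(B u)) (nhds (c, G))
        (nhds (A (c, G) + √(B (c, G)))) := (hAc.add hBc.sqrt).tendsto (c, G)
    simpa [hA, hB, hδ0] using h
  change Filter.Tendsto _ _ _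
  rw [tendsto_iff_norm_sub_tendsto_zero]
  refine squeeze_zero (fun _ => norm_nonneg _) (fun u => ?_) hlim
  obtain ⟨c', G'⟩ := u
  set z' := proxPt Q a β c' G' with hz'
  obtain ⟨m1, m2⟩ := proxPt_spec hQ hne ha.le ha2 hβ c G
  obtain ⟨m1', m2'⟩ := proxPt_spec hQ hne ha.le ha2 hβ c' G'
  have g1 := proxObj_growth hQc ha ha2 hβ.le m1 m2 m1'
  have g2 := proxObj_growth hQc ha ha2 hβ.le m1' m2' m1
  rw [← hz, ← hz'] at g1 g2
  have hsym : normLp a (z - z') = normLp a (z' - z) := normLp_sub_comm a ha.le _ _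
  rw [hsym] at g2
  set r := normLp a (z' - z) with hr
  have hr0 : 0 ≤ r := normLp_nonneg a ha.le _
  have hδn : 0 ≤ δ (c', G') := normLp_nonneg a ha.le _
  have hN0 : 0 ≤ normLp a (z - c) := normLp_nonneg a ha.le _
  refine (norm_le_normLp ha.le ha2 _).trans (le_add_sqrt_of_sq_le (by positivity)
    (by positivity) ?_)
  have t1 : normLp a (z' - c) ≤ normLp a (z' - c') + δ (c', G') := by
    have := normLp_add_le a ha.le (z' - c') (c' - c)
    rw [normLp_sub_comm a ha.le c' c] at this
    simpa [hδ] using this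
  have t2 : normLp a (z - c') ≤ normLp a (z - c) + δ (c', G') := by
    have := normLp_add_le a ha.le (z - c) (c - c')
    simpa [hδ] using this
  have t3 : normLp a (z' - c) ≤ r + normLp a (z - c) := by
    have := normLp_add_le a ha.le (z' - z) (z - c)
    simpa using this
  have t4 : normLp a (z' - c) ^ 2 - normLp a (z' - c') ^ 2 ≤
      δ (c', G') * (2 * r + 2 * normLp a (z - c)) := by
    have p1 := normLp_nonneg a ha.le (z' - c)
    have p2 := normLp_nonneg a ha.le (z' - c')
    rcases le_total (normLp a (z' - c)) (normLp a (z' - c')) with h | h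
    · have : normLp a (z' - c) ^ 2 ≤ normLp a (z' - c') ^ 2 := by gcongr
      have : 0 ≤ δ (c', G') * (2 * r + 2 * normLp a (z - c)) := by positivity
      linarith
    · calc normLp a (z' - c) ^ 2 - normLp a (z' - c') ^ 2
          = (normLp a (z' - c) - normLp a (z' - c')) * (normLp a (z' - c) + normLp a (z' - c')) := by
            ring
        _ ≤ δ (c', G') * (2 * r + 2 * normLp a (z - c)) := by
            exact mul_le_mul (by linarith) (by linarith) (by linarith) hδn
  have t5 : normLp a (z - c') ^ 2 - normLp a (z - c) ^ 2 ≤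
      δ (c', G') * (2 * normLp a (z - c) + δ (c', G')) := by
    have := pow_le_pow_left₀ (normLp_nonneg a ha.le (z - c')) t2 2
    linarith
  have t6 : inner ℝ (G - G') (z' - z) ≤ ‖G - G'‖ * r :=
    (real_inner_le_norm _ _).trans (by gcongr; exact norm_le_normLp ha.le ha2 _)
  have t7 : inner ℝ (G - G') (z' - z) = inner ℝ G z' - inner ℝ G z - inner ℝ G' z' +
      inner ℝ G' z := by
    rw [inner_sub_left, inner_sub_right, inner_sub_right]; ring
  have main : 2 * κ * r ^ 2 ≤ (‖G - G'‖ + β * δ (c', G')) * r +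
      β * δ (c', G') * (2 * normLp a (z - c) + δ (c', G')) := by
    unfold proxObj at g1 g2
    rw [← hκ] at g1 g2
    have h1 := mul_le_mul_of_nonneg_left (add_le_add t4 t5) hβ.le
    have h2 := mul_nonneg hβ.le (mul_nonneg hδn hδn)
    linarith
  change r ^ 2 ≤ A (c', G') * r + B (c', G')
  simp only [hA, hB]
  rw [div_mul_eq_mul_div, ← add_div, le_div_iff₀ (by positivity)]
  linarith

/-! ### The estimate sequence of the accelerated method. -/

/-- The point at which the accelerated method queries its oracle in iteration `k`. -/
noncomputable def queryPt (k : ℕ) (x z : Vec d) : Vec d :=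
  ((k : ℝ) / (k + 2)) • x + ((2 : ℝ) / (k + 2)) • z

theorem queryPt_mem {Q : Set (Vec d)} (hQ : Convex ℝ Q) (k : ℕ) {x z : Vec d} (hx : x ∈ Q)
    (hz : z ∈ Q) : queryPt k x z ∈ Q :=
  hQ hx hz (by positivity) (by positivity) (by field_simp)

/-- One step of the estimate sequence argument for the accelerated method. -/
theorem accelerated_step {F : Vec d → ℝ} {h : Vec d → Vec d} {nr : Vec d → ℝ} {Q : Set (Vec d)}
    {L K σ W : ℝ} (hQ : Convex ℝ Q) (hnr : ∀ v, 0 ≤ nr v)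
    (hsm : ∀ (t : ℝ) v, nr (t • v) = |t| * nr v) (hL : 0 ≤ L) (hσ : 0 < σ)
    (hLσ : 8 * L ≤ σ)
    (hcvx : ∀ x ∈ Q, ∀ y ∈ Q, F y + inner ℝ (h y) (x - y) ≤ F x)
    (hup : ∀ x ∈ Q, ∀ y ∈ Q,
      F x ≤ F y + inner ℝ (h y) (x - y) + L * nr (x - y) ^ 2 + K * nr (x - y))
    (k : ℕ) {x z z' g : Vec d} (hx : x ∈ Q) (hz : z ∈ Q) (hz' : z' ∈ Q)
    (hW : ∀ v, |inner ℝ (g - h (queryPt k x z)) v| ≤ W * nr v) :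
    ((k : ℝ) + 1) * (k + 2) / 2 * F (queryPt k x z') ≤
      (k : ℝ) * (k + 1) / 2 * F x + (k + 1) * (F (queryPt k x z) +
        inner ℝ g (z' - queryPt k x z)) + σ / 2 * nr (z' - z) ^ 2
        + ((k : ℝ) + 1) ^ 2 * (2 * (W ^ 2 + K ^ 2) / σ)
        - (k + 1) * inner ℝ (g - h (queryPt k x z)) (z - queryPt k x z) := by
  set y := queryPt k x z with hy
  have hyQ : y ∈ Q := queryPt_mem hQ k hx hz
  have hxQ : queryPt k x z' ∈ Q := queryPt_mem hQ k hx hz'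
  have hk : (0 : ℝ) ≤ k := Nat.cast_nonneg k
  set w := nr (z' - z) with hw
  have hw0 : 0 ≤ w := hnr _
  have hdiff : queryPt k x z' - y = ((2 : ℝ) / (k + 2)) • (z' - z) := by
    rw [hy]; unfold queryPt; module
  have h1 := hup _ hxQ _ hyQ
  have h2 := hcvx x hx y hyQ
  rw [hdiff, hsm, abs_of_nonneg (by positivity), ← hw, inner_smul_right] at h1
  -- The query point is (k x + 2 z)/(k + 2), so the linear terms at x and at z cancel with weights k
  -- and 2.
  have hcomb : (k : ℝ) * inner ℝ (h y) (x - y) + 2 * inner ℝ (h y) (z - y) = 0 := by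
    rw [← inner_smul_right, ← inner_smul_right, ← inner_add_right]
    have : (k : ℝ) • (x - y) + (2 : ℝ) • (z - y) = 0 := by
      rw [hy]; unfold queryPt
      have hk2 : (k : ℝ) + 2 ≠ 0 := by positivity
      have e1 : (k : ℝ) • x + (2 : ℝ) • z
          = ((k : ℝ) + 2) • (((k : ℝ) / (k + 2)) • x + ((2 : ℝ) / (k + 2)) • z) := by
        rw [smul_add, smul_smul, smul_smul, mul_div_cancel₀ _ hk2, mul_div_cancel₀ _ hk2]
      rw [smul_sub, smul_sub, sub_add_sub_comm, e1, add_smul]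
      module
    rw [this, inner_zero_right]
  -- The step length 2/(k+2) squared against the weight (k+1)(k+2)/2 leaves 2(k+1)/(k+2) ≤ 2. This
  -- is why L enters with a factor independent of k.
  have hA : ((k : ℝ) + 1) * (k + 2) / 2 * F (queryPt k x z') ≤
      ((k : ℝ) + 1) * (k + 2) / 2 * F y + (k + 1) * inner ℝ (h y) (z' - z)
        + 2 * L * w ^ 2 + (k + 1) * K * w := by
    have := mul_le_mul_of_nonneg_left h1 (by positivity : (0:ℝ) ≤ ((k : ℝ) + 1) * (k + 2) / 2)
    refine this.trans ?_
    have e : ((k : ℝ) + 1) * (k + 2) / 2 * (F y + 2 / (k + 2) * inner ℝ (h y) (z' - z)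
        + L * (2 / (k + 2) * w) ^ 2 + K * (2 / (k + 2) * w)) =
        ((k : ℝ) + 1) * (k + 2) / 2 * F y + (k + 1) * inner ℝ (h y) (z' - z)
        + 2 * L * w ^ 2 * ((k + 1) / (k + 2)) + (k + 1) * K * w := by field_simp
    rw [e]
    have : 2 * L * w ^ 2 * (((k : ℝ) + 1) / (k + 2)) ≤ 2 * L * w ^ 2 * 1 := by
      gcongr; rw [div_le_one (by positivity)]; linarith
    linarith
  have hB := mul_le_mul_of_nonneg_left h2 (by positivity : (0:ℝ) ≤ (k : ℝ) * (k + 1) / 2)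
  have hg1 : inner ℝ g (z' - y) = inner ℝ (h y) (z' - z) + inner ℝ (h y) (z - y) +
      inner ℝ (g - h y) (z' - z) + inner ℝ (g - h y) (z - y) := by
    rw [inner_sub_left, inner_sub_left, show z' - y = (z' - z) + (z - y) by abel, inner_add_right]
    ring
  have hξ := (abs_le.1 (hW (z' - z))).1
  rw [← hw] at hξ
  -- The available term is σ/2 · w². Young's inequality spends σ/8 on the noise W and σ/8 on the
  -- nonsmooth part K; the remaining σ/4 covers 2L because 8L ≤ σ.
  have q1 : ((k : ℝ) + 1) * W * w ≤ ((k : ℝ) + 1) ^ 2 * (2 * W ^ 2 / σ) + σ / 8 * w ^ 2 := by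
    have e : ((k : ℝ) + 1) ^ 2 * (2 * W ^ 2 / σ) + σ / 8 * w ^ 2 - ((k : ℝ) + 1) * W * w =
      (4 * (((k : ℝ) + 1) * W) - σ * w) ^ 2 / (8 * σ) := by field_simp; ring
    have : 0 ≤ (4 * (((k : ℝ) + 1) * W) - σ * w) ^ 2 / (8 * σ) := by positivity
    linarith
  have q2 : ((k : ℝ) + 1) * K * w ≤ ((k : ℝ) + 1) ^ 2 * (2 * K ^ 2 / σ) + σ / 8 * w ^ 2 := by
    have e : ((k : ℝ) + 1) ^ 2 * (2 * K ^ 2 / σ) + σ / 8 * w ^ 2 - ((k : ℝ) + 1) * K * w =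
      (4 * (((k : ℝ) + 1) * K) - σ * w) ^ 2 / (8 * σ) := by field_simp; ring
    have : 0 ≤ (4 * (((k : ℝ) + 1) * K) - σ * w) ^ 2 / (8 * σ) := by positivity
    linarith
  have q3 : 2 * L * w ^ 2 ≤ σ / 4 * w ^ 2 := by gcongr; linarith
  have q4 : ((k : ℝ) + 1) ^ 2 * (2 * (W ^ 2 + K ^ 2) / σ) =
      ((k : ℝ) + 1) ^ 2 * (2 * W ^ 2 / σ) + ((k : ℝ) + 1) ^ 2 * (2 * K ^ 2 / σ) := by ring
  have hξ' := mul_le_mul_of_nonneg_left hξ (by positivity : (0:ℝ) ≤ (k : ℝ) + 1)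
  have hcomb' : (k : ℝ) * (k + 1) / 2 * inner ℝ (h y) (x - y) =
      - ((k + 1) * inner ℝ (h y) (z - y)) := by linear_combination ((k : ℝ) + 1) / 2 * hcomb
  rw [q4, hg1]
  linarith

/-- Deterministic estimate for the accelerated dual averaging method with inexact gradients. -/
theorem accelerated_estimate {F : Vec d → ℝ} {h : Vec d → Vec d} {nr : Vec d → ℝ}
    {Q : Set (Vec d)} {L K σ : ℝ} (hQ : Convex ℝ Q) (hnr : ∀ v, 0 ≤ nr v)
    (hsm : ∀ (t : ℝ) v, nr (t • v) = |t| * nr v) (hL : 0 ≤ L) (hσ : 0 < σ)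
    (hLσ : 8 * L ≤ σ)
    (hcvx : ∀ x ∈ Q, ∀ y ∈ Q, F y + inner ℝ (h y) (x - y) ≤ F x)
    (hup : ∀ x ∈ Q, ∀ y ∈ Q,
      F x ≤ F y + inner ℝ (h y) (x - y) + L * nr (x - y) ^ 2 + K * nr (x - y))
    {a : ℝ≥0∞} {β : ℝ} {c : Vec d} {x z G g : ℕ → Vec d} {W : ℕ → ℝ}
    (hG0 : G 0 = 0) (hz0 : z 0 = c) (hGs : ∀ k, G (k + 1) = G k + ((k : ℝ) + 1) • g k)
    (hxs : ∀ k, x (k + 1) = queryPt k (x k) (z (k + 1)))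
    (hxQ : ∀ k, x k ∈ Q) (hzQ : ∀ k, z k ∈ Q) (ha : 1 ≤ a)
    (hgrow : ∀ k, ∀ v ∈ Q,
      proxObj a β c (G k) (z k) + σ / 2 * nr (v - z k) ^ 2 ≤ proxObj a β c (G k) v)
    (hW : ∀ k v, |inner ℝ (g k - h (queryPt k (x k) (z k))) v| ≤ W k * nr v)
    {u : Vec d} (hu : u ∈ Q) (n : ℕ) :
    (n : ℝ) * (n + 1) / 2 * (F (x n) - F u) ≤ β * (normLp a (u - c) ^ 2 / 2) +
      ∑ k ∈ Finset.range n, (((k : ℝ) + 1) ^ 2 * (2 * (W k ^ 2 + K ^ 2) / σ) +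
        ((k : ℝ) + 1) * inner ℝ (g k - h (queryPt k (x k) (z k))) (u - z k)) := by
  set y : ℕ → Vec d := fun k => queryPt k (x k) (z k) with hy
  -- The invariant: the weighted value A_n F(x_n), with A_n = n(n+1)/2, stays below the minimal prox
  -- objective plus accumulated errors. In the induction the growth of the prox objective pays for
  -- the term σ/2 ‖z_{k+1} - z_k‖².
  have inv : ∀ n : ℕ, (n : ℝ) * (n + 1) / 2 * F (x n) ≤
      proxObj a β c (G n) (z n) + ∑ k ∈ Finset.range n,
        (((k : ℝ) + 1) * (F (y k) - inner ℝ (g k) (y k)) +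
        ((k : ℝ) + 1) ^ 2 * (2 * (W k ^ 2 + K ^ 2) / σ) -
        ((k : ℝ) + 1) * inner ℝ (g k - h (y k)) (z k - y k)) := by
    intro n
    induction n with
    | zero => simp [proxObj, hG0, hz0, normLp_zero a ha]
    | succ k ih =>
      have hs := accelerated_step hQ hnr hsm hL hσ hLσ hcvx hup k (hxQ k) (hzQ k) (hzQ (k + 1))
        (hW k)
      rw [← hxs k] at hs
      have hgr := hgrow k (z (k + 1)) (hzQ (k + 1))
      have hobj : proxObj a β c (G (k + 1)) (z (k + 1)) =
          proxObj a β c (G k) (z (k + 1)) + ((k : ℝ) + 1) * inner ℝ (g k) (z (k + 1)) := by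
        unfold proxObj; rw [hGs, inner_add_left, real_inner_smul_left]; ring
      rw [Finset.sum_range_succ, hobj]
      change _ ≤ _ + _ * (F (y k) + inner ℝ (g k) (z (k + 1) - y k)) + _ + _ -
        _ * inner ℝ (g k - h (y k)) (z k - y k) at hs
      rw [inner_sub_right] at hs
      push_cast
      have e : ((k : ℝ) + 1) * (k + 1 + 1) / 2 = ((k : ℝ) + 1) * (k + 2) / 2 := by ring
      rw [e]
      linarith
  have hGu : ∀ n : ℕ, inner ℝ (G n) u = ∑ k ∈ Finset.range n, ((k : ℝ) + 1) * inner ℝ (g k) u := by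
    intro n
    induction n with
    | zero => simp [hG0]
    | succ k ih => rw [hGs, inner_add_left, real_inner_smul_left, ih, Finset.sum_range_succ]
  have hFu : (n : ℝ) * (n + 1) / 2 * F u = ∑ k ∈ Finset.range n, ((k : ℝ) + 1) * F u := by
    rw [← Finset.sum_mul]
    congr 1
    induction n with
    | zero => simp
    | succ k ih => rw [Finset.sum_range_succ, ← ih]; push_cast; ring
  have h1 := inv n
  have h2 := hgrow n u hu
  have h3 : 0 ≤ σ / 2 * nr (u - z n) ^ 2 := by positivity
  have h4 : proxObj a β c (G n) u = inner ℝ (G n) u + β * (normLp a (u - c) ^ 2 / 2) := rfl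
  rw [h4, hGu] at h2
  rw [mul_sub, hFu]
  have key : ∑ k ∈ Finset.range n, ((k : ℝ) + 1) * inner ℝ (g k) u +
      ∑ k ∈ Finset.range n, (((k : ℝ) + 1) * (F (y k) - inner ℝ (g k) (y k)) +
        ((k : ℝ) + 1) ^ 2 * (2 * (W k ^ 2 + K ^ 2) / σ) -
        ((k : ℝ) + 1) * inner ℝ (g k - h (y k)) (z k - y k)) ≤
      ∑ k ∈ Finset.range n, ((k : ℝ) + 1) * F u +
      ∑ k ∈ Finset.range n, (((k : ℝ) + 1) ^ 2 * (2 * (W k ^ 2 + K ^ 2) / σ) +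
        ((k : ℝ) + 1) * inner ℝ (g k - h (y k)) (u - z k)) := by
    rw [← Finset.sum_add_distrib, ← Finset.sum_add_distrib]
    refine Finset.sum_le_sum fun k _ => ?_
    have hc := hcvx u hu (y k) (queryPt_mem hQ k (hxQ k) (hzQ k))
    have hc' := mul_le_mul_of_nonneg_left hc (by positivity : (0 : ℝ) ≤ (k : ℝ) + 1)
    have e : inner ℝ (g k) u - inner ℝ (g k) (y k) - inner ℝ (g k - h (y k)) (z k - y k) =
        inner ℝ (h (y k)) (u - y k) + inner ℝ (g k - h (y k)) (u - z k) := by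
      simp only [inner_sub_left, inner_sub_right]; ring
    have e' := congrArg (fun t => ((k : ℝ) + 1) * t) e
    linarith
  linarith

/-! ### The uniform distribution on the sphere as the direction of a Gaussian vector. -/

/-- Integration in polar coordinates of a product of a radial and an angular function. -/
theorem lintegral_polar (f : Vec d → ℝ≥0∞) (hf : Measurable f) (ψ : ℝ → ℝ≥0∞) (hψ : Measurable ψ)
    (hd : 0 < d) :
    ∫⁻ x : Vec d, f (‖x‖⁻¹ • x) * ψ ‖x‖ =
      (∫⁻ e : Sph d, f e ∂(volume : Measure (Vec d)).toSphere) *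
        ∫⁻ r, ψ r.1 ∂(Measure.volumeIoiPow (Module.finrank ℝ (Vec d) - 1)) := by
  have : Nonempty (Fin d) := ⟨⟨0, hd⟩⟩
  have hm := (volume : Measure (Vec d)).measurePreserving_homeomorphUnitSphereProd
  have h1 := hm.lintegral_comp_emb (Homeomorph.measurableEmbedding _)
    (fun q => f q.1 * ψ q.2.1)
  rw [lintegral_prod_mul (f := fun e : Sph d => f e) (g := fun r : Ioi (0 : ℝ) => ψ r.1)
    (by fun_prop) (by fun_prop)] at h1
  rw [← h1]
  simp only [homeomorphUnitSphereProd_apply_fst_coe, homeomorphUnitSphereProd_apply_snd_coe]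
  rw [lintegral_subtype_comap (measurableSet_singleton (0 : Vec d)).compl
    (fun x : Vec d => f (‖x‖⁻¹ • x) * ψ ‖x‖), restrict_compl_singleton]

/-- The standard Gaussian measure has a radial density. -/
theorem stdGaussian_eq_withDensity : ∃ ρ : ℝ → ℝ≥0∞, Measurable ρ ∧
    stdGaussian (Vec d) = (volume : Measure (Vec d)).withDensity fun x => ρ ‖x‖ := by
  set Z : ℝ := ∫ x : Vec d, Real.exp (-(1 / 2) * ‖x‖ ^ 2) with hZ
  have hb : 0 < ((1 / 2 : ℝ) : ℂ).re := by norm_num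
  have hint : Integrable (fun x : Vec d => Real.exp (-(1 / 2) * ‖x‖ ^ 2)) := by
    have := (GaussianFourier.integrable_cexp_neg_mul_sq_norm_add hb 0 (0 : Vec d)).re
    refine this.congr (.of_forall fun x => ?_)
    simp only [inner_zero_left, Complex.ofReal_zero, mul_zero, add_zero]
    rw [show -(((1 / 2 : ℝ)) : ℂ) * (‖x‖ : ℂ) ^ 2 = ((-(1 / 2) * ‖x‖ ^ 2 : ℝ) : ℂ) by
        push_cast; ring,
      ← Complex.ofReal_exp]
    rfl
  have hZpos : 0 < Z := by
    rw [hZ, GaussianFourier.integral_rexp_neg_mul_sq_norm (by norm_num)]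
    positivity
  have hZc : ((Z : ℝ) : ℂ) = ((Real.pi : ℂ) / ((1 / 2 : ℝ) : ℂ)) ^
      ((Module.finrank ℝ (Vec d) : ℂ) / 2) := by
    have := GaussianFourier.integral_cexp_neg_mul_sq_norm_add hb 0 (0 : Vec d)
    simp only [inner_zero_left, Complex.ofReal_zero, mul_zero, add_zero, norm_zero, ne_eq,
      OfNat.ofNat_ne_zero, not_false_eq_true, zero_pow, zero_div, Complex.exp_zero, mul_one] at this
    rw [← this, hZ, ← integral_complex_ofReal]
    congr 1; ext x; push_cast; ring_nf
  let ρ : ℝ → NNReal := fun r => Real.toNNReal (Z⁻¹ * Real.exp (-(1 / 2) * r ^ 2))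
  have hρ : Measurable ρ := by fun_prop
  refine ⟨fun r => ρ r, by fun_prop, ?_⟩
  have hfin : IsFiniteMeasure ((volume : Measure (Vec d)).withDensity fun x => (ρ ‖x‖ : ℝ≥0∞)) := by
    have := (hint.const_mul Z⁻¹).hasFiniteIntegral
    exact isFiniteMeasure_withDensity_ofReal this
  -- The density is identified by comparing characteristic functions.
  apply Measure.ext_of_charFun
  ext t
  rw [charFun_stdGaussian, charFun_apply,
    integral_withDensity_eq_integral_smul (f := fun x : Vec d => ρ ‖x‖) (by fun_prop)]
  have e : ∀ x : Vec d, ρ ‖x‖ • Complex.exp (↑(inner ℝ x t) * Complex.I) =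
      ((Z⁻¹ : ℝ) : ℂ) * Complex.exp (-((1 / 2 : ℝ) : ℂ) * ‖x‖ ^ 2 + Complex.I * ↑(inner ℝ t x)) := by
    intro x
    rw [NNReal.smul_def, Complex.exp_add, real_inner_comm, mul_comm Complex.I,
        Real.coe_toNNReal _ (by positivity),
      Complex.real_smul]
    push_cast
    ring
  simp_rw [e]
  rw [integral_const_mul, GaussianFourier.integral_cexp_neg_mul_sq_norm_add hb, ← hZc,
    ← mul_assoc, ← Complex.ofReal_mul, inv_mul_cancel₀ hZpos.ne', Complex.I_sq]
  simp only [Complex.ofReal_one, one_mul]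
  congr 1
  push_cast; ring

theorem unifSphere_eq : unifSphere d =
    ((volume : Measure (Vec d)).toSphere univ)⁻¹ • (volume : Measure (Vec d)).toSphere := rfl

theorem isProbabilityMeasure_unifSphere (hd : 0 < d) : IsProbabilityMeasure (unifSphere d) := by
  have : Nonempty (Fin d) := ⟨⟨0, hd⟩⟩
  refine ⟨?_⟩
  rw [unifSphere_eq, Measure.smul_apply, smul_eq_mul]
  exact ENNReal.inv_mul_cancel (fun h => Measure.toSphere_ne_zero (volume : Measure (Vec d))
    (Measure.measure_univ_eq_zero.1 h))
    (measure_ne_top _ _)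

/-- The direction and the length of a standard Gaussian vector are independent and the direction
is uniform on the sphere. -/
theorem lintegral_stdGaussian_polar (hd : 0 < d) (f : Vec d → ℝ≥0∞) (hf : Measurable f)
    (ψ : ℝ → ℝ≥0∞) (hψ : Measurable ψ) :
    ∫⁻ x, f (‖x‖⁻¹ • x) * ψ ‖x‖ ∂stdGaussian (Vec d) =
      (∫⁻ e : Sph d, f e ∂unifSphere d) * ∫⁻ x, ψ ‖x‖ ∂stdGaussian (Vec d) := by
  have : Nonempty (Fin d) := ⟨⟨0, hd⟩⟩
  obtain ⟨ρ, hρ, hG⟩ := stdGaussian_eq_withDensity (d := d)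
  have key : ∀ (f : Vec d → ℝ≥0∞) (_ : Measurable f) (ψ : ℝ → ℝ≥0∞) (_ : Measurable ψ),
      ∫⁻ x, f (‖x‖⁻¹ • x) * ψ ‖x‖ ∂stdGaussian (Vec d) =
      (∫⁻ e : Sph d, f e ∂(volume : Measure (Vec d)).toSphere) *
        ∫⁻ r, ρ r.1 * ψ r.1 ∂(Measure.volumeIoiPow (Module.finrank ℝ (Vec d) - 1)) := by
    intro f hf ψ hψ
    rw [hG, lintegral_withDensity_eq_lintegral_mul _ (by fun_prop) (by fun_prop),
      ← lintegral_polar f hf (fun r => ρ r * ψ r) (by fun_prop) hd]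
    refine lintegral_congr fun x => ?_
    simp only [Pi.mul_apply]; ring
  -- The case f = 1 expresses the radial integral through the Gaussian, so the radial density need
  -- not be known.
  have h1 := key (fun _ => 1) measurable_const ψ hψ
  simp only [one_mul, lintegral_one] at h1
  rw [key f hf ψ hψ, h1, unifSphere_eq, lintegral_smul_measure, smul_eq_mul]
  have hne : (volume : Measure (Vec d)).toSphere univ ≠ 0 :=
    fun h => Measure.toSphere_ne_zero (volume : Measure (Vec d)) (Measure.measure_univ_eq_zero.1 h)
  have hc := ENNReal.inv_mul_cancel hne (measure_ne_top _ _)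
  calc _ = (((volume : Measure (Vec d)).toSphere univ)⁻¹ * (volume : Measure (Vec d)).toSphere
      univ) *
      ((∫⁻ e : Sph d, f e ∂(volume : Measure (Vec d)).toSphere) *
        ∫⁻ r, ρ r.1 * ψ r.1 ∂(Measure.volumeIoiPow (Module.finrank ℝ (Vec d) - 1))) := by
        rw [hc, one_mul]
    _ = _ := by ring

theorem integral_stdGaussian_polar (hd : 0 < d) (f : Vec d → ℝ) (hf : Measurable f)
    (hf0 : ∀ x, 0 ≤ f x) (k : ℕ) :
    ∫ x, f (‖x‖⁻¹ • x) * ‖x‖ ^ k ∂stdGaussian (Vec d) =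
      (∫ e : Sph d, f e ∂unifSphere d) * ∫ x, ‖x‖ ^ k ∂stdGaussian (Vec d) := by
  have h := lintegral_stdGaussian_polar hd (fun x => ENNReal.ofReal (f x)) (by fun_prop)
    (fun r => ENNReal.ofReal (r ^ k)) (by fun_prop)
  rw [integral_eq_lintegral_of_nonneg_ae (.of_forall fun x => mul_nonneg (hf0 _) (by positivity))
    (by fun_prop), integral_eq_lintegral_of_nonneg_ae (.of_forall fun x => hf0 _)
    (hf.comp measurable_subtype_coe).aestronglyMeasurable, integral_eq_lintegral_of_nonneg_ae
        (.of_forall fun x => by positivity)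
    (by fun_prop), ← ENNReal.toReal_mul, ← h]
  congr 1
  refine lintegral_congr fun x => ?_
  rw [ENNReal.ofReal_mul (hf0 _)]

theorem map_neg_stdGaussian :
    (stdGaussian (Vec d)).map (fun x => -x) = stdGaussian (Vec d) :=
  stdGaussian_map (LinearIsometryEquiv.neg ℝ (E := Vec d))

theorem lintegral_unifSphere_neg (hd : 0 < d) (f : Vec d → ℝ≥0∞) (hf : Measurable f) :
    ∫⁻ e : Sph d, f (-(e : Vec d)) ∂unifSphere d = ∫⁻ e : Sph d, f e ∂unifSphere d := by
  have h1 := lintegral_stdGaussian_polar hd (fun x => f (-x)) (by fun_prop) (fun _ => 1)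
      (by fun_prop)
  have h2 := lintegral_stdGaussian_polar hd f hf (fun _ => 1) (by fun_prop)
  simp only [mul_one, lintegral_one, measure_univ] at h1 h2
  rw [← h1, ← h2]
  conv_rhs => rw [← map_neg_stdGaussian, lintegral_map (by fun_prop) (by fun_prop)]
  simp

/-- Inherited from the symmetry of the Gaussian; indicators of sets of the sphere are extended by
zero to ℝ^d to apply the integral version. -/
theorem map_neg_unifSphere (hd : 0 < d) :
    (unifSphere d).map (fun e : Sph d => -e) = unifSphere d := by
  have hneg : Measurable fun e : Sph d => -e := continuous_neg.measurable
  have hemb : MeasurableEmbedding (Subtype.val : Sph d → Vec d) :=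
    MeasurableEmbedding.subtype_coe Metric.isClosed_sphere.measurableSet
  ext s hs
  have h := lintegral_unifSphere_neg hd ((Subtype.val '' s).indicator 1)
    (measurable_one.indicator (hemb.measurableSet_image.2 hs))
  rw [Measure.map_apply hneg hs, ← lintegral_indicator_one (hneg hs), ← lintegral_indicator_one hs]
  have e1 : ∀ e : Sph d, (Subtype.val '' s).indicator (1 : Vec d → ℝ≥0∞) e = s.indicator 1 e := by
    intro e
    by_cases he : e ∈ s
    · rw [indicator_of_mem he, indicator_of_mem (mem_image_of_mem _ he)]; rfl
    · rw [indicator_of_notMem he, indicator_of_notMem]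
      rintro ⟨e', he', h'⟩
      exact he (Subtype.ext h' ▸ he')
  rw [← lintegral_congr e1, ← h]
  refine lintegral_congr fun e => ?_
  rw [show -(e : Vec d) = ((-e : Sph d) : Vec d) from rfl, e1]
  rfl

theorem integral_unifSphere_neg (hd : 0 < d) {E : Type*} [NormedAddCommGroup E] [NormedSpace ℝ E]
    (f : Sph d → E) (hf : Continuous f) :
    ∫ e : Sph d, f (-e) ∂unifSphere d = ∫ e : Sph d, f e ∂unifSphere d := by
  have := isProbabilityMeasure_unifSphere hd
  conv_rhs => rw [← map_neg_unifSphere hd]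
  rw [integral_map continuous_neg.aemeasurable hf.aestronglyMeasurable]

/-! ### Moments of Gaussian vectors and of uniform directions. -/

theorem integrable_norm_pow_stdGaussian (k : ℕ) :
    Integrable (fun x : Vec d => ‖x‖ ^ k) (stdGaussian (Vec d)) := by
  have h := IsGaussian.memLp_id (stdGaussian (Vec d)) (k : ℝ≥0∞) (by simp)
  exact h.integrable_norm_pow'

theorem integral_inner_sq_stdGaussian (v : Vec d) :
    ∫ x, inner ℝ x v ^ 2 ∂stdGaussian (Vec d) = ‖v‖ ^ 2 := by
  have h1 := variance_dual_stdGaussian (innerSL ℝ v)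
  have h0 := integral_strongDual_stdGaussian (innerSL ℝ v)
  rw [variance_eq_integral (by fun_prop), h0, innerSL_apply_norm] at h1
  rw [← h1]
  refine integral_congr_ae (.of_forall fun x => ?_)
  simp [real_inner_comm]

theorem integral_norm_sq_stdGaussian :
    ∫ x, ‖x‖ ^ 2 ∂stdGaussian (Vec d) = d := by
  have h : ∀ x : Vec d, ‖x‖ ^ 2 = ∑ i, inner ℝ x (EuclideanSpace.single i (1 : ℝ)) ^ 2 := by
    intro x
    rw [EuclideanSpace.real_norm_sq_eq]
    simp [EuclideanSpace.inner_single_right]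
  simp_rw [h]
  rw [integral_finsetSum]
  · simp [integral_inner_sq_stdGaussian]
  · intro i _
    refine (integrable_norm_pow_stdGaussian 2).mono' (by fun_prop) (.of_forall fun x => ?_)
    simp only [EuclideanSpace.inner_single_right, one_mul, norm_pow]
    gcongr
    exact PiLp.norm_apply_le x i

/-- The Gaussian second moment ‖v‖² factors as the spherical one times E‖x‖² = d. This identity is
the source of the √d in the smoothness constant. -/
theorem integral_inner_sq_unifSphere (hd : 0 < d) (v : Vec d) :
    ∫ e : Sph d, inner ℝ (e : Vec d) v ^ 2 ∂unifSphere d = ‖v‖ ^ 2 / d := by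
  have h := integral_stdGaussian_polar hd (fun w => inner ℝ w v ^ 2) (by fun_prop)
    (fun x => sq_nonneg _) 2
  have e : ∀ x : Vec d, inner ℝ (‖x‖⁻¹ • x) v ^ 2 * ‖x‖ ^ 2 = inner ℝ x v ^ 2 := by
    intro x
    rcases eq_or_ne x 0 with rfl | hx
    · simp
    · have := norm_ne_zero_iff.2 hx
      rw [real_inner_smul_left]; field_simp
  simp only [e] at h
  rw [integral_inner_sq_stdGaussian, integral_norm_sq_stdGaussian] at h
  rw [h]
  have : (d : ℝ) ≠ 0 := by positivity
  field_simp

/-- Jensen for E‖x‖² = d, done by hand: Bernoulli bounds (‖x‖²/d)^m below by an affine function of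
‖x‖² with mean 1. -/
theorem pow_le_integral_norm_pow_stdGaussian (hd : 0 < d) (m : ℕ) :
    (d : ℝ) ^ m ≤ ∫ x, ‖x‖ ^ (2 * m) ∂stdGaussian (Vec d) := by
  have hd' : (0 : ℝ) < d := by exact_mod_cast hd
  have h : ∀ x : Vec d, (d : ℝ) ^ m * (1 + m * (‖x‖ ^ 2 / d - 1)) ≤ ‖x‖ ^ (2 * m) := by
    intro x
    have := one_add_mul_le_pow (a := ‖x‖ ^ 2 / d - 1) (by
      have : 0 ≤ ‖x‖ ^ 2 / d := by positivity
      linarith) m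
    calc (d : ℝ) ^ m * (1 + m * (‖x‖ ^ 2 / d - 1)) ≤ (d : ℝ) ^ m * (1 + (‖x‖ ^ 2 / d - 1)) ^ m := by
          gcongr
      _ = _ := by rw [← mul_pow, pow_mul]; congr 1; field_simp; ring
  have i2 := integrable_norm_pow_stdGaussian (d := d) 2
  have i3 : Integrable (fun x : Vec d => (m : ℝ) * (‖x‖ ^ 2 / d - 1)) (stdGaussian (Vec d)) :=
    ((i2.div_const _).sub (integrable_const 1)).const_mul _
  have hint : Integrable (fun x : Vec d => (d : ℝ) ^ m * (1 + m * (‖x‖ ^ 2 / d - 1)))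
      (stdGaussian (Vec d)) :=
    ((integrable_const 1).add i3).const_mul _
  refine le_trans (le_of_eq ?_) (integral_mono hint (integrable_norm_pow_stdGaussian _) h)
  rw [integral_const_mul, integral_add (integrable_const 1) i3, integral_const_mul,
    integral_sub (i2.div_const _) (integrable_const 1), integral_div, integral_norm_sq_stdGaussian,
    div_self hd'.ne']
  simp

/-- Chernoff-type moment bound: y^{2m}/(2m)! ≤ e^{|y|} at y = t x_i, then the Gaussian moment
generating function. -/
theorem integral_apply_pow_stdGaussian_le (i : Fin d) {m : ℕ} (hm : 1 ≤ m) :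
    ∫ x, (x i) ^ (2 * m) ∂stdGaussian (Vec d) ≤ (12 * m : ℝ) ^ m := by
  have hm0 : (0 : ℝ) < m := by exact_mod_cast hm
  have hmap : (stdGaussian (Vec d)).map (fun x : Vec d => x i) = gaussianReal 0 1 := by
    have h := IsGaussian.map_eq_gaussianReal (μ := stdGaussian (Vec d))
      (EuclideanSpace.proj i : Vec d →L[ℝ] ℝ)
    rw [integral_strongDual_stdGaussian, variance_dual_stdGaussian] at h
    have hn : ‖(EuclideanSpace.proj i : Vec d →L[ℝ] ℝ)‖ = 1 := by
      have : (EuclideanSpace.proj i : Vec d →L[ℝ] ℝ)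
          = innerSL ℝ (EuclideanSpace.single i (1 : ℝ)) := by
        ext x; simp [EuclideanSpace.inner_single_left]
      rw [this, innerSL_apply_norm]; simp
    rw [hn] at h
    simpa using h
  -- With t² = 2m the moment generating function equals e^m. Then (2m)! ≤ (2m)^{2m}, e ≤ 3 and 2 ≤
  -- 2^m assemble to (2·3·2·m)^m.
  set t := √(2 * m : ℝ) with ht
  have ht0 : 0 < t := by positivity
  have ht2 : t ^ 2 = 2 * m := Real.sq_sqrt (by positivity)
  have hmgf : ∀ s : ℝ, ∫ x : Vec d, Real.exp (s * x i) ∂stdGaussian (Vec d) =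
      Real.exp (s ^ 2 / 2) := by
    intro s
    have := mgf_gaussianReal hmap s
    simpa [mgf] using this
  have hint : ∀ s : ℝ, Integrable (fun x : Vec d => Real.exp (s * x i)) (stdGaussian (Vec d)) := by
    intro s
    have := integrable_exp_mul_gaussianReal (μ := 0) (v := 1) s
    rw [← hmap] at this
    exact this.comp_measurable (by fun_prop)
  have hle : ∀ x : Vec d, (x i) ^ (2 * m) ≤ ((2 * m).factorial : ℝ) / t ^ (2 * m) *
      (Real.exp (t * x i) + Real.exp (-t * x i)) := by
    intro x
    have h1 := Real.pow_div_factorial_le_exp (|t * x i|) (abs_nonneg _) (2 * m)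
    rw [(even_two_mul m).pow_abs, mul_pow] at h1
    have h2 : Real.exp (|t * x i|) ≤ Real.exp (t * x i) + Real.exp (-t * x i) := by
      rcases abs_cases (t * x i) with ⟨h, _⟩ | ⟨h, _⟩ <;> rw [h]
      · linarith [Real.exp_pos (-t * x i)]
      · rw [← neg_mul]; linarith [Real.exp_pos (t * x i)]
    have h3 := h1.trans h2
    rw [div_le_iff₀ (by positivity)] at h3
    rw [div_mul_eq_mul_div, le_div_iff₀ (by positivity)]
    linarith
  have hmono := integral_mono_of_nonneg (μ := stdGaussian (Vec d))
    (.of_forall fun x => (even_two_mul m).pow_nonneg _)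
    (((hint t).add (hint (-t))).const_mul _) (.of_forall hle)
  refine hmono.trans ?_
  rw [integral_const_mul, integral_add' (hint t) (hint (-t)), hmgf, hmgf, neg_sq, ht2, pow_mul, ht2]
  have hfac : ((2 * m).factorial : ℝ) ≤ (2 * m : ℝ) ^ (2 * m) := by
    exact_mod_cast Nat.factorial_le_pow (2 * m)
  have hexp : Real.exp (2 * m / 2) = Real.exp 1 ^ m := by
    rw [← Real.exp_nat_mul]; congr 1; ring
  have he : Real.exp 1 ≤ 3 := by linarith [Real.exp_one_lt_d9]
  rw [hexp]
  calc ((2 * m).factorial : ℝ) / (2 * m) ^ m * (Real.exp 1 ^ m + Real.exp 1 ^ m)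
      ≤ (2 * m : ℝ) ^ (2 * m) / (2 * m) ^ m * (3 ^ m + 3 ^ m) := by gcongr
    _ = (2 * m : ℝ) ^ m * 3 ^ m * 2 := by rw [two_mul m, pow_add]; field_simp; ring
    _ ≤ (2 * m : ℝ) ^ m * 3 ^ m * 2 ^ m := by
        gcongr
        exact le_self_pow₀ (by norm_num) (by omega)
    _ = (12 * m : ℝ) ^ m := by rw [← mul_pow, ← mul_pow]; ring_nf

/-- The Gaussian moment of a coordinate is the spherical one times E‖x‖^{2m}, and the latter is at
least d^m. -/
theorem integral_apply_pow_unifSphere_le (hd : 0 < d) (i : Fin d) {m : ℕ} (hm : 1 ≤ m) :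
    ∫ e : Sph d, ((e : Vec d) i) ^ (2 * m) ∂unifSphere d ≤ (12 * m / d : ℝ) ^ m := by
  have hd' : (0 : ℝ) < d := by exact_mod_cast hd
  have h := integral_stdGaussian_polar hd (fun w => (w i) ^ (2 * m)) (by fun_prop)
    (fun x => (even_two_mul m).pow_nonneg _) (2 * m)
  have e : ∀ x : Vec d, ((‖x‖⁻¹ • x) i) ^ (2 * m) * ‖x‖ ^ (2 * m) = (x i) ^ (2 * m) := by
    intro x
    rcases eq_or_ne x 0 with rfl | hx
    · simp [show m ≠ 0 by omega]
    · have := norm_ne_zero_iff.2 hx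
      rw [← mul_pow]; congr 1
      simp only [PiLp.smul_apply, smul_eq_mul]; field_simp
  simp only [e] at h
  have h1 := integral_apply_pow_stdGaussian_le i hm
  have h2 := pow_le_integral_norm_pow_stdGaussian hd m
  have h3 : 0 ≤ ∫ e : Sph d, ((e : Vec d) i) ^ (2 * m) ∂unifSphere d :=
    integral_nonneg fun _ => (even_two_mul m).pow_nonneg _
  rw [div_pow, le_div_iff₀ (by positivity)]
  calc _ ≤ (∫ e : Sph d, ((e : Vec d) i) ^ (2 * m) ∂unifSphere d) *
        ∫ x, ‖x‖ ^ (2 * m) ∂stdGaussian (Vec d) := by gcongr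
    _ ≤ _ := by rw [← h]; exact h1

/-! ### Gaussian Poincaré by rotations, and its transfer to the sphere. -/

theorem integral_fderiv_sq_stdGaussian_le {K : NNReal} (L : Vec d →L[ℝ] ℝ) (hL : ‖L‖ ≤ K) :
    ∫ y, (L y) ^ 2 ∂stdGaussian (Vec d) ≤ (K : ℝ) ^ 2 := by
  have h1 := variance_dual_stdGaussian L
  rw [variance_eq_integral (by fun_prop), integral_strongDual_stdGaussian] at h1
  simp only [sub_zero] at h1
  rw [h1]
  gcongr

/-- A rotation by δ moves the first component by at most δ(‖u₁‖ + ‖u₂‖), as 1 - cos δ ≤ δ²/2 ≤ δ.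
The factor δ² makes the rescaled increments uniformly dominated as δ → 0. -/
theorem sq_sub_le_rotation {F : Vec d → ℝ} {K : NNReal} (hF : LipschitzWith K F) {δ : ℝ}
    (hδ : 0 ≤ δ) (hδ2 : δ ≤ 2) (u : Vec d × Vec d) :
    (F (Real.cos δ • u.1 + Real.sin δ • u.2) - F u.1) ^ 2 ≤
      (K : ℝ) ^ 2 * δ ^ 2 * (2 * ‖u.1‖ ^ 2 + 2 * ‖u.2‖ ^ 2) := by
  have h1 : |F (Real.cos δ • u.1 + Real.sin δ • u.2) - F u.1| ≤ K * (δ * (‖u.1‖ + ‖u.2‖)) := by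
    refine (hF.norm_sub_le _ _).trans ?_
    gcongr
    have e : Real.cos δ • u.1 + Real.sin δ • u.2 - u.1
        = (Real.cos δ - 1) • u.1 + Real.sin δ • u.2 := by module
    rw [e, mul_add]
    refine (norm_add_le _ _).trans ?_
    rw [norm_smul, norm_smul]
    gcongr
    · rw [Real.norm_eq_abs, abs_sub_comm, abs_of_nonneg (by linarith [Real.cos_le_one δ])]
      have := Real.one_sub_sq_div_two_le_cos (x := δ)
      nlinarith
    · rw [Real.norm_eq_abs]
      exact (Real.abs_sin_le_abs).trans (le_of_eq (abs_of_nonneg hδ))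
  rw [← sq_abs]
  calc _ ≤ (K * (δ * (‖u.1‖ + ‖u.2‖))) ^ 2 := by gcongr
    _ = (K : ℝ) ^ 2 * δ ^ 2 * (‖u.1‖ + ‖u.2‖) ^ 2 := by ring
    _ ≤ _ := by
      gcongr
      linarith [sq_nonneg (‖u.1‖ - ‖u.2‖)]

theorem integrable_norm_sq_prod_stdGaussian :
    Integrable (fun u : Vec d × Vec d => 2 * ‖u.1‖ ^ 2 + 2 * ‖u.2‖ ^ 2)
      ((stdGaussian (Vec d)).prod (stdGaussian (Vec d))) :=
  (((integrable_norm_pow_stdGaussian 2).comp_fst _).const_mul 2).add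
    (((integrable_norm_pow_stdGaussian 2).comp_snd _).const_mul 2)

/-- The path of rotations joins u₁ to u₂ in N equal steps. Cauchy-Schwarz gives N times the sum of
the squared increments, and rotation invariance of the Gaussian pair makes all N of them equal in
mean. -/
theorem integral_sq_sub_le_rotation {F : Vec d → ℝ} {K : NNReal} (hF : LipschitzWith K F) {N : ℕ}
    (hN : 1 ≤ N) :
    ∫ u : Vec d × Vec d, (F u.2 - F u.1) ^ 2 ∂(stdGaussian (Vec d)).prod (stdGaussian (Vec d)) ≤
    ∫ u : Vec d × Vec d, (N : ℝ) ^ 2 * (F (Real.cos (Real.pi / (2 * N)) • u.1 +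
      Real.sin (Real.pi / (2 * N)) • u.2) - F u.1) ^ 2
      ∂(stdGaussian (Vec d)).prod (stdGaussian (Vec d)) := by
  set μ := (stdGaussian (Vec d)).prod (stdGaussian (Vec d)) with hμ
  have hN0 : (0 : ℝ) < N := by exact_mod_cast hN
  set δ : ℝ := Real.pi / (2 * N) with hδ
  have hδ0 : 0 ≤ δ := by positivity
  have hδ2 : δ ≤ 2 := by
    rw [hδ, div_le_iff₀ (by positivity)]
    have : (1 : ℝ) ≤ N := by exact_mod_cast hN
    linarith [Real.pi_le_four]
  set Ψ : Vec d × Vec d → ℝ := fun u =>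
      (F (Real.cos δ • u.1 + Real.sin δ • u.2) - F u.1) ^ 2 with hΨ
  have hFc := hF.continuous
  have hΨc : Continuous Ψ := by fun_prop
  have hΨint : Integrable Ψ μ := by
    refine (integrable_norm_sq_prod_stdGaussian.const_mul ((K : ℝ) ^ 2 * δ ^ 2)).mono'
      hΨc.aestronglyMeasurable (.of_forall fun u => ?_)
    rw [Real.norm_eq_abs, abs_of_nonneg (sq_nonneg _)]
    exact sq_sub_le_rotation hF hδ0 hδ2 u
  have hrot : ∀ θ : ℝ, μ.map (ContinuousLinearMap.rotation θ) = μ := fun θ =>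
    IsGaussian.map_rotation_eq_self (by simp) θ
  have hrotint : ∀ θ : ℝ, Integrable (fun u => Ψ (ContinuousLinearMap.rotation θ u)) μ := by
    intro θ
    have := hΨint
    rw [← hrot θ] at this
    exact this.comp_measurable (by fun_prop)
  have hroteq : ∀ θ : ℝ, ∫ u, Ψ (ContinuousLinearMap.rotation θ u) ∂μ = ∫ u, Ψ u ∂μ := by
    intro θ
    conv_rhs => rw [← hrot θ]
    rw [integral_map (by fun_prop) hΨc.aestronglyMeasurable]
  have hpt : ∀ u : Vec d × Vec d, (F u.2 - F u.1) ^ 2 ≤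
      N * ∑ j ∈ Finset.range N, Ψ (ContinuousLinearMap.rotation (j * δ) u) := by
    intro u
    set X : ℕ → ℝ := fun j => F (Real.cos (j * δ) • u.1 + Real.sin (j * δ) • u.2) with hX
    have hX0 : X 0 = F u.1 := by simp [hX]
    have hXN : X N = F u.2 := by
      have : (N : ℝ) * δ = Real.pi / 2 := by rw [hδ]; field_simp
      simp [hX, this]
    have hstep : ∀ j : ℕ, Ψ (ContinuousLinearMap.rotation (j * δ) u) = (X (j + 1) - X j) ^ 2 := by
      intro j
      simp only [hΨ, hX, ContinuousLinearMap.rotation_apply]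
      push_cast
      rw [add_mul, one_mul, Real.cos_add, Real.sin_add]
      have e : Real.cos δ • (Real.cos (j * δ) • u.1 + Real.sin (j * δ) • u.2) +
          Real.sin δ • (-Real.sin (j * δ) • u.1 + Real.cos (j * δ) • u.2) =
          (Real.cos (j * δ) * Real.cos δ - Real.sin (j * δ) * Real.sin δ) • u.1 +
          (Real.sin (j * δ) * Real.cos δ + Real.cos (j * δ) * Real.sin δ) • u.2 := by module
      rw [e]
    rw [← hX0, ← hXN, ← Finset.sum_range_sub]
    simp_rw [hstep]
    have := sq_sum_le_card_mul_sum_sq (s := Finset.range N) (f := fun j => X (j + 1) - X j)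
    rwa [Finset.card_range] at this
  calc _ ≤ ∫ u, N * ∑ j ∈ Finset.range N, Ψ (ContinuousLinearMap.rotation (j * δ) u) ∂μ := by
        refine integral_mono_of_nonneg (.of_forall fun u => sq_nonneg _) ?_ (.of_forall hpt)
        exact (integrable_finsetSum _ fun j _ => hrotint _).const_mul _
    _ = _ := by
        rw [integral_const_mul, integral_finsetSum _ fun j _ => hrotint _, integral_const_mul]
        simp_rw [hroteq]
        simp
        ring

/-- The Gaussian Poincaré inequality for Lipschitz functions. -/
theorem integral_sq_sub_stdGaussian_le {F : Vec d → ℝ} {K : NNReal} (hF : LipschitzWith K F) :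
    ∫ u : Vec d × Vec d, (F u.2 - F u.1) ^ 2 ∂(stdGaussian (Vec d)).prod (stdGaussian (Vec d)) ≤
      (Real.pi / 2) ^ 2 * (K : ℝ) ^ 2 := by
  set μ := (stdGaussian (Vec d)).prod (stdGaussian (Vec d)) with hμ
  have hFc := hF.continuous
  set T : ℕ → Vec d × Vec d → ℝ := fun N u => ((N : ℝ) + 1) ^ 2 *
    (F (Real.cos (Real.pi / (2 * ((N : ℝ) + 1))) • u.1 +
      Real.sin (Real.pi / (2 * ((N : ℝ) + 1))) • u.2) - F u.1) ^ 2 with hT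
  -- Rademacher's theorem, usable because the Gaussian is absolutely continuous. The increments,
  -- rescaled by N + 1, then converge to (π/2) DF(u₁)u₂, whose conditional second moment given u₁ is
  -- at most (π/2)²K².
  have hae : ∀ᵐ u ∂μ, DifferentiableAt ℝ F u.1 := by
    obtain ⟨ρ, hρ, hG⟩ := stdGaussian_eq_withDensity (d := d)
    have h1 : ∀ᵐ x ∂stdGaussian (Vec d), DifferentiableAt ℝ F x := by
      rw [hG]
      exact (withDensity_absolutelyContinuous _ _).ae_le hF.ae_differentiableAt
    exact Measure.quasiMeasurePreserving_fst.ae h1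
  have hlim : Filter.Tendsto (fun N => ∫ u, T N u ∂μ) Filter.atTop
      (nhds (∫ u, (Real.pi / 2 * fderiv ℝ F u.1 u.2) ^ 2 ∂μ)) := by
    refine tendsto_integral_of_dominated_convergence
      (fun u => (K : ℝ) ^ 2 * (Real.pi / 2) ^ 2 * (2 * ‖u.1‖ ^ 2 + 2 * ‖u.2‖ ^ 2)) ?_ ?_ ?_ ?_
    · intro N
      exact Continuous.aestronglyMeasurable (by fun_prop)
    · exact integrable_norm_sq_prod_stdGaussian.const_mul _
    · intro N
      refine .of_forall fun u => ?_
      rw [Real.norm_eq_abs, abs_of_nonneg (by positivity)]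
      have hN0 : (0 : ℝ) ≤ N := Nat.cast_nonneg N
      have h := sq_sub_le_rotation hF (δ := Real.pi / (2 * ((N : ℝ) + 1))) (by positivity)
        (by rw [div_le_iff₀ (by positivity)]; linarith [Real.pi_le_four]) u
      calc T N u ≤ ((N : ℝ) + 1) ^ 2 * ((K : ℝ) ^ 2 * (Real.pi / (2 * ((N : ℝ) + 1))) ^ 2 *
            (2 * ‖u.1‖ ^ 2 + 2 * ‖u.2‖ ^ 2)) := by
              simp only [hT]; gcongr
        _ = _ := by field_simp
    · filter_upwards [hae] with u hu
      have hcurve : HasDerivAt (fun s : ℝ => Real.cos s • u.1 + Real.sin s • u.2) u.2 0 := by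
        have h1 : HasDerivAt (fun s : ℝ => Real.cos s • u.1 + Real.sin s • u.2)
            (-Real.sin 0 • u.1 + Real.cos 0 • u.2) 0 := ((Real.hasDerivAt_cos 0).smul_const u.1).add
          ((Real.hasDerivAt_sin 0).smul_const u.2)
        simpa using h1
      have hu' : HasFDerivAt F (fderiv ℝ F u.1) (Real.cos 0 • u.1 + Real.sin 0 • u.2) := by
        simpa using hu.hasFDerivAt
      have hcomp := hu'.comp_hasDerivAt (0 : ℝ) hcurve
      have hslope := hcomp.tendsto_slope_zero
      have hδ : Filter.Tendsto (fun N : ℕ => Real.pi / (2 * ((N : ℝ) + 1))) Filter.atTop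
          (nhdsWithin 0 {0}ᶜ) := by
        refine tendsto_nhdsWithin_iff.2 ⟨?_, .of_forall fun N => ?_⟩
        · have := (tendsto_one_div_add_atTop_nhds_zero_nat (𝕜 := ℝ)).const_mul (Real.pi / 2)
          rw [mul_zero] at this
          refine this.congr fun N => ?_
          field_simp
        · have : 0 < Real.pi / (2 * ((N : ℝ) + 1)) := by positivity
          exact this.ne'
      have h := ((hslope.comp hδ).const_mul (Real.pi / 2)).pow 2
      refine h.congr fun N => ?_
      simp only [hT, Function.comp_apply, zero_add, Real.cos_zero, Real.sin_zero, one_smul,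
        zero_smul, add_zero, smul_eq_mul]
      have : (N : ℝ) + 1 ≠ 0 := by positivity
      field_simp
  have hbound : ∀ N, ∫ u : Vec d × Vec d, (F u.2 - F u.1) ^ 2 ∂μ ≤ ∫ u, T N u ∂μ := by
    intro N
    have := integral_sq_sub_le_rotation hF (N := N + 1) (by omega)
    push_cast at this
    exact this
  refine (ge_of_tendsto' hlim hbound).trans ?_
  have hL : ∀ x, ‖fderiv ℝ F x‖ ≤ K := fun x => norm_fderiv_le_of_lipschitz ℝ hF
  have hsq : ∀ x : Vec d, ∫ y, (Real.pi / 2 * fderiv ℝ F x y) ^ 2 ∂stdGaussian (Vec d) ≤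
      (Real.pi / 2) ^ 2 * (K : ℝ) ^ 2 := by
    intro x
    simp_rw [mul_pow]
    rw [integral_const_mul]
    gcongr
    exact integral_fderiv_sq_stdGaussian_le _ (hL x)
  have hmeas : Measurable fun u : Vec d × Vec d => fderiv ℝ F u.1 u.2 := by
    have : Measurable fun u : Vec d × Vec d => fderiv ℝ F u.1 :=
      (measurable_fderiv ℝ F).comp measurable_fst
    exact (isBoundedBilinearMap_apply (𝕜 := ℝ) (E := Vec d) (F := ℝ)).continuous.measurable.comp
      (this.prodMk measurable_snd)
  have hint : Integrable (fun u : Vec d × Vec d => (Real.pi / 2 * fderiv ℝ F u.1 u.2) ^ 2) μ := by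
    refine (integrable_norm_sq_prod_stdGaussian.const_mul ((Real.pi / 2) ^ 2 * (K : ℝ) ^ 2)).mono'
      ((hmeas.const_mul _).pow_const 2).aestronglyMeasurable (.of_forall fun u => ?_)
    rw [Real.norm_eq_abs, abs_of_nonneg (sq_nonneg _), mul_pow, mul_assoc]
    gcongr
    rw [← sq_abs]
    have h1 : |fderiv ℝ F u.1 u.2| ≤ K * ‖u.2‖ :=
      ((fderiv ℝ F u.1).le_opNorm u.2).trans (by gcongr; exact hL _)
    calc _ ≤ (K * ‖u.2‖) ^ 2 := by gcongr
      _ ≤ _ := by rw [mul_pow]; gcongr; nlinarith [sq_nonneg ‖u.1‖, sq_nonneg ‖u.2‖]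
  rw [hμ, integral_prod _ hint]
  calc _ ≤ ∫ _x : Vec d, (Real.pi / 2) ^ 2 * (K : ℝ) ^ 2 ∂stdGaussian (Vec d) :=
        integral_mono hint.integral_prod_left (integrable_const _) hsq
    _ = _ := by simp

/-- The positively homogeneous extension of the restriction to the sphere of a Lipschitz function
vanishing at the origin is Lipschitz. -/
theorem lipschitzWith_homogeneous {φ : Vec d → ℝ} {K : NNReal} (hφ : LipschitzWith K φ)
    (h0 : φ 0 = 0) : LipschitzWith (3 * K) fun x => ‖x‖ * φ (‖x‖⁻¹ • x) := by
  have hb : ∀ x : Vec d, |φ (‖x‖⁻¹ • x)| ≤ K := by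
    intro x
    have h1 := hφ.norm_sub_le (‖x‖⁻¹ • x) 0
    rw [h0, sub_zero, sub_zero, norm_smul, norm_inv, norm_norm] at h1
    refine h1.trans ?_
    have : ‖x‖⁻¹ * ‖x‖ ≤ 1 := by
      rcases eq_or_ne x 0 with rfl | hx
      · simp
      · rw [inv_mul_cancel₀ (norm_ne_zero_iff.2 hx)]
    have hK : (0 : ℝ) ≤ K := K.2
    nlinarith
  refine LipschitzWith.of_dist_le_mul fun x y => ?_
  rw [Real.dist_eq, dist_eq_norm]
  push_cast
  have hKn : 0 ≤ (K : ℝ) := K.2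
  rcases eq_or_ne x 0 with rfl | hx
  · simp only [norm_zero, zero_mul, zero_sub, abs_neg, norm_neg, abs_mul, abs_norm]
    have := mul_le_mul_of_nonneg_left (hb y) (norm_nonneg y)
    nlinarith [norm_nonneg y]
  rcases eq_or_ne y 0 with rfl | hy
  · simp only [norm_zero, zero_mul, sub_zero, abs_mul, abs_norm]
    have := mul_le_mul_of_nonneg_left (hb x) (norm_nonneg x)
    nlinarith [norm_nonneg x]
  have hxn : ‖x‖ ≠ 0 := norm_ne_zero_iff.2 hx
  have hyn : ‖y‖ ≠ 0 := norm_ne_zero_iff.2 hy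
  have e : ‖x‖ * φ (‖x‖⁻¹ • x) - ‖y‖ * φ (‖y‖⁻¹ • y) =
      (‖x‖ - ‖y‖) * φ (‖x‖⁻¹ • x) + ‖y‖ * (φ (‖x‖⁻¹ • x) - φ (‖y‖⁻¹ • y)) := by ring
  rw [e]
  refine (abs_add_le _ _).trans ?_
  rw [abs_mul, abs_mul, abs_norm]
  -- The constant 3 is 1 for the change of radius plus 2 for the change of direction.
  have h1 : |‖x‖ - ‖y‖| * |φ (‖x‖⁻¹ • x)| ≤ ‖x - y‖ * K := by
    gcongr
    · exact abs_norm_sub_norm_le x y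
    · exact hb x
  have h2 : ‖y‖ * ‖‖x‖⁻¹ • x - ‖y‖⁻¹ • y‖ ≤ 2 * ‖x - y‖ := by
    have : ‖y‖ * ‖‖x‖⁻¹ • x - ‖y‖⁻¹ • y‖ = ‖(‖y‖ - ‖x‖) • (‖x‖⁻¹ • x) + (x - y)‖ := by
      rw [← norm_norm y, ← norm_smul, norm_norm]
      congr 1
      rw [smul_sub, smul_smul, smul_smul, smul_smul, mul_inv_cancel₀ hyn, one_smul, sub_mul,
        mul_inv_cancel₀ hxn, sub_smul, one_smul]
      abel
    rw [this]
    refine (norm_add_le _ _).trans ?_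
    rw [norm_smul, norm_smul, norm_inv, norm_norm, inv_mul_cancel₀ hxn, mul_one, Real.norm_eq_abs]
    have := abs_norm_sub_norm_le y x
    rw [norm_sub_rev y x] at this
    linarith
  have h3 : |φ (‖x‖⁻¹ • x) - φ (‖y‖⁻¹ • y)| ≤ K * ‖‖x‖⁻¹ • x - ‖y‖⁻¹ • y‖ := hφ.norm_sub_le _ _
  have h4 : ‖y‖ * |φ (‖x‖⁻¹ • x) - φ (‖y‖⁻¹ • y)| ≤ K * (2 * ‖x - y‖) :=
    calc _ ≤ ‖y‖ * (K * ‖‖x‖⁻¹ • x - ‖y‖⁻¹ • y‖) := by gcongr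
      _ = K * (‖y‖ * ‖‖x‖⁻¹ • x - ‖y‖⁻¹ • y‖) := by ring
      _ ≤ _ := by gcongr
  linarith

/-- An odd Lipschitz function on the sphere has variance `O(1 / d)`. -/
theorem integral_sq_unifSphere_le (hd : 0 < d) {φ : Vec d → ℝ} {K : NNReal}
    (hφ : LipschitzWith K φ) (hodd : ∀ x, φ (-x) = -φ x) :
    ∫ e : Sph d, φ e ^ 2 ∂unifSphere d ≤ 12 * (K : ℝ) ^ 2 / d := by
  have hd' : (0 : ℝ) < d := by exact_mod_cast hd
  have h0 : φ 0 = 0 := by have := hodd 0; rw [neg_zero] at this; linarith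
  set F : Vec d → ℝ := fun x => ‖x‖ * φ (‖x‖⁻¹ • x) with hF
  have hFL := lipschitzWith_homogeneous hφ h0
  have hFc : Continuous F := hFL.continuous
  have hpolar := integral_stdGaussian_polar hd (fun w => φ w ^ 2)
      (hφ.continuous.measurable.pow_const 2)
    (fun x => sq_nonneg _) 2
  have e : ∀ x : Vec d, φ (‖x‖⁻¹ • x) ^ 2 * ‖x‖ ^ 2 = F x ^ 2 := by
    intro x; simp only [hF]; ring
  simp only [e] at hpolar
  rw [integral_norm_sq_stdGaussian] at hpolar
  have hFle : ∀ x, |F x| ≤ 3 * K * ‖x‖ := by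
    intro x
    have h := hFL.norm_sub_le x 0
    have hF0 : F 0 = 0 := by simp [hF]
    change ‖F x - F 0‖ ≤ _ at h
    rw [hF0, sub_zero, sub_zero] at h
    simpa using h
  have hi1 : Integrable F (stdGaussian (Vec d)) := by
    refine ((integrable_norm_pow_stdGaussian (d := d) 1).const_mul (3 * (K : ℝ))).mono'
      hFc.aestronglyMeasurable (.of_forall fun x => ?_)
    simpa using hFle x
  have hi2 : Integrable (fun x => F x ^ 2) (stdGaussian (Vec d)) := by
    refine ((integrable_norm_pow_stdGaussian (d := d) 2).const_mul ((3 * (K : ℝ)) ^ 2)).mono'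
      (hFc.pow 2).aestronglyMeasurable (.of_forall fun x => ?_)
    rw [Real.norm_eq_abs, abs_of_nonneg (sq_nonneg _), ← sq_abs, ← mul_pow]
    gcongr
    exact hFle x
  -- Oddness makes the mean vanish, so the two-copy Poincaré integral is 2 E F² = 2d E φ². With the
  -- Lipschitz constant 3K this gives E φ² ≤ (9π²/8) K²/d, below 12K²/d as π² ≤ 10.
  have hmean : ∫ x, F x ∂stdGaussian (Vec d) = 0 := by
    have h : ∫ x, F (-x) ∂stdGaussian (Vec d) = ∫ x, F x ∂stdGaussian (Vec d) := by
      conv_rhs => rw [← map_neg_stdGaussian]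
      rw [integral_map (by fun_prop) hFc.aestronglyMeasurable]
    have h' : ∀ x, F (-x) = -F x := by
      intro x; simp only [hF, norm_neg, smul_neg, hodd]; ring
    simp_rw [h', integral_neg] at h
    linarith
  have hP := integral_sq_sub_stdGaussian_le hFL
  have hexp : ∫ u : Vec d × Vec d, (F u.2 - F u.1) ^ 2
      ∂(stdGaussian (Vec d)).prod (stdGaussian (Vec d)) = 2 * ∫ x, F x ^ 2 ∂stdGaussian (Vec d) := by
    have e2 : ∀ u : Vec d × Vec d, (F u.2 - F u.1) ^ 2 =
        (F u.2 ^ 2 + F u.1 ^ 2) - 2 * (F u.1 * F u.2) := fun u => by ring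
    simp_rw [e2]
    rw [integral_sub, integral_add, integral_const_mul, integral_prod_mul, hmean,
      integral_fun_fst (fun x => F x ^ 2), integral_fun_snd (fun x => F x ^ 2)]
    · simp; ring
    · exact hi2.comp_snd _
    · exact hi2.comp_fst _
    · exact (hi2.comp_snd _).add (hi2.comp_fst _)
    · exact (hi1.mul_prod hi1).const_mul 2
  change ∫ u : Vec d × Vec d, (F u.2 - F u.1) ^ 2 ∂_ ≤ _ at hP
  rw [hexp, hpolar] at hP
  push_cast at hP
  rw [le_div_iff₀ hd']
  have hpi : Real.pi ^ 2 ≤ 10 := by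
    have h1 := Real.pi_lt_d2
    have h2 := Real.pi_pos
    nlinarith
  nlinarith [sq_nonneg (K : ℝ)]

/-! ### The divergence theorem on the ball for Lipschitz functions. -/

/-- Integration in polar coordinates. -/
theorem integral_polar (hd : 0 < d) {f : Vec d → ℝ} (hf : Integrable f) :
    ∫ x, f x = ∫ r in Ioi (0 : ℝ), r ^ (d - 1) *
      ∫ e : Sph d, f (r • (e : Vec d)) ∂(volume : Measure (Vec d)).toSphere := by
  have : Nonempty (Fin d) := ⟨⟨0, hd⟩⟩
  have hm := (volume : Measure (Vec d)).measurePreserving_homeomorphUnitSphereProd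
  have hemb := (homeomorphUnitSphereProd (Vec d)).measurableEmbedding
  set g : Sph d × Ioi (0 : ℝ) → ℝ := fun q => f (q.2.1 • (q.1 : Vec d)) with hg
  have e : ∀ x : ({0}ᶜ : Set (Vec d)), g (homeomorphUnitSphereProd (Vec d) x) = f x := by
    intro x
    simp only [hg, homeomorphUnitSphereProd_apply_fst_coe, homeomorphUnitSphereProd_apply_snd_coe]
    have : ‖(x : Vec d)‖ ≠ 0 := norm_ne_zero_iff.2 x.2
    rw [smul_smul, mul_inv_cancel₀ this, one_smul]
  have h0 : ∫ x, f x = ∫ x : ({0}ᶜ : Set (Vec d)), f x ∂(volume : Measure (Vec d)).comap (↑) := by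
    rw [integral_subtype_comap (measurableSet_singleton _).compl f, restrict_compl_singleton]
  have h1 := hm.integral_comp hemb g
  have hgi : Integrable g ((volume : Measure (Vec d)).toSphere.prod
      (Measure.volumeIoiPow (Module.finrank ℝ (Vec d) - 1))) := by
    rw [← hm.integrable_comp_emb hemb]
    have h2 : Integrable (fun x : ({0}ᶜ : Set (Vec d)) => f x)
        ((volume : Measure (Vec d)).comap (↑)) := by
      have h3 : IntegrableOn f ({0}ᶜ : Set (Vec d)) := hf.integrableOn
      rwa [integrableOn_iff_comap_subtypeVal (measurableSet_singleton _).compl] at h3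
    exact h2.congr (.of_forall fun x => (e x).symm)
  simp only [e] at h1
  rw [h0, h1, integral_prod_symm g hgi]
  simp only [Measure.volumeIoiPow, ENNReal.ofReal, hg, finrank_euclideanSpace, Fintype.card_fin]
  rw [integral_withDensity_eq_integral_smul (by fun_prop),
    integral_subtype_comap measurableSet_Ioi fun r : ℝ => Real.toNNReal (r ^ (d - 1)) •
      ∫ e : Sph d, f (r • (e : Vec d)) ∂(volume : Measure (Vec d)).toSphere]
  refine setIntegral_congr_fun measurableSet_Ioi fun r hr => ?_
  simp only [NNReal.smul_def, smul_eq_mul]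
  rw [Real.coe_toNNReal _ (pow_nonneg (le_of_lt hr) _)]

/-- A truncated paraboloid. -/
noncomputable def paraboloid (s : ℝ) (u : Vec d) : ℝ := s ^ 2 - min ‖u‖ s ^ 2

theorem lipschitzWith_paraboloid {s : ℝ} (hs : 0 ≤ s) :
    LipschitzWith (2 * s.toNNReal) (paraboloid s : Vec d → ℝ) := by
  refine LipschitzWith.of_dist_le_mul fun x y => ?_
  rw [Real.dist_eq, dist_eq_norm]
  push_cast
  rw [Real.coe_toNNReal _ hs]
  unfold paraboloid
  have h1 : |min ‖y‖ s - min ‖x‖ s| ≤ ‖x - y‖ := by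
    refine (abs_min_sub_min_le_max _ _ _ _).trans ?_
    rw [sub_self, abs_zero, max_eq_left (abs_nonneg _), norm_sub_rev]
    exact abs_norm_sub_norm_le y x
  have a1 : 0 ≤ min ‖x‖ s := le_min (norm_nonneg _) hs
  have a2 : 0 ≤ min ‖y‖ s := le_min (norm_nonneg _) hs
  have b1 : min ‖x‖ s ≤ s := min_le_right _ _
  have b2 : min ‖y‖ s ≤ s := min_le_right _ _
  have e : s ^ 2 - min ‖x‖ s ^ 2 - (s ^ 2 - min ‖y‖ s ^ 2) =
    (min ‖y‖ s - min ‖x‖ s) * (min ‖y‖ s + min ‖x‖ s) := by ring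
  rw [e, abs_mul, abs_of_nonneg (by linarith : 0 ≤ min ‖y‖ s + min ‖x‖ s), mul_comm]
  gcongr
  linarith

theorem paraboloid_eq_zero {s : ℝ} {u : Vec d} (h : s ≤ ‖u‖) : paraboloid s u = 0 := by
  simp [paraboloid, min_eq_right h]

theorem hasCompactSupport_paraboloid (s : ℝ) :
    HasCompactSupport (paraboloid s : Vec d → ℝ) := by
  refine HasCompactSupport.intro (isCompact_closedBall (0 : Vec d) s) fun x hx => ?_
  rw [mem_closedBall_zero_iff, not_le] at hx
  exact paraboloid_eq_zero hx.le

theorem lineDeriv_paraboloid {s : ℝ} {u : Vec d} (hu : ‖u‖ ≠ s) (v : Vec d) :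
    lineDeriv ℝ (paraboloid s) u (-v) =
      (Metric.ball (0 : Vec d) s).indicator (fun u => 2 * inner ℝ u v) u := by
  rcases lt_or_gt_of_ne hu with h | h
  · rw [indicator_of_mem (by simpa using h)]
    have hev : paraboloid s =ᶠ[nhds u] fun w : Vec d => s ^ 2 - ‖w‖ ^ 2 := by
      filter_upwards [(isOpen_lt continuous_norm continuous_const).mem_nhds h] with w hw
      simp [paraboloid, min_eq_left (le_of_lt hw)]
    have hd : HasFDerivAt (fun w : Vec d => s ^ 2 - ‖w‖ ^ 2) (-(2 • innerSL ℝ u)) u :=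
      (hasStrictFDerivAt_norm_sq u).hasFDerivAt.const_sub _
    rw [hev.lineDeriv_eq, (hd.hasLineDerivAt (-v)).lineDeriv]
    simp
  · rw [indicator_of_notMem (by simpa using h.le)]
    have hev : paraboloid s =ᶠ[nhds u] fun _ : Vec d => (0 : ℝ) := by
      filter_upwards [(isOpen_lt continuous_const continuous_norm).mem_nhds h] with w hw
      exact paraboloid_eq_zero (le_of_lt hw)
    rw [hev.lineDeriv_eq]
    simp [lineDeriv]

/-- Integration by parts needs a Lipschitz weight, which the indicator of a ball is not. The
truncated paraboloid is one, and its gradient -2u inside the ball leaves φ times a linear function,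
ready for polar coordinates. -/
theorem integral_lineDeriv_mul_paraboloid (hd : 0 < d) {φ : Vec d → ℝ} {K : NNReal}
    (hφ : LipschitzWith K φ) {s : ℝ} (hs : 0 < s) (v : Vec d) :
    ∫ x, lineDeriv ℝ φ x v * paraboloid s x = ∫ r in (0 : ℝ)..s, 2 * r ^ d *
      ∫ e : Sph d, φ (r • (e : Vec d)) * inner ℝ (e : Vec d) v
        ∂(volume : Measure (Vec d)).toSphere := by
  have : Nonempty (Fin d) := ⟨⟨0, hd⟩⟩
  rw [hφ.integral_lineDeriv_mul_eq (lipschitzWith_paraboloid hs.le)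
    (hasCompactSupport_paraboloid s) v]
  set f : Vec d → ℝ := (Metric.ball (0 : Vec d) s).indicator
    (fun u => 2 * inner ℝ u v * φ u) with hf
  have hφc := hφ.continuous
  have hfi : Integrable f := by
    rw [hf, integrable_indicator_iff measurableSet_ball]
    have hc : Continuous (fun u : Vec d => 2 * inner ℝ u v * φ u) := by fun_prop
    exact (hc.continuousOn.integrableOn_compact (isCompact_closedBall 0 s)).mono_set
      Metric.ball_subset_closedBall
  have hae : ∀ᵐ x : Vec d, lineDeriv ℝ (paraboloid s) x (-v) * φ x = f x := by
    have : ∀ᵐ x : Vec d, x ∉ Metric.sphere (0 : Vec d) s :=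
      measure_eq_zero_iff_ae_notMem.1 (Measure.addHaar_sphere volume 0 s)
    filter_upwards [this] with x hx
    rw [lineDeriv_paraboloid (by simpa using hx), hf]
    by_cases h : x ∈ Metric.ball (0 : Vec d) s
    · rw [indicator_of_mem h, indicator_of_mem h]
    · rw [indicator_of_notMem h, indicator_of_notMem h, zero_mul]
  rw [integral_congr_ae hae, integral_polar hd hfi, intervalIntegral.integral_of_le hs.le,
    integral_Ioc_eq_integral_Ioo]
  have hind : ∀ r ∈ Ioi (0 : ℝ), r ^ (d - 1) *
      ∫ e : Sph d, f (r • (e : Vec d)) ∂(volume : Measure (Vec d)).toSphere =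
      (Ioo 0 s).indicator (fun r => 2 * r ^ d *
        ∫ e : Sph d, φ (r • (e : Vec d)) * inner ℝ (e : Vec d) v
          ∂(volume : Measure (Vec d)).toSphere) r := by
    intro r hr
    have hr0 : 0 < r := hr
    have hnorm : ∀ e : Sph d, ‖r • (e : Vec d)‖ = r := fun e => by
      rw [norm_smul, norm_eq_of_mem_sphere, mul_one, Real.norm_eq_abs, abs_of_pos hr0]
    by_cases h : r < s
    · rw [indicator_of_mem (show r ∈ Ioo 0 s from ⟨hr0, h⟩), ← integral_const_mul,
        ← integral_const_mul]
      refine integral_congr_ae (.of_forall fun e => ?_)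
      simp only [hf]
      rw [indicator_of_mem (by simpa [hnorm] using h), real_inner_smul_left]
      obtain ⟨k, rfl⟩ : ∃ k, d = k + 1 := ⟨d - 1, by omega⟩
      rw [Nat.add_sub_cancel, pow_succ]
      ring
    · rw [indicator_of_notMem (fun h' => h h'.2)]
      have : ∀ e : Sph d, f (r • (e : Vec d)) = 0 := fun e => by
        rw [hf, indicator_of_notMem (by simpa [hnorm] using h)]
      simp [this]
  rw [setIntegral_congr_fun measurableSet_Ioi hind, setIntegral_indicator measurableSet_Ioo,
    inter_eq_self_of_subset_right Ioo_subset_Ioi_self]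

/-- The divergence theorem on the unit ball, for a Lipschitz function in a fixed direction. -/
theorem integral_ball_lineDeriv (hd : 0 < d) {φ : Vec d → ℝ} {K : NNReal}
    (hφ : LipschitzWith K φ) (v : Vec d) :
    ∫ x in Metric.ball (0 : Vec d) 1, lineDeriv ℝ φ x v =
      ∫ e : Sph d, φ e * inner ℝ (e : Vec d) v ∂(volume : Measure (Vec d)).toSphere := by
  have : Nonempty (Fin d) := ⟨⟨0, hd⟩⟩
  have hφc := hφ.continuous
  set J : ℝ → ℝ := fun r => 2 * r ^ d *
      ∫ e : Sph d, φ (r • (e : Vec d)) * inner ℝ (e : Vec d) v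
        ∂(volume : Measure (Vec d)).toSphere with hJ
  have hJc : Continuous J := by
    have h : Continuous fun r : ℝ => ∫ e : Sph d, φ (r • (e : Vec d)) * inner ℝ (e : Vec d) v
        ∂(volume : Measure (Vec d)).toSphere :=
      continuous_parametric_integral_of_continuous
        (f := fun (r : ℝ) (e : Sph d) => φ (r • (e : Vec d)) * inner ℝ (e : Vec d) v)
        (by unfold Function.uncurry; fun_prop) isCompact_univ |>.congr
        fun r => by rw [Measure.restrict_univ]
    fun_prop
  set I : ℝ → ℝ := fun s => ∫ x, lineDeriv ℝ φ x v * paraboloid s x with hI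
  have hId : HasDerivWithinAt I (J 1) (Iio 1) 1 := by
    have h : HasDerivAt (fun s => ∫ r in (0 : ℝ)..s, J r) (J 1) 1 :=
      intervalIntegral.integral_hasDerivAt_right (hJc.intervalIntegrable _ _)
        (hJc.stronglyMeasurableAtFilter _ _) hJc.continuousAt
    refine h.hasDerivWithinAt.congr_of_eventuallyEq ?_ ?_
    · filter_upwards [mem_nhdsWithin_of_mem_nhds (lt_mem_nhds (zero_lt_one (α := ℝ)))] with s hs
      exact integral_lineDeriv_mul_paraboloid hd hφ hs v
    · exact integral_lineDeriv_mul_paraboloid hd hφ one_pos v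
  -- The extra factor 1/(1+s) makes this the difference quotient in s². In this variable the
  -- paraboloids have difference quotient tending to the indicator of the unit ball, while the other
  -- side differentiates to the sphere integral at radius 1.
  have hslope : Filter.Tendsto (fun s => (1 + s)⁻¹ * ((s - 1)⁻¹ * (I s - I 1)))
      (nhdsWithin 1 (Iio 1)) (nhds ((1 + 1)⁻¹ * J 1)) := by
    refine Filter.Tendsto.mul ?_ ?_
    · have : ContinuousAt (fun s : ℝ => (1 + s)⁻¹) 1 :=
        ContinuousAt.inv₀ (by fun_prop) (by norm_num)
      exact this.tendsto.mono_left nhdsWithin_le_nhds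
    · have := hasDerivWithinAt_iff_tendsto_slope.1 hId
      rw [sdiff_singleton_eq_self (by simp)] at this
      exact this.congr fun s => by rw [slope_def_field, div_eq_inv_mul]
  have hmeas : AEStronglyMeasurable (fun x => lineDeriv ℝ φ x v) volume :=
    aestronglyMeasurable_lineDeriv hφc volume
  have hint : ∀ s : ℝ, 0 ≤ s → Integrable fun x => lineDeriv ℝ φ x v * paraboloid s x := by
    intro s hs
    have hp := (lipschitzWith_paraboloid (d := d) hs).continuous
    refine ((hp.integrable_of_hasCompactSupport (hasCompactSupport_paraboloid s)).norm.const_mul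
      (K * ‖v‖)).mono' (hmeas.mul hp.aestronglyMeasurable) (.of_forall fun x => ?_)
    rw [norm_mul]
    gcongr
    exact norm_lineDeriv_le_of_lipschitz ℝ hφ
  have hdct : Filter.Tendsto (fun s => ∫ x, lineDeriv ℝ φ x v *
      ((paraboloid 1 x - paraboloid s x) / (1 - s ^ 2)))
      (nhdsWithin 1 (Iio 1)) (nhds (∫ x, lineDeriv ℝ φ x v *
        (Metric.ball (0 : Vec d) 1).indicator 1 x)) := by
    have hnear : ∀ᶠ s : ℝ in nhdsWithin 1 (Iio 1), s ∈ Ioo (0 : ℝ) 1 :=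
      Ioo_mem_nhdsLT one_pos
    refine tendsto_integral_filter_of_dominated_convergence
      (fun x => K * ‖v‖ * (Metric.ball (0 : Vec d) 1).indicator 1 x) ?_ ?_ ?_ ?_
    · filter_upwards [hnear] with s hs
      have h1 := (lipschitzWith_paraboloid (d := d) zero_le_one).continuous
      have h2 := (lipschitzWith_paraboloid (d := d) hs.1.le).continuous
      exact hmeas.mul ((h1.sub h2).div_const _).aestronglyMeasurable
    · filter_upwards [hnear] with s hs
      refine .of_forall fun x => ?_
      rw [norm_mul]
      gcongr
      · exact norm_lineDeriv_le_of_lipschitz ℝ hφ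
      · have h1s : 0 < 1 - s ^ 2 := by nlinarith [hs.1, hs.2]
        by_cases hx : x ∈ Metric.ball (0 : Vec d) 1
        · rw [indicator_of_mem hx, Pi.one_apply, Real.norm_eq_abs, abs_le, le_div_iff₀ h1s,
            div_le_iff₀ h1s]
          have hx1 : ‖x‖ < 1 := by simpa using hx
          unfold paraboloid
          rw [min_eq_left hx1.le]
          rcases le_total ‖x‖ s with h | h
          · rw [min_eq_left h]; constructor <;> nlinarith
          · rw [min_eq_right h]
            constructor <;> nlinarith [norm_nonneg x, hs.1]
        · have hx1 : 1 ≤ ‖x‖ := by simpa using hx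
          rw [indicator_of_notMem hx, paraboloid_eq_zero hx1,
            paraboloid_eq_zero (hs.2.le.trans hx1)]
          simp
    · refine Integrable.const_mul ?_ _
      rw [integrable_indicator_iff measurableSet_ball]
      exact integrableOn_const (measure_ball_lt_top.ne)
    · refine .of_forall fun x => ?_
      refine Filter.Tendsto.const_mul _ (tendsto_const_nhds.congr' ?_)
      by_cases hx : x ∈ Metric.ball (0 : Vec d) 1
      · have hx1 : ‖x‖ < 1 := by simpa using hx
        have hxs : ∀ᶠ s : ℝ in nhdsWithin 1 (Iio 1), ‖x‖ < s :=
          mem_nhdsWithin_of_mem_nhds (lt_mem_nhds hx1)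
        filter_upwards [hnear, hxs] with s hs hs'
        rw [indicator_of_mem hx, Pi.one_apply]
        have h1s : 1 - s ^ 2 ≠ 0 := by nlinarith [hs.1, hs.2]
        unfold paraboloid
        rw [min_eq_left hx1.le, min_eq_left hs'.le]
        field_simp
        ring
      · have hx1 : 1 ≤ ‖x‖ := by simpa using hx
        filter_upwards [hnear] with s hs
        rw [indicator_of_notMem hx, paraboloid_eq_zero hx1, paraboloid_eq_zero (hs.2.le.trans hx1)]
        simp
  have heq : (fun s => (1 + s)⁻¹ * ((s - 1)⁻¹ * (I s - I 1))) =ᶠ[nhdsWithin 1 (Iio 1)]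
      fun s => ∫ x, lineDeriv ℝ φ x v * ((paraboloid 1 x - paraboloid s x) / (1 - s ^ 2)) := by
    filter_upwards [Ioo_mem_nhdsLT (one_pos (α := ℝ))] with s hs
    have e : ∀ x : Vec d, lineDeriv ℝ φ x v * ((paraboloid 1 x - paraboloid s x) / (1 - s ^ 2)) =
        (1 - s ^ 2)⁻¹ * (lineDeriv ℝ φ x v * paraboloid 1 x - lineDeriv ℝ φ x v * paraboloid s x) :=
      fun x => by ring
    simp_rw [e]
    rw [integral_const_mul, integral_sub (hint 1 zero_le_one) (hint s hs.1.le)]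
    simp only [hI]
    have h1 : 1 + s ≠ 0 := by linarith [hs.1]
    have h2 : s - 1 ≠ 0 := by linarith [hs.2]
    have h3 : 1 - s ^ 2 ≠ 0 := by nlinarith [hs.1, hs.2]
    field_simp
    ring
  have hfin := tendsto_nhds_unique (hslope.congr' heq) hdct
  have e1 : ∫ x, lineDeriv ℝ φ x v * (Metric.ball (0 : Vec d) 1).indicator 1 x =
      ∫ x in Metric.ball (0 : Vec d) 1, lineDeriv ℝ φ x v := by
    rw [← integral_indicator measurableSet_ball]
    congr 1; ext x
    by_cases hx : x ∈ Metric.ball (0 : Vec d) 1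
    · rw [indicator_of_mem hx, indicator_of_mem hx]; simp
    · rw [indicator_of_notMem hx, indicator_of_notMem hx, mul_zero]
  rw [← e1, ← hfin, hJ]
  simp only [one_pow, one_smul]
  ring

/-! ### The smoothed function and its gradient. -/

/-- The average of `f` over the Euclidean ball of radius `γ` around `x`. -/
noncomputable def ballAvg (f : Vec d → ℝ) (γ : ℝ) (x : Vec d) : ℝ :=
  ((volume : Measure (Vec d)).real (Metric.ball 0 1))⁻¹ *
    ∫ u in Metric.ball (0 : Vec d) 1, f (x + γ • u)

/-- The expectation of the two-point randomized gradient. -/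
noncomputable def meanGrad (f : Vec d → ℝ) (γ : ℝ) (x : Vec d) : Vec d :=
  ∫ e, zoGrad f γ x e ∂unifSphere d

theorem continuous_zoGrad {f : Vec d → ℝ} (hf : Continuous f) (γ : ℝ) :
    Continuous fun q : Vec d × Sph d => zoGrad f γ q.1 q.2 := by
  unfold zoGrad; fun_prop

theorem integrable_unifSphere_of_continuous (hd : 0 < d) {E : Type*} [NormedAddCommGroup E]
    [SecondCountableTopologyEither (Sph d) E] {g : Sph d → E} (hg : Continuous g) :
    Integrable g (unifSphere d) := by
  have := isProbabilityMeasure_unifSphere hd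
  have h := hg.continuousOn.integrableOn_compact (μ := unifSphere d) isCompact_univ
  rwa [integrableOn_univ] at h

theorem measureReal_ball_pos : 0 < (volume : Measure (Vec d)).real (Metric.ball 0 1) :=
  ENNReal.toReal_pos (Metric.measure_ball_pos _ _ one_pos).ne' measure_ball_lt_top.ne

theorem integrableOn_ball {f : Vec d → ℝ} (hf : Continuous f) (γ : ℝ) (x : Vec d) :
    IntegrableOn (fun u => f (x + γ • u)) (Metric.ball (0 : Vec d) 1) := by
  have hc : Continuous fun u => f (x + γ • u) := by fun_prop
  exact (hc.continuousOn.integrableOn_compact (isCompact_closedBall 0 1)).mono_set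
    Metric.ball_subset_closedBall

theorem setIntegral_ball_const (c : ℝ) :
    ∫ _u in Metric.ball (0 : Vec d) 1, c = (volume : Measure (Vec d)).real (Metric.ball 0 1) * c := by
  simp

/-- The symmetry e ↦ -e of the sphere makes the two evaluation points contribute equally, which
turns d/(2γ) into d/γ. -/
theorem inner_meanGrad (hd : 0 < d) {f : Vec d → ℝ} (hf : Continuous f) {γ : ℝ} (hγ : γ ≠ 0)
    (x v : Vec d) :
    inner ℝ (meanGrad f γ x) v =
      d / γ * ∫ e : Sph d, f (x + γ • (e : Vec d)) * inner ℝ (e : Vec d) v ∂unifSphere d := by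
  have hc : Continuous fun e : Sph d => zoGrad f γ x e :=
    (continuous_zoGrad hf γ).comp (by fun_prop : Continuous fun e : Sph d => (x, e))
  have h1 : inner ℝ (meanGrad f γ x) v = ∫ e, inner ℝ (zoGrad f γ x e) v ∂unifSphere d := by
    unfold meanGrad
    rw [real_inner_comm, ← integral_inner (integrable_unifSphere_of_continuous hd hc)]
    simp_rw [real_inner_comm]
  have hp : Continuous fun e : Sph d => f (x + γ • (e : Vec d)) * inner ℝ (e : Vec d) v := by
    fun_prop
  have hm : Continuous fun e : Sph d => f (x - γ • (e : Vec d)) * inner ℝ (e : Vec d) v := by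
    fun_prop
  have h2 : ∫ e : Sph d, f (x - γ • (e : Vec d)) * inner ℝ (e : Vec d) v ∂unifSphere d =
      -∫ e : Sph d, f (x + γ • (e : Vec d)) * inner ℝ (e : Vec d) v ∂unifSphere d := by
    rw [← integral_unifSphere_neg hd _ hm, ← integral_neg]
    refine integral_congr_ae (.of_forall fun e => ?_)
    change f (x - γ • (-(e : Vec d))) * inner ℝ (-(e : Vec d)) v = _
    rw [smul_neg, sub_neg_eq_add, inner_neg_left]; ring
  have e : ∀ e : Sph d, inner ℝ (zoGrad f γ x e) v = d / (2 * γ) *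
      (f (x + γ • (e : Vec d)) * inner ℝ (e : Vec d) v -
        f (x - γ • (e : Vec d)) * inner ℝ (e : Vec d) v) := by
    intro e; unfold zoGrad; rw [real_inner_smul_left]; ring
  rw [h1]
  simp_rw [e]
  rw [integral_const_mul, integral_sub (integrable_unifSphere_of_continuous hd hp)
    (integrable_unifSphere_of_continuous hd hm), h2]
  field_simp
  ring

theorem lipschitz_ballAvg {f : Vec d → ℝ} {K : NNReal} (hf : LipschitzWith K f) (γ : ℝ)
    (x y : Vec d) : |ballAvg f γ x - ballAvg f γ y| ≤ K * ‖x - y‖ := by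
  have hV := measureReal_ball_pos (d := d)
  unfold ballAvg
  rw [← mul_sub, ← integral_sub (integrableOn_ball hf.continuous γ x)
    (integrableOn_ball hf.continuous γ y), abs_mul, abs_of_pos (by positivity),
    inv_mul_le_iff₀ hV]
  have := norm_setIntegral_le_of_norm_le_const (μ := (volume : Measure (Vec d)))
    (s := Metric.ball (0 : Vec d) 1) (f := fun u => f (x + γ • u) - f (y + γ • u))
    (C := K * ‖x - y‖) measure_ball_lt_top (fun u _ => by
      refine (hf.norm_sub_le _ _).trans (le_of_eq ?_)
      congr 2; abel)
  rw [mul_comm]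
  exact this

/-- The directional derivative of the smoothed function. A shift of y by tv is a shift of u by tv/γ;
averaging the derivative over the ball gives a sphere integral by the divergence theorem, and the
surface measure has total mass d times the volume of the ball. -/
theorem tendsto_slope_ballAvg (hd : 0 < d) {f : Vec d → ℝ} {K : NNReal} (hf : LipschitzWith K f)
    {γ : ℝ} (hγ : γ ≠ 0) (y v : Vec d) :
    Filter.Tendsto (fun t : ℝ => t⁻¹ * (ballAvg f γ (y + t • v) - ballAvg f γ y))
      (nhdsWithin 0 (Ioi 0)) (nhds (inner ℝ (meanGrad f γ y) v)) := by
  have : Nonempty (Fin d) := ⟨⟨0, hd⟩⟩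
  have hV := measureReal_ball_pos (d := d)
  set φ : Vec d → ℝ := fun u => f (y + γ • u) with hφ
  have hφL : LipschitzWith (K * ‖γ‖₊) φ := by
    refine LipschitzWith.of_dist_le_mul fun a b => (hf.dist_le_mul _ _).trans (le_of_eq ?_)
    rw [dist_add_left, dist_smul₀]
    push_cast
    ring
  set w : Vec d := γ⁻¹ • v with hw
  have hg : Integrable ((Metric.ball (0 : Vec d) 1).indicator (1 : Vec d → ℝ)) := by
    rw [integrable_indicator_iff measurableSet_ball]
    exact integrableOn_const measure_ball_lt_top.ne
  have ht := (hφL.integral_inv_smul_sub_mul_tendsto_integral_lineDeriv_mul hg w).const_mul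
    ((volume : Measure (Vec d)).real (Metric.ball 0 1))⁻¹
  have hind : ∀ ψ : Vec d → ℝ, ∫ x, ψ x * (Metric.ball (0 : Vec d) 1).indicator 1 x =
      ∫ x in Metric.ball (0 : Vec d) 1, ψ x := by
    intro ψ
    rw [← integral_indicator measurableSet_ball]
    congr 1; ext x
    by_cases hx : x ∈ Metric.ball (0 : Vec d) 1
    · rw [indicator_of_mem hx, indicator_of_mem hx]; simp
    · rw [indicator_of_notMem hx, indicator_of_notMem hx, mul_zero]
  simp_rw [hind] at ht
  rw [integral_ball_lineDeriv hd hφL w] at ht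
  have hlimit : ((volume : Measure (Vec d)).real (Metric.ball 0 1))⁻¹ *
      ∫ e : Sph d, φ e * inner ℝ (e : Vec d) w ∂(volume : Measure (Vec d)).toSphere =
      inner ℝ (meanGrad f γ y) v := by
    rw [inner_meanGrad hd hf.continuous hγ, unifSphere_eq, integral_smul_measure,
      Measure.toSphere_apply_univ]
    simp only [hφ, hw, real_inner_smul_right, finrank_euclideanSpace, Fintype.card_fin,
      ENNReal.toReal_inv, ENNReal.toReal_mul, ENNReal.toReal_natCast, smul_eq_mul]
    rw [← Measure.real_def]
    have e : ∀ e : Sph d, f (y + γ • (e : Vec d)) * (γ⁻¹ * inner ℝ (e : Vec d) v) =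
        γ⁻¹ * (f (y + γ • (e : Vec d)) * inner ℝ (e : Vec d) v) := fun e => by ring
    simp_rw [e]
    rw [integral_const_mul]
    have hd0 : (d : ℝ) ≠ 0 := by positivity
    field_simp
  rw [hlimit] at ht
  refine ht.congr fun t => ?_
  unfold ballAvg
  rw [← mul_sub, ← integral_sub (integrableOn_ball hf.continuous γ _)
    (integrableOn_ball hf.continuous γ y)]
  simp_rw [smul_eq_mul]
  rw [integral_const_mul]
  have e : ∀ u : Vec d, φ (u + t • w) = f (y + t • v + γ • u) := by
    intro u
    simp only [hφ, hw]
    congr 1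
    rw [smul_add, smul_comm γ t, smul_smul γ, mul_inv_cancel₀ hγ, one_smul]
    abel
  simp_rw [e]
  ring

theorem abs_inner_meanGrad_le (hd : 0 < d) {f : Vec d → ℝ} {K : NNReal} (hf : LipschitzWith K f)
    {γ : ℝ} (hγ : γ ≠ 0) (y v : Vec d) : |inner ℝ (meanGrad f γ y) v| ≤ K * ‖v‖ := by
  refine le_of_tendsto (tendsto_slope_ballAvg hd hf hγ y v).abs ?_
  filter_upwards [self_mem_nhdsWithin] with t ht
  have ht0 : (0 : ℝ) < t := ht
  rw [abs_mul, abs_inv, abs_of_pos ht0, inv_mul_le_iff₀ ht0]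
  refine (lipschitz_ballAvg hf γ _ _).trans (le_of_eq ?_)
  rw [add_sub_cancel_left, norm_smul, Real.norm_eq_abs, abs_of_pos ht0]
  ring

theorem add_smul_mem_cthickening {Q : Set (Vec d)} {x u : Vec d} (hx : x ∈ Q) (hu : ‖u‖ ≤ 1)
    {γ : ℝ} (hγ : 0 ≤ γ) : x + γ • u ∈ Metric.cthickening γ Q := by
  refine Metric.mem_cthickening_of_dist_le _ x γ Q hx ?_
  rw [dist_self_add_left, norm_smul, Real.norm_eq_abs, abs_of_nonneg hγ]
  nlinarith [norm_nonneg u]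

/-- The average inherits convexity along segments of Q, and a directional derivative of a convex
function is at most the secant slope. All points x + γu lie in Q_γ, so convexity of f there
suffices. -/
theorem ballAvg_gradient_inequality (hd : 0 < d) {f : Vec d → ℝ} {K : NNReal}
    (hf : LipschitzWith K f) {γ : ℝ} (hγ : 0 < γ) {Q : Set (Vec d)}
    (hcvx : ConvexOn ℝ (Metric.cthickening γ Q) f) {x y : Vec d} (hx : x ∈ Q) (hy : y ∈ Q) :
    ballAvg f γ y + inner ℝ (meanGrad f γ y) (x - y) ≤ ballAvg f γ x := by
  have hV := measureReal_ball_pos (d := d)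
  have hlim := tendsto_slope_ballAvg hd hf hγ.ne' y (x - y)
  have h : inner ℝ (meanGrad f γ y) (x - y) ≤ ballAvg f γ x - ballAvg f γ y := by
    refine le_of_tendsto hlim ?_
    filter_upwards [Ioo_mem_nhdsGT (one_pos (α := ℝ))] with t ht
    rw [inv_mul_le_iff₀ ht.1]
    have hconv : ballAvg f γ (y + t • (x - y)) ≤ (1 - t) * ballAvg f γ y + t * ballAvg f γ x := by
      unfold ballAvg
      rw [mul_left_comm, mul_left_comm t, ← mul_add, ← integral_const_mul (1 - t),
        ← integral_const_mul t, ← integral_add ((integrableOn_ball hf.continuous γ y).const_mul _)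
          ((integrableOn_ball hf.continuous γ x).const_mul _)]
      refine mul_le_mul_of_nonneg_left ?_ (by positivity)
      refine setIntegral_mono_on (integrableOn_ball hf.continuous γ _)
        (((integrableOn_ball hf.continuous γ y).const_mul _).add
          ((integrableOn_ball hf.continuous γ x).const_mul _)) measurableSet_ball fun u hu => ?_
      have hu1 : ‖u‖ ≤ 1 := le_of_lt (by simpa using hu)
      have := hcvx.2 (add_smul_mem_cthickening hy hu1 hγ.le)
        (add_smul_mem_cthickening hx hu1 hγ.le) (by linarith [ht.2] : 0 ≤ 1 - t) ht.1.le (by ring)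
      refine le_trans (le_of_eq ?_) this
      congr 1
      module
    linarith
  linarith

/-- The difference is at most (d/γ) D E|⟨e,v⟩|, and E|⟨e,v⟩| ≤ ‖v‖/√d. -/
theorem inner_meanGrad_sub_le (hd : 0 < d) {f : Vec d → ℝ} (hf : Continuous f) {γ : ℝ}
    (hγ : 0 < γ) {x y : Vec d} {D : ℝ} (hD : 0 ≤ D)
    (hxy : ∀ e : Sph d, |f (x + γ • (e : Vec d)) - f (y + γ • (e : Vec d))| ≤ D) (v : Vec d) :
    inner ℝ (meanGrad f γ x - meanGrad f γ y) v ≤ √d / γ * D * ‖v‖ := by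
  have := isProbabilityMeasure_unifSphere hd
  rcases eq_or_ne v 0 with rfl | hv
  · simp
  have hvn : 0 < ‖v‖ := norm_pos_iff.2 hv
  have hd' : (0 : ℝ) < d := by exact_mod_cast hd
  have hsq : √(d : ℝ) ^ 2 = d := Real.sq_sqrt hd'.le
  have hs0 : 0 < √(d : ℝ) := Real.sqrt_pos.2 hd'
  have hcx : Continuous fun e : Sph d => f (x + γ • (e : Vec d)) * inner ℝ (e : Vec d) v := by
    fun_prop
  have hcy : Continuous fun e : Sph d => f (y + γ • (e : Vec d)) * inner ℝ (e : Vec d) v := by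
    fun_prop
  rw [inner_sub_left, inner_meanGrad hd hf hγ.ne', inner_meanGrad hd hf hγ.ne', ← mul_sub,
    ← integral_sub (integrable_unifSphere_of_continuous hd hcx)
      (integrable_unifSphere_of_continuous hd hcy)]
  -- AM-GM with weight √d/‖v‖, balanced against E⟨e,v⟩² = ‖v‖²/d, replaces Cauchy-Schwarz.
  have hb : ∫ e : Sph d, (f (x + γ • (e : Vec d)) * inner ℝ (e : Vec d) v -
      f (y + γ • (e : Vec d)) * inner ℝ (e : Vec d) v) ∂unifSphere d ≤
      ∫ e : Sph d, D * ((√d / ‖v‖ * inner ℝ (e : Vec d) v ^ 2 + ‖v‖ / √d) / 2) ∂unifSphere d := by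
    refine integral_mono (integrable_unifSphere_of_continuous hd (hcx.sub hcy))
      (integrable_unifSphere_of_continuous hd (by fun_prop)) fun e => ?_
    simp only
    rw [← sub_mul]
    refine (le_abs_self _).trans ?_
    rw [abs_mul]
    refine mul_le_mul (hxy e) ?_ (abs_nonneg _) hD
    rw [← sq_abs]
    set s := |inner ℝ (e : Vec d) v|
    have e1 : (√d / ‖v‖ * s ^ 2 + ‖v‖ / √d) / 2 - s = (√d * s - ‖v‖) ^ 2 / (2 * ‖v‖ * √d) := by
      field_simp; ring
    have : 0 ≤ (√d * s - ‖v‖) ^ 2 / (2 * ‖v‖ * √d) := by positivity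
    linarith
  have hI : Integrable (fun e : Sph d => inner ℝ (e : Vec d) v ^ 2) (unifSphere d) :=
    integrable_unifSphere_of_continuous hd (by fun_prop)
  rw [integral_const_mul, integral_div, integral_add (hI.const_mul _) (integrable_const _),
    integral_const_mul, integral_inner_sq_unifSphere hd] at hb
  calc _ ≤ (d : ℝ) / γ * (D * ((√d / ‖v‖ * (‖v‖ ^ 2 / d) + ∫ _ : Sph d,
      ‖v‖ / √d ∂unifSphere d) / 2)) := by
        gcongr
    _ = _ := by
        rw [integral_const]
        simp only [probReal_univ, smul_eq_mul, one_mul]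
        field_simp
        rw [hsq]; ring

/-- Pairing u with -u, x is the midpoint of x ± γu. -/
theorem le_ballAvg {f : Vec d → ℝ} (hf : Continuous f) {γ : ℝ} (hγ : 0 < γ)
    {Q : Set (Vec d)} (hcvx : ConvexOn ℝ (Metric.cthickening γ Q) f) {x : Vec d} (hx : x ∈ Q) :
    f x ≤ ballAvg f γ x := by
  have hV := measureReal_ball_pos (d := d)
  have hneg : ∫ u in Metric.ball (0 : Vec d) 1, f (x + γ • (-u)) =
      ∫ u in Metric.ball (0 : Vec d) 1, f (x + γ • u) := by
    have h := (Measure.measurePreserving_neg (volume : Measure (Vec d))).setIntegral_preimage_emb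
      (MeasurableEquiv.neg (Vec d)).measurableEmbedding (fun u => f (x + γ • u))
      (Metric.ball (0 : Vec d) 1)
    have hpre : Neg.neg ⁻¹' (Metric.ball (0 : Vec d) 1) = Metric.ball (0 : Vec d) 1 := by
      ext u; simp
    rw [hpre] at h
    exact h
  have hin : IntegrableOn (fun u => f (x + γ • (-u))) (Metric.ball (0 : Vec d) 1) := by
    have := integrableOn_ball hf (-γ) x
    simpa using this
  have h2 : ∫ _u in Metric.ball (0 : Vec d) 1, f x ≤
      ∫ u in Metric.ball (0 : Vec d) 1, (1 / 2 * f (x + γ • u) + 1 / 2 * f (x + γ • (-u))) := by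
    refine setIntegral_mono_on (integrableOn_const measure_ball_lt_top.ne)
      (((integrableOn_ball hf γ x).const_mul _).add (hin.const_mul _)) measurableSet_ball
      fun u hu => ?_
    have hu1 : ‖u‖ ≤ 1 := le_of_lt (by simpa using hu)
    have := hcvx.2 (add_smul_mem_cthickening hx hu1 hγ.le)
      (add_smul_mem_cthickening hx (by rwa [norm_neg] : ‖-u‖ ≤ 1) hγ.le)
      (by norm_num : (0 : ℝ) ≤ 1 / 2) (by norm_num : (0 : ℝ) ≤ 1 / 2) (by norm_num)
    refine le_trans (le_of_eq ?_) this
    congr 1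
    module
  rw [integral_add ((integrableOn_ball hf γ x).const_mul _) (hin.const_mul _), integral_const_mul,
    integral_const_mul, hneg, setIntegral_ball_const] at h2
  unfold ballAvg
  rw [le_inv_mul_iff₀ hV]
  linarith

theorem ballAvg_le {f : Vec d → ℝ} {K : NNReal} (hf : LipschitzWith K f) {γ : ℝ}
    (hγ : 0 < γ) (x : Vec d) : ballAvg f γ x ≤ f x + K * γ := by
  have hV := measureReal_ball_pos (d := d)
  unfold ballAvg
  rw [inv_mul_le_iff₀ hV, ← setIntegral_ball_const]
  refine setIntegral_mono_on (integrableOn_ball hf.continuous γ x)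
    (integrableOn_const measure_ball_lt_top.ne) measurableSet_ball fun u hu => ?_
  have hu1 : ‖u‖ ≤ 1 := le_of_lt (by simpa using hu)
  have h := (abs_le.1 (hf.norm_sub_le (x + γ • u) x)).2
  rw [add_sub_cancel_left, norm_smul, Real.norm_eq_abs, abs_of_pos hγ] at h
  have : (K : ℝ) * (γ * ‖u‖) ≤ K * γ := by
    gcongr; nlinarith
  linarith

/-! ### Uniform smoothness of ℓ_{2m} and second moments of the randomized gradient. -/

/-- If |s| ≤ 2m|t|, the cross term 2|st| is at most 4m t². Otherwise set u = t/s: (1 ± u)^{2m} ≤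
e^{±2mu}, cosh x ≤ e^{x²/2}, and 2mu² ≤ 1/2 allows e^{2mu²} ≤ 1 + 4mu². -/
theorem pow_two_point {m : ℕ} (hm : 1 ≤ m) (s t : ℝ) :
    ((s + t) ^ (2 * m) + (s - t) ^ (2 * m)) / 2 ≤ (s ^ 2 + (4 * m + 1) * t ^ 2) ^ m := by
  have hm1 : (1 : ℝ) ≤ m := by exact_mod_cast hm
  rcases le_or_gt |s| (2 * m * |t|) with h | h
  · have hst : |s * t| ≤ 2 * m * t ^ 2 := by
      rw [abs_mul, ← sq_abs t]; nlinarith [abs_nonneg t]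
    have h1 : (s + t) ^ 2 ≤ s ^ 2 + (4 * m + 1) * t ^ 2 := by nlinarith [le_abs_self (s * t)]
    have h2 : (s - t) ^ 2 ≤ s ^ 2 + (4 * m + 1) * t ^ 2 := by nlinarith [neg_abs_le (s * t)]
    have h1' := pow_le_pow_left₀ (sq_nonneg _) h1 m
    have h2' := pow_le_pow_left₀ (sq_nonneg _) h2 m
    rw [pow_mul, pow_mul]
    linarith
  · have hs : s ≠ 0 := by
      rintro rfl
      rw [abs_zero] at h
      have : 0 ≤ 2 * m * |t| := by positivity
      linarith
    have hs0 : 0 < |s| := abs_pos.2 hs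
    set u := t / s with hu
    have htu : t = s * u := by rw [hu]; field_simp
    have hu1 : 2 * m * |u| < 1 := by
      rw [hu, abs_div, ← mul_div_assoc, div_lt_one hs0]; exact h
    have hu2 := abs_lt.1 (by nlinarith [abs_nonneg u] : |u| < 1)
    have e1 : (s + t) ^ (2 * m) = s ^ (2 * m) * (1 + u) ^ (2 * m) := by
      rw [← mul_pow, htu]; ring
    have e2 : (s - t) ^ (2 * m) = s ^ (2 * m) * (1 - u) ^ (2 * m) := by
      rw [← mul_pow, htu]; ring
    have e3 : (s ^ 2 + (4 * m + 1) * t ^ 2) ^ m = s ^ (2 * m) * (1 + (4 * m + 1) * u ^ 2) ^ m := by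
      rw [pow_mul, ← mul_pow, htu]; ring
    rw [e1, e2, e3, ← mul_add, mul_div_assoc]
    refine mul_le_mul_of_nonneg_left ?_ ((even_two_mul m).pow_nonneg s)
    have f1 : (1 + u) ^ (2 * m) ≤ Real.exp (2 * m * u) := by
      have := pow_le_pow_left₀ (by linarith) (by linarith [Real.add_one_le_exp u] :
        1 + u ≤ Real.exp u) (2 * m)
      rw [← Real.exp_nat_mul] at this
      push_cast at this; exact this
    have f2 : (1 - u) ^ (2 * m) ≤ Real.exp (-(2 * m * u)) := by
      have := pow_le_pow_left₀ (by linarith) (by linarith [Real.add_one_le_exp (-u)] :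
        1 - u ≤ Real.exp (-u)) (2 * m)
      rw [← Real.exp_nat_mul] at this
      push_cast at this
      rwa [mul_neg] at this
    have f3 := Real.cosh_le_exp_half_sq (2 * m * u)
    rw [Real.cosh_eq] at f3
    have hx : 2 * m * u ^ 2 ≤ 1 / 2 := by
      rw [← sq_abs u]; nlinarith [abs_nonneg u]
    have hx0 : 0 ≤ 2 * m * u ^ 2 := by positivity
    have f4 : Real.exp (2 * m * u ^ 2) ≤ 1 + (4 * m + 1) * u ^ 2 := by
      refine (Real.exp_bound_div_one_sub_of_interval hx0 (by linarith)).trans ?_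
      rw [div_le_iff₀ (by linarith)]
      nlinarith [sq_nonneg u]
    have f5 : Real.exp ((2 * m * u) ^ 2 / 2) = Real.exp (2 * m * u ^ 2) ^ m := by
      rw [← Real.exp_nat_mul]; congr 1; ring
    rw [f5] at f3
    have f6 := pow_le_pow_left₀ (Real.exp_pos _).le f4 m
    linarith

theorem normLp_pow_nat {n : ℕ} (hn : 1 ≤ n) (x : Vec d) :
    normLp (n : ℝ≥0∞) x ^ n = ∑ i, |x i| ^ n := by
  have h := normLp_rpow (p := (n : ℝ≥0∞)) (by exact_mod_cast hn) (by simp) x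
  simpa using h

theorem one_le_two_mul_cast {m : ℕ} (hm : 1 ≤ m) : (1 : ℝ≥0∞) ≤ ((2 * m : ℕ) : ℝ≥0∞) := by
  exact_mod_cast (by omega : 1 ≤ 2 * m)

/-- 2-uniform smoothness of the `ℓ_{2m}` norm. -/
theorem normLp_uniformSmooth {m : ℕ} (hm : 1 ≤ m) (s t : Vec d) :
    normLp ((2 * m : ℕ) : ℝ≥0∞) (s + t) ^ 2 + normLp ((2 * m : ℕ) : ℝ≥0∞) (s - t) ^ 2 ≤
      2 * normLp ((2 * m : ℕ) : ℝ≥0∞) s ^ 2 +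
        2 * (4 * m + 1) * normLp ((2 * m : ℕ) : ℝ≥0∞) t ^ 2 := by
  have h2m := one_le_two_mul_cast hm
  have hm' : (1 : ℝ≥0∞) ≤ (m : ℝ≥0∞) := by exact_mod_cast hm
  set X := normLp ((2 * m : ℕ) : ℝ≥0∞) (s + t) with hX
  set Y := normLp ((2 * m : ℕ) : ℝ≥0∞) (s - t) with hY
  have hsq : ∀ x : Vec d, normLp (m : ℝ≥0∞) (WithLp.toLp 2 fun i => x i ^ 2) =
      normLp ((2 * m : ℕ) : ℝ≥0∞) x ^ 2 := by
    intro x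
    have h1 := normLp_pow_nat hm (WithLp.toLp 2 fun i => x i ^ 2 : Vec d)
    have h2 := normLp_pow_nat (by omega : 1 ≤ 2 * m) x
    refine (pow_left_inj₀ (normLp_nonneg _ hm' _) (sq_nonneg _) (by omega : m ≠ 0)).1 ?_
    rw [h1, ← pow_mul, h2]
    refine Finset.sum_congr rfl fun i _ => ?_
    simp [abs_pow, pow_mul]
  have hc : (0 : ℝ) ≤ 4 * m + 1 := by positivity
  -- The scalar two-point bound is summed over coordinates as the m-th power of the ℓ_m norm of w;
  -- the triangle inequality in ℓ_m then separates s from t.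
  set w : Vec d := (WithLp.toLp 2 fun i => s i ^ 2) +
      (4 * m + 1 : ℝ) • (WithLp.toLp 2 fun i => t i ^ 2)
    with hw
  have hwn : normLp (m : ℝ≥0∞) w ≤ normLp ((2 * m : ℕ) : ℝ≥0∞) s ^ 2 +
      (4 * m + 1) * normLp ((2 * m : ℕ) : ℝ≥0∞) t ^ 2 := by
    refine (normLp_add_le _ hm' _ _).trans ?_
    rw [normLp_smul _ hm', abs_of_nonneg hc, hsq, hsq]
  have hpow : (X ^ (2 * m) + Y ^ (2 * m)) / 2 ≤ normLp (m : ℝ≥0∞) w ^ m := by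
    rw [normLp_pow_nat hm, hX, hY, normLp_pow_nat (by omega), normLp_pow_nat (by omega),
      ← Finset.sum_add_distrib, Finset.sum_div]
    refine Finset.sum_le_sum fun i _ => ?_
    rw [(even_two_mul m).pow_abs, (even_two_mul m).pow_abs]
    have hwi : |w i| = s i ^ 2 + (4 * m + 1) * t i ^ 2 := by
      rw [hw]
      simp only [PiLp.add_apply, PiLp.smul_apply, smul_eq_mul]
      exact abs_of_nonneg (by positivity)
    rw [hwi]
    exact pow_two_point hm (s i) (t i)
  have hmean : ((X ^ 2 + Y ^ 2) / 2) ^ m ≤ (X ^ (2 * m) + Y ^ (2 * m)) / 2 := by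
    have := (convexOn_pow m).2 (mem_Ici.2 (sq_nonneg X)) (mem_Ici.2 (sq_nonneg Y))
      (by norm_num : (0 : ℝ) ≤ 1 / 2) (by norm_num : (0 : ℝ) ≤ 1 / 2) (by norm_num)
    simp only [smul_eq_mul] at this
    rw [← mul_add, ← mul_add, one_div_mul_eq_div, one_div_mul_eq_div, ← pow_mul, ← pow_mul] at this
    exact this
  have hfin := (pow_le_pow_iff_left₀ (by positivity) (normLp_nonneg _ hm' _)
    (by omega : m ≠ 0)).1 (hmean.trans hpow)
  linarith

theorem convexOn_normLp_sq {p : ℝ≥0∞} (hp : 1 ≤ p) :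
    ConvexOn ℝ univ fun x : Vec d => normLp p x ^ 2 := by
  have h : ConvexOn ℝ univ (normLp p : Vec d → ℝ) := by
    refine ⟨convex_univ, fun x _ y _ a b ha hb _ => ?_⟩
    refine (normLp_add_le p hp _ _).trans ?_
    rw [normLp_smul p hp, normLp_smul p hp, abs_of_nonneg ha, abs_of_nonneg hb]
    rfl
  exact h.pow (fun x _ => normLp_nonneg p hp x) 2

theorem normLp_integral_sq_le (hd : 0 < d) {p : ℝ≥0∞} (hp : 1 ≤ p) {ζ : Sph d → Vec d}
    (hζ : Continuous ζ) :
    normLp p (∫ e, ζ e ∂unifSphere d) ^ 2 ≤ ∫ e, normLp p (ζ e) ^ 2 ∂unifSphere d := by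
  have := isProbabilityMeasure_unifSphere hd
  have hc : Continuous fun x : Vec d => normLp p x ^ 2 := (continuous_normLp p hp).pow 2
  exact (convexOn_normLp_sq hp).map_integral_le hc.continuousOn isClosed_univ
    (.of_forall fun _ => mem_univ _) (integrable_unifSphere_of_continuous hd hζ)
    (integrable_unifSphere_of_continuous hd (hc.comp hζ))

/-- Adding a centred random vector increases the expected squared `ℓ_{2m}` norm by at most a
multiple of the second moment of the vector. -/
theorem integral_normLp_add_sq_le (hd : 0 < d) {m : ℕ} (hm : 1 ≤ m) {ζ : Sph d → Vec d}
    (hζ : Continuous ζ) (hmean : ∫ e, ζ e ∂unifSphere d = 0) (s : Vec d) :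
    ∫ e, normLp ((2 * m : ℕ) : ℝ≥0∞) (s + ζ e) ^ 2 ∂unifSphere d ≤
      normLp ((2 * m : ℕ) : ℝ≥0∞) s ^ 2 +
        2 * (4 * m + 1) * ∫ e, normLp ((2 * m : ℕ) : ℝ≥0∞) (ζ e) ^ 2 ∂unifSphere d := by
  have := isProbabilityMeasure_unifSphere hd
  have h2m := one_le_two_mul_cast hm
  have hc : Continuous fun x : Vec d => normLp ((2 * m : ℕ) : ℝ≥0∞) x ^ 2 :=
    (continuous_normLp _ h2m).pow 2
  have i1 : Integrable (fun e => normLp ((2 * m : ℕ) : ℝ≥0∞) (s + ζ e) ^ 2) (unifSphere d) :=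
    integrable_unifSphere_of_continuous hd (hc.comp (continuous_const.add hζ))
  have i2 : Integrable (fun e => normLp ((2 * m : ℕ) : ℝ≥0∞) (s - ζ e) ^ 2) (unifSphere d) :=
    integrable_unifSphere_of_continuous hd (hc.comp (continuous_const.sub hζ))
  have i3 : Integrable (fun e => normLp ((2 * m : ℕ) : ℝ≥0∞) (ζ e) ^ 2) (unifSphere d) :=
    integrable_unifSphere_of_continuous hd (hc.comp hζ)
  have h1 := integral_mono (i1.add i2) ((integrable_const _).add (i3.const_mul _))
    fun e => normLp_uniformSmooth hm s (ζ e)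
  -- By Jensen the mean of ‖s - ζ‖² is at least ‖s‖², which removes that term from the smoothness
  -- inequality.
  have h2 : normLp ((2 * m : ℕ) : ℝ≥0∞) (∫ e, (s - ζ e) ∂unifSphere d) ^ 2 ≤
      ∫ e, normLp ((2 * m : ℕ) : ℝ≥0∞) (s - ζ e) ^ 2 ∂unifSphere d :=
    normLp_integral_sq_le hd h2m (continuous_const.sub hζ)
  rw [integral_sub (integrable_const _) (integrable_unifSphere_of_continuous hd hζ), hmean,
    integral_const, probReal_univ, one_smul, sub_zero] at h2
  rw [integral_add' i1 i2, integral_add' (integrable_const _) (i3.const_mul _), integral_const,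
    probReal_univ, one_smul, integral_const_mul] at h1
  linarith

/-- Second moment of the two-point randomized gradient in the `ℓ_{2m}` norm, `m ≳ log d`. -/
theorem integral_normLp_zoGrad_sq_le (hd : 0 < d) {m : ℕ} (hm : 1 ≤ m)
    (hdm : (d : ℝ) ^ 2 ≤ 4 ^ (m - 1)) {f : Vec d → ℝ} {K : NNReal} (hf : LipschitzWith K f)
    {γ : ℝ} (hγ : 0 < γ) (x : Vec d) :
    ∫ e, normLp ((2 * m : ℕ) : ℝ≥0∞) (zoGrad f γ x e) ^ 2 ∂unifSphere d ≤
      588 * m * (K : ℝ) ^ 2 := by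
  have := isProbabilityMeasure_unifSphere hd
  have h2m := one_le_two_mul_cast hm
  have hd' : (0 : ℝ) < d := by exact_mod_cast hd
  have hm' : (0 : ℝ) < m := by exact_mod_cast hm
  have hfc := hf.continuous
  set φ : Vec d → ℝ := fun w => (f (x + γ • w) - f (x - γ • w)) / (2 * γ) with hφ
  have hφL : LipschitzWith K φ := by
    refine LipschitzWith.of_dist_le_mul fun a b => ?_
    rw [Real.dist_eq, dist_eq_norm]
    have h1 := hf.norm_sub_le (x + γ • a) (x + γ • b)
    have h2 := hf.norm_sub_le (x - γ • b) (x - γ • a)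
    rw [show x + γ • a - (x + γ • b) = γ • (a - b) by module, norm_smul, Real.norm_eq_abs,
      Real.norm_eq_abs, abs_of_pos hγ] at h1
    rw [show x - γ • b - (x - γ • a) = γ • (a - b) by module, norm_smul, Real.norm_eq_abs,
      Real.norm_eq_abs, abs_of_pos hγ] at h2
    have e : φ a - φ b = ((f (x + γ • a) - f (x + γ • b)) + (f (x - γ • b) - f (x - γ • a)))
      / (2 * γ) := by simp only [hφ]; ring
    rw [e, abs_div, abs_of_pos (by positivity : 0 < 2 * γ), div_le_iff₀ (by positivity)]
    refine (abs_add_le _ _).trans ?_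
    linarith
  have hφodd : ∀ w, φ (-w) = -φ w := by
    intro w; simp only [hφ, smul_neg, sub_neg_eq_add, ← sub_eq_add_neg]; ring
  have hφ0 : φ 0 = 0 := by simp [hφ]
  have hφb : ∀ e : Sph d, φ e ^ 2 ≤ (K : ℝ) ^ 2 := by
    intro e
    have := hφL.norm_sub_le (e : Vec d) 0
    rw [hφ0, sub_zero, sub_zero, norm_eq_of_mem_sphere, mul_one] at this
    rw [← sq_abs]
    exact pow_le_pow_left₀ (abs_nonneg _) this 2
  have hvar := integral_sq_unifSphere_le hd hφL hφodd
  set N : Sph d → ℝ := fun e => normLp ((2 * m : ℕ) : ℝ≥0∞) (e : Vec d) ^ 2 with hN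
  have hN0 : ∀ e, 0 ≤ N e := fun e => sq_nonneg _
  have hNc : Continuous N := ((continuous_normLp _ h2m).comp continuous_subtype_val).pow 2
  have hφc : Continuous fun e : Sph d => φ e := hφL.continuous.comp continuous_subtype_val
  -- Truncation of ‖e‖²_{2m} at four times the scale 12m/d of its moments. Below τ the variance of φ
  -- gives 576mK²/d². Above τ only |φ| ≤ K is used, and the tail gains 4^{m-1} ≥ d², leaving
  -- 12mK²/d². The sum, times d², has constant 588.
  set τ : ℝ := 48 * m / d with hτ
  have hτ0 : 0 < τ := by positivity
  have hNm : ∫ e, N e ^ m ∂unifSphere d ≤ d * (12 * m / d) ^ m := by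
    have e : ∀ e : Sph d, N e ^ m = ∑ i, ((e : Vec d) i) ^ (2 * m) := by
      intro e
      simp only [hN]
      rw [← pow_mul, normLp_pow_nat (by omega)]
      exact Finset.sum_congr rfl fun i _ => (even_two_mul m).pow_abs _
    simp_rw [e]
    rw [integral_finsetSum _ fun i _ => integrable_unifSphere_of_continuous hd (by fun_prop)]
    calc _ ≤ ∑ _i : Fin d, (12 * m / d : ℝ) ^ m :=
          Finset.sum_le_sum fun i _ => integral_apply_pow_unifSphere_le hd i hm
      _ = _ := by simp
  have hpt : ∀ e : Sph d, φ e ^ 2 * N e ≤ τ * φ e ^ 2 + (K : ℝ) ^ 2 / τ ^ (m - 1) * N e ^ m := by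
    intro e
    have p1 : 0 ≤ (K : ℝ) ^ 2 / τ ^ (m - 1) * N e ^ m :=
      mul_nonneg (by positivity) (pow_nonneg (hN0 e) m)
    rcases le_total (N e) τ with h | h
    · have := mul_le_mul_of_nonneg_left h (sq_nonneg (φ e))
      linarith
    · have h1 : φ e ^ 2 * N e ≤ (K : ℝ) ^ 2 * N e := mul_le_mul_of_nonneg_right (hφb e) (hN0 e)
      have h2 : (K : ℝ) ^ 2 * N e ≤ (K : ℝ) ^ 2 / τ ^ (m - 1) * N e ^ m := by
        have hpow := pow_le_pow_left₀ hτ0.le h (m - 1)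
        rw [div_mul_eq_mul_div, le_div_iff₀ (by positivity)]
        calc (K : ℝ) ^ 2 * N e * τ ^ (m - 1) ≤ (K : ℝ) ^ 2 * N e * N e ^ (m - 1) := by
              refine mul_le_mul_of_nonneg_left hpow (mul_nonneg (sq_nonneg _) (hN0 e))
          _ = (K : ℝ) ^ 2 * N e ^ m := by
              rw [mul_assoc, ← pow_succ', Nat.sub_add_cancel hm]
      have : 0 ≤ τ * φ e ^ 2 := by positivity
      linarith
  have iφ : Integrable (fun e : Sph d => φ e ^ 2) (unifSphere d) :=
    integrable_unifSphere_of_continuous hd (hφc.pow 2)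
  have iN : Integrable (fun e : Sph d => N e ^ m) (unifSphere d) :=
    integrable_unifSphere_of_continuous hd (hNc.pow m)
  have hint := integral_mono (integrable_unifSphere_of_continuous hd ((hφc.pow 2).mul hNc))
    ((iφ.const_mul τ).add (iN.const_mul _)) hpt
  rw [integral_add' (iφ.const_mul τ) (iN.const_mul _), integral_const_mul,
      integral_const_mul] at hint
  have e : ∀ e : Sph d, normLp ((2 * m : ℕ) : ℝ≥0∞) (zoGrad f γ x e) ^ 2 =
      (d : ℝ) ^ 2 * (φ e ^ 2 * N e) := by
    intro e
    unfold zoGrad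
    rw [normLp_smul _ h2m, mul_pow, sq_abs]
    simp only [hφ, hN]; ring
  simp_rw [e]
  rw [integral_const_mul]
  change (∫ e : Sph d, φ e ^ 2 * N e ∂unifSphere d) ≤ _ at hint
  have t1 : τ * ∫ e : Sph d, φ e ^ 2 ∂unifSphere d ≤ τ * (12 * (K : ℝ) ^ 2 / d) := by gcongr
  have t2 : (K : ℝ) ^ 2 / τ ^ (m - 1) * ∫ e, N e ^ m ∂unifSphere d ≤ 12 * m *
      (K : ℝ) ^ 2 / d ^ 2 := by
    calc _ ≤ (K : ℝ) ^ 2 / τ ^ (m - 1) * (d * (12 * m / d) ^ m) := by gcongr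
      _ = 12 * m * (K : ℝ) ^ 2 / 4 ^ (m - 1) := by
        obtain ⟨k, rfl⟩ : ∃ k, m = k + 1 := ⟨m - 1, by omega⟩
        have key : ∀ w c : ℝ, w ^ k ≠ 0 → (d : ℝ) * w = c →
            (K : ℝ) ^ 2 / (4 * w) ^ k * (d * w ^ (k + 1)) = c * (K : ℝ) ^ 2 / 4 ^ k := by
          intro w c hw hc
          rw [← hc, mul_pow]
          field_simp
          ring
        rw [Nat.add_sub_cancel, hτ,
          show (48 * ((k + 1 : ℕ) : ℝ) / d) = 4 * (12 * ((k + 1 : ℕ) : ℝ) / d) by ring]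
        exact key _ _ (by positivity) (by field_simp)
      _ ≤ _ := by gcongr
  calc (d : ℝ) ^ 2 * ∫ e : Sph d, φ e ^ 2 * N e ∂unifSphere d
      ≤ (d : ℝ) ^ 2 * (τ * (12 * (K : ℝ) ^ 2 / d) + 12 * m * (K : ℝ) ^ 2 / d ^ 2) := by
        gcongr; linarith
    _ = 588 * m * (K : ℝ) ^ 2 := by rw [hτ]; field_simp; ring

/-- Second moment of the centred two-point randomized gradient. -/
theorem integral_normLp_zoGrad_sub_sq_le (hd : 0 < d) {m : ℕ} (hm : 1 ≤ m)
    (hdm : (d : ℝ) ^ 2 ≤ 4 ^ (m - 1)) {f : Vec d → ℝ} {K : NNReal} (hf : LipschitzWith K f)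
    {γ : ℝ} (hγ : 0 < γ) (x : Vec d) :
    ∫ e, normLp ((2 * m : ℕ) : ℝ≥0∞) (zoGrad f γ x e - meanGrad f γ x) ^ 2 ∂unifSphere d ≤
      2352 * m * (K : ℝ) ^ 2 := by
  have := isProbabilityMeasure_unifSphere hd
  have h2m := one_le_two_mul_cast hm
  have h1 := integral_normLp_zoGrad_sq_le hd hm hdm hf hγ x
  have hg : Continuous fun e : Sph d => zoGrad f γ x e :=
    (continuous_zoGrad hf.continuous γ).comp (by fun_prop : Continuous fun e : Sph d => (x, e))
  have h2 := normLp_integral_sq_le hd h2m hg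
  change normLp _ (meanGrad f γ x) ^ 2 ≤ _ at h2
  have hc : Continuous fun x : Vec d => normLp ((2 * m : ℕ) : ℝ≥0∞) x ^ 2 :=
    (continuous_normLp _ h2m).pow 2
  have ig : Integrable (fun e => normLp ((2 * m : ℕ) : ℝ≥0∞) (zoGrad f γ x e) ^ 2) (unifSphere d) :=
    integrable_unifSphere_of_continuous hd (hc.comp hg)
  -- Centring costs a factor 4: ‖g - h‖² ≤ 2‖g‖² + 2‖h‖² and ‖h‖² ≤ E‖g‖² by Jensen, hence 2352 =
  -- 4·588.
  have h3 := integral_mono (μ := unifSphere d) (f := fun e =>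
      normLp ((2 * m : ℕ) : ℝ≥0∞) (zoGrad f γ x e - meanGrad f γ x) ^ 2)
    (integrable_unifSphere_of_continuous hd (hc.comp (hg.sub continuous_const)))
    ((ig.const_mul 2).add (integrable_const (2 * normLp ((2 * m : ℕ) : ℝ≥0∞) (meanGrad f γ x) ^ 2)))
    fun e => by
      have t := normLp_add_le _ h2m (zoGrad f γ x e) (-meanGrad f γ x)
      rw [normLp_neg _ h2m, ← sub_eq_add_neg] at t
      have t0 := normLp_nonneg _ h2m (zoGrad f γ x e - meanGrad f γ x)
      have t2 := pow_le_pow_left₀ t0 t 2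
      simp only [Pi.add_apply]
      nlinarith [sq_nonneg (normLp ((2 * m : ℕ) : ℝ≥0∞) (zoGrad f γ x e) -
        normLp ((2 * m : ℕ) : ℝ≥0∞) (meanGrad f γ x))]
  rw [integral_add' (ig.const_mul 2) (integrable_const _), integral_const_mul, integral_const,
    probReal_univ, one_smul] at h3
  linarith

/-! ### Independent directions and resampling of one of them. -/

/-- The joint law of countably many independent uniform directions. -/
noncomputable def dirLaw (ι : Type*) (d : ℕ) : Measure (ι → Sph d) :=
  Measure.infinitePi fun _ => unifSphere d

theorem isProbabilityMeasure_dirLaw (ι : Type*) (hd : 0 < d) :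
    IsProbabilityMeasure (dirLaw ι d) := by
  have := isProbabilityMeasure_unifSphere hd
  unfold dirLaw; infer_instance

/-- Reduces an arbitrary probability space to the canonical product, where the expectations are
computed. -/
theorem map_eq_dirLaw {ι Ω : Type*} (hd : 0 < d) [MeasurableSpace Ω] {P : Measure Ω}
    [IsProbabilityMeasure P] {e : ι → Ω → Sph d} (he : ∀ i, Measurable (e i))
    (hlaw : ∀ i, P.map (e i) = unifSphere d) (hind : iIndepFun e P) :
    P.map (fun ω i => e i ω) = dirLaw ι d := by
  have := isProbabilityMeasure_unifSphere hd
  rw [(iIndepFun_iff_map_fun_eq_infinitePi_map he).1 hind]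
  simp [dirLaw, hlaw]

/-- A product of spheres is compact, so continuity alone gives integrability. -/
theorem integrable_dirLaw_of_continuous {ι : Type*} [Countable ι] (hd : 0 < d)
    {g : (ι → Sph d) → ℝ} (hg : Continuous g) :
    Integrable g (dirLaw ι d) := by
  have := isProbabilityMeasure_dirLaw ι hd
  have h := hg.continuousOn.integrableOn_compact (μ := dirLaw ι d) isCompact_univ
  rwa [integrableOn_univ] at h

section Resampling

variable {ι : Type*} [DecidableEq ι]

/-- Resampling one coordinate does not change the joint law. -/
theorem map_update_dirLaw (hd : 0 < d) (i : ι) :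
    ((dirLaw ι d).prod (unifSphere d)).map (fun q => Function.update q.1 i q.2) = dirLaw ι d := by
  have := isProbabilityMeasure_unifSphere hd
  have := isProbabilityMeasure_dirLaw ι hd
  have hm : Measurable fun q : (ι → Sph d) × Sph d => Function.update q.1 i q.2 := by
    refine measurable_pi_iff.2 fun j => ?_
    rcases eq_or_ne j i with rfl | h
    · simpa using measurable_snd
    · simpa [h, Function.comp_def] using (measurable_pi_apply j).comp measurable_fst
  refine Measure.eq_infinitePi _ fun s t ht => ?_
  have hpi : MeasurableSet (Set.pi (s : Set ι) t) :=
    MeasurableSet.pi s.countable_toSet fun j _ => ht j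
  rw [Measure.map_apply hm hpi]
  have key : ∀ j ∈ s.erase i, MeasurableSet (t j) := fun j _ => ht j
  by_cases hi : i ∈ s
  · have e : (fun q : (ι → Sph d) × Sph d => Function.update q.1 i q.2) ⁻¹' Set.pi (s : Set ι) t =
        Set.pi ((s.erase i : Finset ι) : Set ι) t ×ˢ t i := by
      ext q
      simp only [mem_preimage, Set.mem_pi, mem_prod, Finset.mem_coe, Finset.mem_erase]
      constructor
      · intro h
        refine ⟨fun j hj => by simpa [hj.1] using h j hj.2, by simpa using h i hi⟩
      · rintro ⟨h1, h2⟩ j hj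
        rcases eq_or_ne j i with rfl | hji
        · simpa using h2
        · simpa [hji] using h1 j ⟨hji, hj⟩
    rw [e, Measure.prod_prod, dirLaw, Measure.infinitePi_pi _ key, Finset.prod_erase_mul _ _ hi]
  · have e : (fun q : (ι → Sph d) × Sph d => Function.update q.1 i q.2) ⁻¹' Set.pi (s : Set ι) t =
        Set.pi (s : Set ι) t ×ˢ univ := by
      ext q
      simp only [mem_preimage, Set.mem_pi, mem_prod, Finset.mem_coe, mem_univ, and_true]
      refine forall₂_congr fun j hj => ?_
      have hji : j ≠ i := fun h => hi (h ▸ hj)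
      simp [hji]
    rw [e, Measure.prod_prod, measure_univ, mul_one, dirLaw,
        Measure.infinitePi_pi _ fun j _ => ht j]

variable [Countable ι]

/-- Integrating out one coordinate on which `Y` does not depend. -/
theorem integral_dirLaw_resample (hd : 0 < d) (i : ι) {E : Type*} [TopologicalSpace E]
    {Y : (ι → Sph d) → E} (hY : Continuous Y) (hYi : ∀ ω θ, Y (Function.update ω i θ) = Y ω)
    {H : E → Sph d → ℝ} (hH : Continuous H.uncurry) :
    ∫ ω, H (Y ω) (ω i) ∂dirLaw ι d = ∫ ω, ∫ θ, H (Y ω) θ ∂unifSphere d ∂dirLaw ι d := by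
  have := isProbabilityMeasure_unifSphere hd
  have := isProbabilityMeasure_dirLaw ι hd
  have hc : Continuous fun q : (ι → Sph d) × Sph d => Function.update q.1 i q.2 :=
    continuous_fst.update i continuous_snd
  have hG : Continuous fun ω : ι → Sph d => H (Y ω) (ω i) :=
    hH.comp (hY.prodMk (continuous_apply i))
  conv_lhs => rw [← map_update_dirLaw hd i]
  rw [integral_map hc.measurable.aemeasurable hG.aestronglyMeasurable]
  simp only [hYi, Function.update_self]
  have hHc : Continuous fun q : (ι → Sph d) × Sph d => H (Y q.1) q.2 :=
    hH.comp ((hY.comp continuous_fst).prodMk continuous_snd)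
  refine integral_prod _ ?_
  have h := hHc.continuousOn.integrableOn_compact
    (μ := (dirLaw ι d).prod (unifSphere d)) isCompact_univ
  rwa [integrableOn_univ] at h

/-- Second moment of a sum of conditionally centred noise terms. -/
theorem integral_normLp_sum_sq_le (hd : 0 < d) {m : ℕ} (hm : 1 ≤ m) {ζ : Vec d → Sph d → Vec d}
    (hζ : Continuous ζ.uncurry) (hmean : ∀ y, ∫ e, ζ y e ∂unifSphere d = 0) {V : ℝ}
    (hV : ∀ y, ∫ e, normLp ((2 * m : ℕ) : ℝ≥0∞) (ζ y e) ^ 2 ∂unifSphere d ≤ V)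
    {y : (ι → Sph d) → Vec d} (hy : Continuous y) {i : ℕ → ι} (hi : Function.Injective i)
    (hyi : ∀ j ω θ, y (Function.update ω (i j) θ) = y ω) (b : ℕ) :
    ∫ ω, normLp ((2 * m : ℕ) : ℝ≥0∞) (∑ j ∈ Finset.range b, ζ (y ω) (ω (i j))) ^ 2 ∂dirLaw ι d ≤
      b * (2 * (4 * m + 1) * V) := by
  have := isProbabilityMeasure_dirLaw ι hd
  have := isProbabilityMeasure_unifSphere hd
  have h2m := one_le_two_mul_cast hm
  have hN : Continuous fun x : Vec d => normLp ((2 * m : ℕ) : ℝ≥0∞) x ^ 2 :=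
    (continuous_normLp _ h2m).pow 2
  have hζi : ∀ j, Continuous fun ω : ι → Sph d => ζ (y ω) (ω (i j)) := fun j =>
    hζ.comp (hy.prodMk (continuous_apply (i j)))
  induction b with
  | zero =>
    simp only [Finset.range_zero, Finset.sum_empty, normLp_zero _ h2m]
    simp
  | succ b ih =>
    set S : (ι → Sph d) → Vec d := fun ω => ∑ j ∈ Finset.range b, ζ (y ω) (ω (i j)) with hS
    have hSc : Continuous S := continuous_finsetSum _ fun j _ => hζi j
    have hSi : ∀ ω θ, S (Function.update ω (i b) θ) = S ω := by
      intro ω θ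
      simp only [hS, hyi]
      refine Finset.sum_congr rfl fun j hj => ?_
      rw [Function.update_of_ne]
      exact fun h => (Finset.mem_range.1 hj).ne (hi h)
    -- Neither the query point nor the partial sum depends on direction b, so it can be integrated
    -- out first and uniform smoothness applied conditionally.
    have hr := integral_dirLaw_resample hd (i b) (Y := fun ω => (S ω, y ω)) (hSc.prodMk hy)
      (fun ω θ => by simp only [hSi, hyi])
      (H := fun w θ => normLp ((2 * m : ℕ) : ℝ≥0∞) (w.1 + ζ w.2 θ) ^ 2)
      (hN.comp ((continuous_fst.comp continuous_fst).add
        (hζ.comp ((continuous_snd.comp continuous_fst).prodMk continuous_snd))))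
    simp only [Finset.sum_range_succ]
    refine hr.trans_le ?_
    have hpt : ∀ ω, ∫ θ, normLp ((2 * m : ℕ) : ℝ≥0∞) (S ω + ζ (y ω) θ) ^ 2 ∂unifSphere d ≤
        normLp ((2 * m : ℕ) : ℝ≥0∞) (S ω) ^ 2 + 2 * (4 * m + 1) * V := by
      intro ω
      have hζy : Continuous (ζ (y ω)) := hζ.comp (by fun_prop : Continuous fun θ => (y ω, θ))
      refine (integral_normLp_add_sq_le hd hm hζy (hmean _) (S ω)).trans ?_
      have := hV (y ω)
      gcongr
    have iS : Integrable (fun ω => normLp ((2 * m : ℕ) : ℝ≥0∞) (S ω) ^ 2) (dirLaw ι d) :=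
      integrable_dirLaw_of_continuous hd (hN.comp hSc)
    refine (integral_mono_of_nonneg (.of_forall fun ω => integral_nonneg fun θ => sq_nonneg _)
      (iS.add (integrable_const _)) (.of_forall hpt)).trans ?_
    rw [integral_add' iS (integrable_const _), integral_const, probReal_univ, one_smul]
    rw [Nat.cast_succ, add_one_mul]
    exact add_le_add_left ih _

/-- Centred noise is uncorrelated with quantities independent of it. -/
theorem integral_inner_dirLaw_eq_zero (hd : 0 < d) {ζ : Vec d → Sph d → Vec d}
    (hζ : Continuous ζ.uncurry) (hmean : ∀ y, ∫ e, ζ y e ∂unifSphere d = 0)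
    {y w : (ι → Sph d) → Vec d} (hy : Continuous y) (hw : Continuous w) (i : ι)
    (hyi : ∀ ω θ, y (Function.update ω i θ) = y ω) (hwi : ∀ ω θ, w (Function.update ω i θ) = w ω) :
    ∫ ω, inner ℝ (ζ (y ω) (ω i)) (w ω) ∂dirLaw ι d = 0 := by
  have hr := integral_dirLaw_resample hd i (Y := fun ω => (y ω, w ω)) (hy.prodMk hw)
    (fun ω θ => by simp only [hyi, hwi]) (H := fun q θ => inner ℝ (ζ q.1 θ) q.2)
    ((hζ.comp ((continuous_fst.comp continuous_fst).prodMk continuous_snd)).inner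
      (continuous_snd.comp continuous_fst))
  refine hr.trans ?_
  have : ∀ ω, ∫ θ, inner ℝ (ζ (y ω) θ) (w ω) ∂unifSphere d = 0 := by
    intro ω
    have hζy : Continuous (ζ (y ω)) := hζ.comp (by fun_prop : Continuous fun θ => (y ω, θ))
    simp_rw [real_inner_comm (w ω)]
    rw [integral_inner (integrable_unifSphere_of_continuous hd hζy), hmean, inner_zero_right]
  simp [this]

end Resampling

/-! ### The iterates: feasibility, dependence on the directions, continuity. -/

theorem continuous_meanGrad (hd : 0 < d) {f : Vec d → ℝ} (hf : Continuous f) (γ : ℝ) :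
    Continuous (meanGrad f γ) := by
  have := isProbabilityMeasure_unifSphere hd
  have h := continuous_parametric_integral_of_continuous (μ := unifSphere d)
    (f := fun x e => zoGrad f γ x e) (continuous_zoGrad hf γ) isCompact_univ
  rw [Measure.restrict_univ] at h
  exact h

section Run

variable {Q : Set (Vec d)} {g : Vec d → Sph d → Vec d} {a : ℝ≥0∞} {β : ℝ} {B : ℕ}

/-- The batch gradient used in iteration `k`. -/
noncomputable def batchGrad (g : Vec d → Sph d → Vec d) (B k : ℕ) (e : ℕ → Sph d) (σ : State d) :
    Vec d :=
  (B : ℝ)⁻¹ • ∑ j ∈ Finset.range B, g (queryPt k σ.x σ.z) (e j)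

theorem accRun_succ_G (c : Vec d) (e : ℕ → ℕ → Sph d) (k : ℕ) :
    (accRun Q g a c β B e (k + 1)).G = (accRun Q g a c β B e k).G +
      ((k : ℝ) + 1) • batchGrad g B k (e k) (accRun Q g a c β B e k) := rfl

theorem accRun_succ_z (c : Vec d) (e : ℕ → ℕ → Sph d) (k : ℕ) :
    (accRun Q g a c β B e (k + 1)).z = proxPt Q a β c (accRun Q g a c β B e (k + 1)).G := rfl

theorem accRun_succ_x (c : Vec d) (e : ℕ → ℕ → Sph d) (k : ℕ) :
    (accRun Q g a c β B e (k + 1)).x =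
      queryPt k (accRun Q g a c β B e k).x (accRun Q g a c β B e (k + 1)).z := rfl

theorem accRun_z_mem (hQ : IsClosed Q) (ha : 1 ≤ a) (ha2 : a ≤ 2) (hβ : 0 < β) {c : Vec d}
    (hc : c ∈ Q) (e : ℕ → ℕ → Sph d) (k : ℕ) : (accRun Q g a c β B e k).z ∈ Q := by
  cases k with
  | zero => exact hc
  | succ k => rw [accRun_succ_z]; exact (proxPt_spec hQ ⟨c, hc⟩ ha ha2 hβ c _).1

theorem accRun_x_mem (hQ : IsClosed Q) (hQc : Convex ℝ Q) (ha : 1 ≤ a) (ha2 : a ≤ 2) (hβ : 0 < β)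
    {c : Vec d} (hc : c ∈ Q) (e : ℕ → ℕ → Sph d) (k : ℕ) : (accRun Q g a c β B e k).x ∈ Q := by
  induction k with
  | zero => exact hc
  | succ k ih =>
    rw [accRun_succ_x]
    exact queryPt_mem hQc k ih (accRun_z_mem hQ ha ha2 hβ hc e (k + 1))

/-- Adaptedness: the state after n iterations sees only the directions of earlier iterations. -/
theorem accRun_congr (c : Vec d) {e e' : ℕ → ℕ → Sph d} {n : ℕ}
    (h : ∀ k < n, ∀ j, e k j = e' k j) : accRun Q g a c β B e n = accRun Q g a c β B e' n := by
  induction n with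
  | zero => rfl
  | succ n ih =>
    have h1 := ih fun k hk => h k (by omega)
    have h2 : e n = e' n := funext (h n (by omega))
    simp only [accRun, h1, h2]

/-- All queries stay in Q, so only the oracle on Q matters. This permits replacing f by a global
Lipschitz extension. -/
theorem accRun_congr_oracle (hQ : IsClosed Q) (hQc : Convex ℝ Q) (ha : 1 ≤ a) (ha2 : a ≤ 2)
    (hβ : 0 < β) {g' : Vec d → Sph d → Vec d} (hg : ∀ y ∈ Q, ∀ θ, g y θ = g' y θ) {c : Vec d}
    (hc : c ∈ Q) (e : ℕ → ℕ → Sph d) (n : ℕ) :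
    accRun Q g a c β B e n = accRun Q g' a c β B e n := by
  induction n with
  | zero => rfl
  | succ n ih =>
    have hy := queryPt_mem hQc n (accRun_x_mem hQ hQc ha ha2 hβ hc (g := g') (B := B) e n)
      (accRun_z_mem hQ ha ha2 hβ hc (g := g') (B := B) e n)
    have hG : ∀ j, g _ (e n j) = g' _ (e n j) := fun j => hg _ hy (e n j)
    unfold queryPt at hG
    simp only [accRun, ih, accStep, hG]

theorem continuous_queryPt (k : ℕ) {T : Type*} [TopologicalSpace T] {x z : T → Vec d}
    (hx : Continuous x) (hz : Continuous z) : Continuous fun t => queryPt k (x t) (z t) := by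
  unfold queryPt; fun_prop

theorem continuous_batchGrad (hg : Continuous g.uncurry) (k : ℕ) {T : Type*} [TopologicalSpace T]
    {σ : T → State d} (hx : Continuous fun t => (σ t).x) (hz : Continuous fun t => (σ t).z)
    {e : T → ℕ → Sph d} (he : ∀ j, Continuous fun t => e t j) :
    Continuous fun t => batchGrad g B k (e t) (σ t) := by
  have hs : Continuous fun t => ∑ j ∈ Finset.range B,
      g (queryPt k (σ t).x (σ t).z) (e t j) :=
    continuous_finsetSum _ fun j _ => hg.comp ((continuous_queryPt k hx hz).prodMk (he j))
  exact hs.const_smul ((B : ℝ)⁻¹)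

theorem continuous_proxPt_comp (hQ : IsClosed Q) (hQc : Convex ℝ Q) (hne : Q.Nonempty)
    (ha : 1 < a) (ha2 : a ≤ 2) (hβ : 0 < β) {T : Type*} [TopologicalSpace T] {c G : T → Vec d}
    (hc : Continuous c) (hG : Continuous G) : Continuous fun t => proxPt Q a β (c t) (G t) := by
  have h := continuous_proxPt hQ hQc hne ha ha2 hβ
  have h' := h.comp (hc.prodMk hG)
  exact h'

theorem continuous_accRun (hQ : IsClosed Q) (hQc : Convex ℝ Q) (hne : Q.Nonempty) (ha : 1 < a)
    (ha2 : a ≤ 2) (hβ : 0 < β) (hg : Continuous g.uncurry) {T : Type*} [TopologicalSpace T]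
    {c : T → Vec d} (hc : Continuous c) {e : T → ℕ → ℕ → Sph d}
    (he : ∀ k j, Continuous fun t => e t k j) (n : ℕ) :
    (Continuous fun t => (accRun Q g a (c t) β B (e t) n).x) ∧
      (Continuous fun t => (accRun Q g a (c t) β B (e t) n).z) ∧
      Continuous fun t => (accRun Q g a (c t) β B (e t) n).G := by
  induction n with
  | zero => exact ⟨hc, hc, continuous_const⟩
  | succ n ih =>
    obtain ⟨hx, hz, hG⟩ := ih
    have hG' : Continuous fun t => (accRun Q g a (c t) β B (e t) (n + 1)).G := by
      simp only [accRun_succ_G]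
      have hb := continuous_batchGrad (B := B) hg n hx hz (he n)
      exact hG.add (hb.const_smul ((n : ℝ) + 1))
    have hz' : Continuous fun t => (accRun Q g a (c t) β B (e t) (n + 1)).z := by
      simp only [accRun_succ_z]
      exact continuous_proxPt_comp hQ hQc hne ha ha2 hβ hc hG'
    refine ⟨?_, hz', hG'⟩
    simp only [accRun_succ_x]
    exact continuous_queryPt n hx hz'

end Run

/-! ### The expected gap after one stage. -/

theorem sum_range_succ_sq_le (n : ℕ) :
    ∑ k ∈ Finset.range n, ((k : ℝ) + 1) ^ 2 ≤ (n : ℝ) * (n + 1) / 2 * n := by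
  induction n with
  | zero => simp
  | succ n ih =>
    rw [Finset.sum_range_succ]
    push_cast
    have : (0 : ℝ) ≤ n := Nat.cast_nonneg n
    nlinarith

theorem batchGrad_sub_eq {B : ℕ} (hB : 0 < B) (g : Vec d → Sph d → Vec d) (k : ℕ) (e : ℕ → Sph d)
    (σ : State d) (h : Vec d) : batchGrad g B k e σ - h =
      (B : ℝ)⁻¹ • ∑ j ∈ Finset.range B, (g (queryPt k σ.x σ.z) (e j) - h) := by
  have hB' : (B : ℝ) ≠ 0 := by exact_mod_cast hB.ne'
  rw [Finset.sum_sub_distrib, Finset.sum_const, Finset.card_range, smul_sub,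
    ← Nat.cast_smul_eq_nsmul ℝ, smul_smul, inv_mul_cancel₀ hB', one_smul]
  rfl

theorem continuous_ballAvg {f : Vec d → ℝ} {K : NNReal} (hf : LipschitzWith K f) (γ : ℝ) :
    Continuous (ballAvg f γ) := by
  have h : LipschitzWith K (ballAvg f γ) := LipschitzWith.of_dist_le_mul fun x y => by
    rw [Real.dist_eq, dist_eq_norm]; exact lipschitz_ballAvg hf γ x y
  exact h.continuous

set_option maxHeartbeats 400000 in
/-- Expected gap of a random process satisfying the recursion of the batched accelerated method. -/
theorem expected_gap_of_process (hd : 0 < d) {p : ℝ≥0∞} (hp : 1 ≤ p) (hp2 : p ≤ 2) {a : ℝ≥0∞}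
    (ha : 1 < a) (ha2 : a ≤ 2) (hpa : p ≤ a) {Q : Set (Vec d)} (hQc : Convex ℝ Q) {f : Vec d → ℝ}
        {K : NNReal} (hf : LipschitzWith K f) {γ : ℝ} (hγ : 0 < γ)
    (hcvx : ConvexOn ℝ (Metric.cthickening γ Q) f) {L N σ β : ℝ} (hL : 0 ≤ L) (hσ : 0 < σ)
    (hLσ : 8 * L ≤ σ) (hβ : 0 < β)
    (hup : ∀ x ∈ Q, ∀ y ∈ Q, ballAvg f γ x ≤ ballAvg f γ y + inner ℝ (meanGrad f γ y) (x - y) +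
      L * normLp p (x - y) ^ 2 + N * normLp p (x - y))
    (hσβ : ∀ v : Vec d, σ / 2 * normLp p v ^ 2 ≤ β * (a.toReal - 1) / 4 * normLp a v ^ 2)
    {m : ℕ} (hm : 1 ≤ m) (hdm : (d : ℝ) ^ 2 ≤ 4 ^ (m - 1)) {B : ℕ} (hB : 0 < B) (s : ℕ)
    {c : (ℕ × ℕ × ℕ → Sph d) → Vec d} (hc : Continuous c) {r : (ℕ × ℕ × ℕ → Sph d) → ℕ → State d}
    (hG0 : ∀ ω, (r ω 0).G = 0) (hz0 : ∀ ω, (r ω 0).z = c ω)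
    (hGs : ∀ ω k, (r ω (k + 1)).G = (r ω k).G +
      ((k : ℝ) + 1) • batchGrad (zoGrad f γ) B k (fun j => ω (s, k, j)) (r ω k))
    (hxs : ∀ ω k, (r ω (k + 1)).x = queryPt k (r ω k).x (r ω (k + 1)).z)
    (hxQ : ∀ ω k, (r ω k).x ∈ Q) (hzQ : ∀ ω k, (r ω k).z ∈ Q)
    (hmin : ∀ ω k, IsMinOn (proxObj a β (c ω) (r ω k).G) Q (r ω k).z)
    (hrx : ∀ k, Continuous fun ω => (r ω k).x) (hrz : ∀ k, Continuous fun ω => (r ω k).z)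
    (hri : ∀ k j ω θ, r (Function.update ω (s, k, j) θ) k = r ω k) {u : Vec d} (hu : u ∈ Q) {n : ℕ}
    (hn : 0 < n) :
    (∫ ω, ballAvg f γ (r ω n).x ∂dirLaw (ℕ × ℕ × ℕ) d) - ballAvg f γ u ≤
      β / (n * (n + 1)) * ∫ ω, normLp p (c ω - u) ^ 2 ∂dirLaw (ℕ × ℕ × ℕ) d +
        2 * n * (((d : ℝ) ^ (1 - 1 / p.toReal)) ^ 2 * (23520 * m ^ 2 * (K : ℝ) ^ 2) / B +
            N ^ 2) / σ := by
  have := isProbabilityMeasure_dirLaw (ℕ × ℕ × ℕ) hd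
  have := isProbabilityMeasure_unifSphere hd
  have hfc := hf.continuous
  have h2m := one_le_two_mul_cast hm
  have h2mt : ((2 * m : ℕ) : ℝ≥0∞) ≠ ∞ := ENNReal.natCast_ne_top _
  have hpt : p ≠ ∞ := ne_top_of_le_ne_top (by simp) hp2
  have hat : a ≠ ∞ := ne_top_of_le_ne_top (by simp) ha2
  have hB' : (0 : ℝ) < B := by exact_mod_cast hB
  have hn' : (0 : ℝ) < n := by exact_mod_cast hn
  set g := zoGrad f γ with hg
  set h := meanGrad f γ with hh
  have hgc : Continuous g.uncurry := continuous_zoGrad hfc γ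
  have hhc : Continuous h := continuous_meanGrad hd hfc γ
  obtain ⟨ζ, hζdef⟩ : ∃ ζ : Vec d → Sph d → Vec d, ζ =
    fun y θ => g y θ - h y := ⟨_, rfl⟩
  have hζ : Continuous ζ.uncurry := by
    rw [hζdef]; exact hgc.sub (hhc.comp continuous_fst)
  have hmean : ∀ y, ∫ θ, ζ y θ ∂unifSphere d = 0 := by
    intro y
    have hgy : Continuous (g y) := hgc.comp (by fun_prop : Continuous fun θ => (y, θ))
    simp only [hζdef]
    rw [integral_sub (integrable_unifSphere_of_continuous hd hgy) (integrable_const _),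
      integral_const, probReal_univ, one_smul]
    exact sub_self _
  obtain ⟨y, hy⟩ : ∃ y : ℕ → (ℕ × ℕ × ℕ → Sph d) → Vec d, y =
    fun k ω => queryPt k (r ω k).x (r ω k).z := ⟨_, rfl⟩
  have hyc : ∀ k, Continuous (y k) := fun k => by
    rw [hy]; exact continuous_queryPt k (hrx k) (hrz k)
  have hyi : ∀ k j ω θ, y k (Function.update ω (s, k, j) θ) = y k ω := fun k j ω θ => by
    simp only [hy, hri]
  obtain ⟨ξ, hξ⟩ : ∃ ξ : ℕ → (ℕ × ℕ × ℕ → Sph d) → Vec d, ξ =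
    fun k ω => batchGrad g B k (fun j => ω (s, k, j)) (r ω k) - h (y k ω) := ⟨_, rfl⟩
  have hξe : ∀ k (ω : ℕ × ℕ × ℕ → Sph d), ξ k ω = (B : ℝ)⁻¹ • ∑ j ∈ Finset.range B,
      ζ (y k ω) (ω (s, k, j)) := by
    intro k ω
    simp only [hξ, hζdef, hy]
    exact batchGrad_sub_eq hB _ _ _ _ _
  have hζc : ∀ k j, Continuous fun ω => ζ (y k ω) (ω (s, k, j)) := fun k j =>
    hζ.comp ((hyc k).prodMk (continuous_apply _))
  have hξc : ∀ k, Continuous (ξ k) := by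
    intro k
    rw [funext (hξe k)]
    have h := continuous_finsetSum (Finset.range B) fun j _ => hζc k j
    exact h.const_smul (B : ℝ)⁻¹
  obtain ⟨κ, hκ⟩ : ∃ κ : ℝ, κ =
    (d : ℝ) ^ (1 - 1 / p.toReal) := ⟨_, rfl⟩
  obtain ⟨W, hW⟩ : ∃ W : ℕ → (ℕ × ℕ × ℕ → Sph d) → ℝ, W =
    fun k ω => κ * normLp ((2 * m : ℕ) : ℝ≥0∞) (ξ k ω) := ⟨_, rfl⟩
  have hWb : ∀ k ω v, |inner ℝ (ξ k ω) v| ≤ W k ω * normLp p v := fun k ω v => by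
    rw [hW, hκ]; exact abs_inner_le_normLp hp hpt h2m h2mt (ξ k ω) v
  have hWc : ∀ k, Continuous (W k) := fun k => by
    rw [hW]; exact continuous_const.mul ((continuous_normLp _ h2m).comp (hξc k))
  obtain ⟨V, hV⟩ : ∃ V : ℝ, V =
    κ ^ 2 * (23520 * m ^ 2 * (K : ℝ) ^ 2) / B := ⟨_, rfl⟩
  have hζV : ∀ y, ∫ θ, normLp ((2 * m : ℕ) : ℝ≥0∞) (ζ y θ) ^ 2 ∂unifSphere d ≤
      2352 * m * (K : ℝ) ^ 2 := by
    intro y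
    simp only [hζdef, hg, hh]
    exact integral_normLp_zoGrad_sub_sq_le hd hm hdm hf hγ y
  have hWV : ∀ k, ∫ ω, W k ω ^ 2 ∂dirLaw (ℕ × ℕ × ℕ) d ≤ V := by
    intro k
    have h1 := integral_normLp_sum_sq_le hd hm hζ hmean hζV (hyc k) (i := fun j => (s, k, j))
      (fun j j' h => by simpa using h) (hyi k) B
    have e : ∀ ω : ℕ × ℕ × ℕ → Sph d, W k ω ^ 2 = κ ^ 2 * (B : ℝ)⁻¹ ^ 2 *
      normLp ((2 * m : ℕ) : ℝ≥0∞)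
        (∑ j ∈ Finset.range B, ζ (y k ω) (ω (s, k, j))) ^ 2 := by
      intro ω
      simp only [hW, hξe]
      rw [normLp_smul _ h2m, mul_pow, mul_pow, sq_abs]; ring
    simp_rw [e]
    rw [integral_const_mul]
    refine (mul_le_mul_of_nonneg_left h1 (by positivity)).trans ?_
    have hm' : (1 : ℝ) ≤ m := by exact_mod_cast hm
    rw [hV]
    -- 23520 is 2·5·2352, using 4m + 1 ≤ 5m.
    calc κ ^ 2 * (B : ℝ)⁻¹ ^ 2 * (B * (2 * (4 * m + 1) * (2352 * m * (K : ℝ) ^ 2)))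
        = κ ^ 2 * (2 * (4 * m + 1) * (2352 * m * (K : ℝ) ^ 2)) / B := by field_simp
      _ ≤ _ := by
        gcongr ?_ / _
        refine mul_le_mul_of_nonneg_left ?_ (sq_nonneg _)
        have : 0 ≤ (m : ℝ) * (K : ℝ) ^ 2 := by positivity
        nlinarith
  -- The comparison point is u - z_k, and z_k does not depend on the directions of iteration k: a
  -- martingale difference.
  have hmart : ∀ k, ∫ ω, inner ℝ (ξ k ω) (u - (r ω k).z) ∂dirLaw (ℕ × ℕ × ℕ) d = 0 := by
    intro k
    have hzc : Continuous fun ω => u - (r ω k).z := continuous_const.sub (hrz k)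
    have h1 : ∀ j, ∫ ω, inner ℝ (ζ (y k ω) (ω (s, k, j))) (u - (r ω k).z)
        ∂dirLaw (ℕ × ℕ × ℕ) d = 0 := fun j =>
      integral_inner_dirLaw_eq_zero hd hζ hmean (hyc k) hzc (s, k, j) (hyi k j)
        fun ω θ => by simp only [hri]
    simp_rw [hξe, real_inner_smul_left, sum_inner]
    rw [integral_const_mul, integral_finsetSum _ fun j _ =>
      integrable_dirLaw_of_continuous hd ((hζc k j).inner hzc)]
    simp [h1]
  have hpath : ∀ ω, (n : ℝ) * (n + 1) / 2 * (ballAvg f γ (r ω n).x - ballAvg f γ u) ≤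
      β * (normLp p (c ω - u) ^ 2 / 2) + ∑ k ∈ Finset.range n,
        (((k : ℝ) + 1) ^ 2 * (2 * (W k ω ^ 2 + N ^ 2) / σ) +
          ((k : ℝ) + 1) * inner ℝ (ξ k ω) (u - (r ω k).z)) := by
    intro ω
    have hest := accelerated_estimate (F := ballAvg f γ) (h := h) (nr := normLp p) (Q := Q)
      (a := a) (β := β) (c := c ω) (x := fun k => (r ω k).x) (z := fun k => (r ω k).z)
      (G := fun k => (r ω k).G) (g := fun k => batchGrad g B k (fun j => ω (s, k, j)) (r ω k))
      (W := fun k => W k ω) hQc (normLp_nonneg p hp) (normLp_smul p hp) hL hσ hLσ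
      (fun x hx y hy => ballAvg_gradient_inequality hd hf hγ hcvx hx hy) hup (hG0 ω) (hz0 ω)
      (hGs ω) (hxs ω) (hxQ ω) (hzQ ω) ha.le
      (fun k v hv => by
        have := proxObj_growth hQc ha ha2 hβ.le (hzQ ω k) (hmin ω k) hv
        linarith [hσβ (v - (r ω k).z)])
      (fun k v => by
        have := hWb k ω v
        rw [hξ, hy] at this
        exact this) hu n
    have hξω : ∀ k, batchGrad g B k (fun j => ω (s, k, j)) (r ω k) -
        h (queryPt k (r ω k).x (r ω k).z) = ξ k ω := fun k => by rw [hξ, hy]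
    simp only [hξω] at hest
    refine hest.trans ?_
    -- The prox distance in ℓ_a is at most the ℓ_p distance since p ≤ a.
    have h1 := normLp_antitone hp hpa hat (u - c ω)
    rw [normLp_sub_comm p hp u] at h1
    have h0 := normLp_nonneg a ha.le (u - c ω)
    gcongr
  have iW : ∀ k : ℕ, Integrable (fun ω => ((k : ℝ) + 1) ^ 2 * (2 * (W k ω ^ 2 + N ^ 2) / σ))
      (dirLaw (ℕ × ℕ × ℕ) d) := fun k =>
    integrable_dirLaw_of_continuous hd (continuous_const.mul ((continuous_const.mul
      (((hWc k).pow 2).add continuous_const)).div_const _))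
  have iM : ∀ k : ℕ, Integrable (fun ω => ((k : ℝ) + 1) * inner ℝ (ξ k ω) (u - (r ω k).z))
      (dirLaw (ℕ × ℕ × ℕ) d) := fun k =>
    integrable_dirLaw_of_continuous hd (continuous_const.mul ((hξc k).inner
      (continuous_const.sub (hrz k))))
  have iWM : ∀ k : ℕ, Integrable (fun ω => ((k : ℝ) + 1) ^ 2 * (2 * (W k ω ^ 2 + N ^ 2) / σ) +
      ((k : ℝ) + 1) * inner ℝ (ξ k ω) (u - (r ω k).z)) (dirLaw (ℕ × ℕ × ℕ) d) :=
    fun k => (iW k).add (iM k)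
  have iF : Integrable (fun ω => ballAvg f γ (r ω n).x) (dirLaw (ℕ × ℕ × ℕ) d) := by
    exact integrable_dirLaw_of_continuous hd ((continuous_ballAvg hf γ).comp (hrx n))
  have iD : Integrable (fun ω => β * (normLp p (c ω - u) ^ 2 / 2)) (dirLaw (ℕ × ℕ × ℕ) d) :=
    integrable_dirLaw_of_continuous hd (continuous_const.mul
      ((((continuous_normLp p hp).comp (hc.sub continuous_const)).pow 2).div_const _))
  have iS : Integrable (fun ω => ∑ k ∈ Finset.range n,
        (((k : ℝ) + 1) ^ 2 * (2 * (W k ω ^ 2 + N ^ 2) / σ) +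
          ((k : ℝ) + 1) * inner ℝ (ξ k ω) (u - (r ω k).z))) (dirLaw (ℕ × ℕ × ℕ) d) :=
    integrable_finsetSum _ fun k _ => iWM k
  have hint := integral_mono (((iF.sub (integrable_const (ballAvg f γ u)))).const_mul
    ((n : ℝ) * (n + 1) / 2)) (iD.add iS) hpath
  rw [integral_const_mul, integral_sub' iF (integrable_const _), integral_const, probReal_univ,
    one_smul, integral_add' iD iS, integral_const_mul, integral_div,
    integral_finsetSum _ fun k _ => iWM k] at hint
  have hterm : ∀ k ∈ Finset.range n, ∫ ω, (((k : ℝ) + 1) ^ 2 * (2 * (W k ω ^ 2 + N ^ 2) / σ) +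
      ((k : ℝ) + 1) * inner ℝ (ξ k ω) (u - (r ω k).z)) ∂dirLaw (ℕ × ℕ × ℕ) d ≤
      ((k : ℝ) + 1) ^ 2 * (2 * (V + N ^ 2) / σ) := by
    intro k _
    have iWk : Integrable (fun ω => W k ω ^ 2) (dirLaw (ℕ × ℕ × ℕ) d) :=
      integrable_dirLaw_of_continuous hd ((hWc k).pow 2)
    rw [integral_add (iW k) (iM k), integral_const_mul, integral_const_mul, hmart, mul_zero,
      add_zero, integral_div, integral_const_mul, integral_add iWk (integrable_const _),
      integral_const, probReal_univ, one_smul]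
    have := hWV k
    gcongr
  have hsum := Finset.sum_le_sum hterm
  rw [← Finset.sum_mul] at hsum
  have hV0 : 0 ≤ V := by rw [hV]; positivity
  have hsq := mul_le_mul_of_nonneg_right (sum_range_succ_sq_le n)
    (by positivity : 0 ≤ 2 * (V + N ^ 2) / σ)
  set D := ∫ ω, normLp p (c ω - u) ^ 2 ∂dirLaw (ℕ × ℕ × ℕ) d with hD
  rw [← hκ, ← hV]
  have hfin : (n : ℝ) * (n + 1) / 2 * ((∫ ω, ballAvg f γ (r ω n).x ∂dirLaw (ℕ × ℕ × ℕ) d) -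
      ballAvg f γ u) ≤ (n : ℝ) * (n + 1) / 2 * (β / (n * (n + 1)) * D +
        2 * n * (V + N ^ 2) / σ) := by
    have e1 : (n : ℝ) * (n + 1) / 2 * (β / (n * (n + 1)) * D + 2 * n * (V + N ^ 2) / σ) =
        β * (D / 2) + n * (n + 1) / 2 * n * (2 * (V + N ^ 2) / σ) := by field_simp
    rw [e1]
    exact hint.trans (add_le_add_right (hsum.trans hsq) _)
  exact le_of_mul_le_mul_left hfin (by positivity)

/-- Expected gap of one stage of the batched accelerated method, for the smoothed function. -/
theorem accRun_expected_gap (hd : 0 < d) {p : ℝ≥0∞} (hp : 1 ≤ p) (hp2 : p ≤ 2) {a : ℝ≥0∞}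
    (ha : 1 < a) (ha2 : a ≤ 2) (hpa : p ≤ a) {Q : Set (Vec d)} (hQ : IsClosed Q)
    (hQc : Convex ℝ Q) {f : Vec d → ℝ} {K : NNReal} (hf : LipschitzWith K f) {γ : ℝ} (hγ : 0 < γ)
    (hcvx : ConvexOn ℝ (Metric.cthickening γ Q) f) {L N σ β : ℝ} (hL : 0 ≤ L) (hσ : 0 < σ)
    (hLσ : 8 * L ≤ σ) (hβ : 0 < β)
    (hup : ∀ x ∈ Q, ∀ y ∈ Q, ballAvg f γ x ≤ ballAvg f γ y + inner ℝ (meanGrad f γ y) (x - y) +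
      L * normLp p (x - y) ^ 2 + N * normLp p (x - y))
    (hσβ : ∀ v : Vec d, σ / 2 * normLp p v ^ 2 ≤ β * (a.toReal - 1) / 4 * normLp a v ^ 2)
    {m : ℕ} (hm : 1 ≤ m) (hdm : (d : ℝ) ^ 2 ≤ 4 ^ (m - 1)) {B : ℕ} (hB : 0 < B) (s : ℕ)
    {c : (ℕ × ℕ × ℕ → Sph d) → Vec d} (hc : Continuous c) (hcQ : ∀ ω, c ω ∈ Q)
    (hcs : ∀ k j ω θ, c (Function.update ω (s, k, j) θ) = c ω) {u : Vec d} (hu : u ∈ Q) {n : ℕ}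
    (hn : 0 < n) :
    (∫ ω, ballAvg f γ (accRun Q (zoGrad f γ) a (c ω) β B (fun k j => ω (s, k, j)) n).x
        ∂dirLaw (ℕ × ℕ × ℕ) d) - ballAvg f γ u ≤
      β / (n * (n + 1)) * ∫ ω, normLp p (c ω - u) ^ 2 ∂dirLaw (ℕ × ℕ × ℕ) d +
        2 * n * (((d : ℝ) ^ (1 - 1 / p.toReal)) ^ 2 * (23520 * m ^ 2 * (K : ℝ) ^ 2) / B +
            N ^ 2) / σ := by
  have hne : Q.Nonempty := ⟨u, hu⟩
  have hgc : Continuous (zoGrad f γ).uncurry := continuous_zoGrad hf.continuous γ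
  have hrc := fun k => continuous_accRun (B := B) hQ hQc hne ha ha2 hβ hgc hc
    (e := fun ω k j => ω (s, k, j)) (fun k j => continuous_apply _) k
  refine expected_gap_of_process hd hp hp2 ha ha2 hpa hQc hf hγ hcvx hL hσ hLσ hβ hup hσβ hm hdm hB
    s hc (r := fun ω => accRun Q (zoGrad f γ) a (c ω) β B (fun k j => ω (s, k, j)))
    (fun _ => rfl) (fun _ => rfl) (fun _ _ => rfl) (fun _ _ => rfl)
    (fun ω k => accRun_x_mem hQ hQc ha.le ha2 hβ (hcQ ω) _ k)
    (fun ω k => accRun_z_mem hQ ha.le ha2 hβ (hcQ ω) _ k) (fun ω k => ?_)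
    (fun k => (hrc k).1) (fun k => (hrc k).2.1) (fun k j ω θ => ?_) hu hn
  · cases k with
    -- Before the first step the accumulated gradient is zero, so the centre itself minimizes the
    -- prox objective.
    | zero =>
      intro v _
      change inner ℝ (0 : Vec d) (c ω) + β * (normLp a (c ω - c ω) ^ 2 / 2) ≤
        inner ℝ (0 : Vec d) v + β * (normLp a (v - c ω) ^ 2 / 2)
      rw [sub_self, normLp_zero a ha.le, inner_zero_left, inner_zero_left]
      have : 0 ≤ β * (normLp a (v - c ω) ^ 2 / 2) := by positivity
      simpa using this
    | succ k => exact (proxPt_spec hQ hne ha.le ha2 hβ (c ω) _).2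
  · simp only [hcs]
    refine accRun_congr _ fun k' hk' j' => Function.update_of_ne ?_ _ _
    simp only [ne_eq, Prod.mk.injEq, not_and]
    intro _ h; omega

/-! ### Restarts under strong convexity. -/

section Restart

variable {Q : Set (Vec d)} {g : Vec d → Sph d → Vec d}

theorem restarted_mem (hQ : IsClosed Q) (hQc : Convex ℝ Q) {x₀ : Vec d} (hx₀ : x₀ ∈ Q) (π : Params)
    (e : ℕ → ℕ → ℕ → Sph d) (s : ℕ) : restarted Q g x₀ π e s ∈ Q := by
  induction s with
  | zero => exact hx₀
  | succ s ih =>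
    exact accRun_x_mem hQ hQc π.one_lt_proxExp.le π.proxExp_le_two (π.reg_pos s) ih _ _

theorem restarted_congr (x₀ : Vec d) (π : Params) {e e' : ℕ → ℕ → ℕ → Sph d} {s : ℕ}
    (h : ∀ s' < s, e s' = e' s') : restarted Q g x₀ π e s = restarted Q g x₀ π e' s := by
  induction s with
  | zero => rfl
  | succ s ih =>
    simp only [restarted, ih fun s' hs' => h s' (by omega), h s (by omega)]

theorem restarted_congr_oracle (hQ : IsClosed Q) (hQc : Convex ℝ Q) {x₀ : Vec d} (hx₀ : x₀ ∈ Q)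
    (π : Params) {g' : Vec d → Sph d → Vec d} (hg : ∀ y ∈ Q, ∀ θ, g y θ = g' y θ)
    (e : ℕ → ℕ → ℕ → Sph d) (s : ℕ) : restarted Q g x₀ π e s = restarted Q g' x₀ π e s := by
  induction s with
  | zero => rfl
  | succ s ih =>
    simp only [restarted, ih]
    rw [accRun_congr_oracle hQ hQc π.one_lt_proxExp.le π.proxExp_le_two (π.reg_pos s) hg
      (restarted_mem hQ hQc hx₀ π e s)]

theorem continuous_restarted (hQ : IsClosed Q) (hQc : Convex ℝ Q) {x₀ : Vec d} (hx₀ : x₀ ∈ Q)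
    (π : Params) (hg : Continuous g.uncurry) (s : ℕ) :
    Continuous fun ω : ℕ × ℕ × ℕ → Sph d => restarted Q g x₀ π (fun s k j => ω (s, k, j)) s := by
  induction s with
  | zero => exact continuous_const
  | succ s ih =>
    exact (continuous_accRun hQ hQc ⟨x₀, hx₀⟩ π.one_lt_proxExp π.proxExp_le_two (π.reg_pos s) hg ih
      (e := fun ω k j => ω (s, k, j)) (fun k j => continuous_apply _) (π.iters s)).1

theorem restarted_update (x₀ : Vec d) (π : Params) (s k j : ℕ) (ω : ℕ × ℕ × ℕ → Sph d)
    (θ : Sph d) :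
    restarted Q g x₀ π (fun s' k' j' => Function.update ω (s, k, j) θ (s', k', j')) s =
      restarted Q g x₀ π (fun s' k' j' => ω (s', k', j')) s := by
  refine restarted_congr x₀ π fun s' hs' => ?_
  funext k' j'
  refine Function.update_of_ne ?_ _ _
  simp only [ne_eq, Prod.mk.injEq, not_and]
  intro h; omega

end Restart

/-- Quadratic growth of a strongly convex function around its minimizer. -/
theorem StrongConvexLp.growth {p : ℝ≥0∞} {μ : ℝ} {Q : Set (Vec d)} {f : Vec d → ℝ}
    (h : StrongConvexLp p μ Q f) (hμ : 0 ≤ μ) {u x : Vec d} (hu : u ∈ Q) (hmin : IsMinOn f Q u)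
    (hx : x ∈ Q) : μ / 2 * normLp p (x - u) ^ 2 ≤ f x - f u := by
  set A := μ / 2 * normLp p (x - u) ^ 2 with hA
  have hA0 : 0 ≤ A := by positivity
  have hxu : f u ≤ f x := hmin hx
  by_contra! hlt
  have hApos : 0 < A := by linarith
  -- In place of the limit t → 0: this t gives (1-t)A = (A + f x - f u)/2, which would exceed f x -
  -- f u if the claim failed.
  set t := (A - (f x - f u)) / (2 * A) with ht
  have ht0 : 0 < t := div_pos (by linarith) (by linarith)
  have ht1 : t ≤ 1 := by rw [ht, div_le_one (by linarith)]; linarith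
  have h1 := h.2 x hx u hu t ht0.le ht1
  have h2 : f u ≤ f (t • x + (1 - t) • u) := hmin (h.1 hx hu ht0.le (by linarith) (by ring))
  have h3 : t * ((1 - t) * A) ≤ t * (f x - f u) := by
    have : μ / 2 * (t * (1 - t)) * normLp p (x - u) ^ 2 = t * ((1 - t) * A) := by rw [hA]; ring
    linarith
  have h4 := le_of_mul_le_mul_left h3 ht0
  have h5 : t * A = (A - (f x - f u)) / 2 := by rw [ht]; field_simp
  linarith

/-- Expected accuracy of the restarted method with constant parameters. -/
theorem restarted_expected_gap (hd : 0 < d) {p : ℝ≥0∞} (hp : 1 ≤ p) (hp2 : p ≤ 2) (π : Params)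
    (hpa : p ≤ π.proxExp) {Q : Set (Vec d)} (hQ : IsClosed Q) (hQc : Convex ℝ Q) {f : Vec d → ℝ}
    {K : NNReal} (hf : LipschitzWith K f) {γ : ℝ} (hγ : 0 < γ)
    (hcvx : ConvexOn ℝ (Metric.cthickening γ Q) f) {L N σ μ ε R : ℝ} (hL : 0 ≤ L) (hσ : 0 < σ)
    (hLσ : 8 * L ≤ σ) (hμ : 0 < μ) (hKγ : K * γ ≤ ε / 2) (hε : 0 < ε)
    (hup : ∀ x ∈ Q, ∀ y ∈ Q, ballAvg f γ x ≤ ballAvg f γ y + inner ℝ (meanGrad f γ y) (x - y) +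
      L * normLp p (x - y) ^ 2 + N * normLp p (x - y))
    {n B m : ℕ} (hn : 0 < n) (hB : 0 < B) (hm : 1 ≤ m) (hdm : (d : ℝ) ^ 2 ≤ 4 ^ (m - 1))
    (hπn : ∀ s, π.iters s = n) (hπB : ∀ s, π.batch s = B)
    (hπβ : ∀ s, π.reg s = μ * (n * (n + 1)) / 16)
    (hσβ : ∀ v : Vec d, σ / 2 * normLp p v ^ 2 ≤
      μ * (n * (n + 1)) / 16 * (π.proxExp.toReal - 1) / 4 * normLp π.proxExp v ^ 2)
    (hnoise : 2 * n * (((d : ℝ) ^ (1 - 1 / p.toReal)) ^ 2 * (23520 * m ^ 2 * (K : ℝ) ^ 2) / B +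
        N ^ 2)
      / σ ≤ ε / 8)
    (hsc : StrongConvexLp p μ Q f) {x₀ u : Vec d} (hx₀ : x₀ ∈ Q) (hu : u ∈ Q)
    (hmin : IsMinOn f Q u) (hR : normLp p (x₀ - u) ≤ R) (hS : 2 * (μ * R ^ 2) ≤ ε * 8 ^ π.stages)
    (hS0 : 0 < π.stages) :
    (∫ ω, f (output Q f γ x₀ π fun s k j => ω (s, k, j)) ∂dirLaw (ℕ × ℕ × ℕ) d) - f u ≤ ε := by
  have := isProbabilityMeasure_dirLaw (ℕ × ℕ × ℕ) hd
  obtain ⟨c, hc⟩ : ∃ c : ℕ → (ℕ × ℕ × ℕ → Sph d) → Vec d, ∀ s ω, c s ω =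
    restarted Q (zoGrad f γ) x₀ π (fun s k j => ω (s, k, j)) s := ⟨_, fun _ _ => rfl⟩
  have hcc : ∀ s, Continuous (c s) := fun s => by
    rw [funext (hc s)]
    have hgc : Continuous (zoGrad f γ).uncurry := continuous_zoGrad hf.continuous γ
    exact continuous_restarted hQ hQc hx₀ π hgc s
  have hcQ : ∀ s ω, c s ω ∈ Q := fun s ω => by rw [hc]; exact restarted_mem hQ hQc hx₀ π _ s
  have hci : ∀ s k j ω θ, c s (Function.update ω (s, k, j) θ) = c s ω := fun s k j ω θ => by
    rw [hc, hc]; exact restarted_update x₀ π s k j ω θ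
  obtain ⟨D, hD⟩ : ∃ D : ℕ → ℝ, ∀ s, D s =
    ∫ ω, normLp p (c s ω - u) ^ 2 ∂dirLaw (ℕ × ℕ × ℕ) d := ⟨_, fun _ => rfl⟩
  -- The regularization μn(n+1)/16 is chosen so that β/(n(n+1)) = μ/16, independently of n.
  have hgap : ∀ s, (∫ ω, ballAvg f γ (c (s + 1) ω) ∂dirLaw (ℕ × ℕ × ℕ) d) - ballAvg f γ u ≤
      μ * D s / 16 + ε / 8 := by
    intro s
    have h := accRun_expected_gap hd hp hp2 π.one_lt_proxExp π.proxExp_le_two hpa hQ hQc hf hγ hcvx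
      hL hσ hLσ (β := μ * (n * (n + 1)) / 16) (by positivity) hup hσβ hm hdm hB s (hcc s) (hcQ s)
      (hci s) hu hn
    have e : ∀ ω, c (s + 1) ω = (accRun Q (zoGrad f γ) π.proxExp (c s ω)
        (μ * (n * (n + 1)) / 16) B (fun k j => ω (s, k, j)) n).x := fun ω => by
      rw [hc, hc, restarted, hπn, hπB, hπβ]
    simp_rw [e]
    refine h.trans (add_le_add (le_of_eq ?_) hnoise)
    rw [hD]
    field_simp
  have iF : ∀ s, Integrable (fun ω => ballAvg f γ (c s ω)) (dirLaw (ℕ × ℕ × ℕ) d) := fun s =>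
    integrable_dirLaw_of_continuous hd ((continuous_ballAvg hf γ).comp (hcc s))
  have ifc : ∀ s, Integrable (fun ω => f (c s ω)) (dirLaw (ℕ × ℕ × ℕ) d) := fun s =>
    integrable_dirLaw_of_continuous hd (hf.continuous.comp (hcc s))
  have hfF : ∀ s, (∫ ω, f (c s ω) ∂dirLaw (ℕ × ℕ × ℕ) d) ≤
      ∫ ω, ballAvg f γ (c s ω) ∂dirLaw (ℕ × ℕ × ℕ) d := fun s =>
    integral_mono (ifc s) (iF s) fun ω => le_ballAvg hf.continuous hγ hcvx (hcQ s ω)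
  have hFu : ballAvg f γ u ≤ f u + ε / 2 := (ballAvg_le hf hγ u).trans (by linarith)
  have hDs : ∀ s, μ / 2 * D s ≤ (∫ ω, f (c s ω) ∂dirLaw (ℕ × ℕ × ℕ) d) - f u := by
    intro s
    have iD : Integrable (fun ω => μ / 2 * normLp p (c s ω - u) ^ 2) (dirLaw (ℕ × ℕ × ℕ) d) :=
      integrable_dirLaw_of_continuous hd (continuous_const.mul
        (((continuous_normLp p hp).comp ((hcc s).sub continuous_const)).pow 2))
    have h := integral_mono iD ((ifc s).sub (integrable_const (f u))) fun ω =>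
      hsc.growth hμ.le hu hmin (hcQ s ω)
    rw [integral_const_mul, integral_sub' (ifc s) (integrable_const _), integral_const,
      probReal_univ, one_smul, ← hD] at h
    exact h
  -- Noise ε/8 and smoothing bias ε/2 give μD_{s+1} ≤ μD_s/8 + 5ε/4, and 2/8 + 5/4 ≤ 2.
  have hclaim : ∀ s, μ * D s ≤ μ * R ^ 2 / 8 ^ s + 2 * ε := by
    intro s
    induction s with
    | zero =>
      have h0 : D 0 = normLp p (x₀ - u) ^ 2 := by
        rw [hD]; simp only [hc, restarted]; simp
      have h1 := pow_le_pow_left₀ (normLp_nonneg p hp (x₀ - u)) hR 2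
      have := mul_le_mul_of_nonneg_left h1 hμ.le
      rw [h0, pow_zero, div_one]; linarith
    | succ s ih =>
      have h1 := hgap s
      have h2 := hfF (s + 1)
      have h3 := hDs (s + 1)
      have h4 : μ * R ^ 2 / 8 ^ (s + 1) = μ * R ^ 2 / 8 ^ s / 8 := by rw [pow_succ]; field
      rw [h4]; linarith
  obtain ⟨S, hS'⟩ : ∃ S, π.stages = S + 1 := ⟨π.stages - 1, by omega⟩
  have e : ∀ ω : ℕ × ℕ × ℕ → Sph d,
      output Q f γ x₀ π (fun s k j => ω (s, k, j)) = c (S + 1) ω := fun ω => by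
    rw [hc, output, hS']
  simp_rw [e]
  have h1 := hgap S
  have h2 := hfF (S + 1)
  have h3 := hclaim S
  -- Thus μD_S ≤ 6ε before the last stage, whose final gap is at most 6ε/16 + ε/8 + ε/2 = ε.
  have h4 : μ * R ^ 2 / 8 ^ S ≤ 4 * ε := by
    rw [div_le_iff₀ (by positivity)]
    rw [hS', pow_succ (8 : ℝ) S] at hS
    linarith
  linarith

/-! ### The two upper models of the smoothed function, and the guarantee for `f`. -/

/-- The gradient inequality at x bounds the increase by the gradient at x; replacing it by the
gradient at y costs √d/γ · M‖x-y‖_p · ‖x-y‖_2. -/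
theorem ballAvg_le_of_lipschitzLp (hd : 0 < d) {p : ℝ≥0∞} (hp : 1 ≤ p) (hp2 : p ≤ 2)
    {Q : Set (Vec d)} {f : Vec d → ℝ} {K : NNReal} (hf : LipschitzWith K f) {γ : ℝ} (hγ : 0 < γ)
    (hcvx : ConvexOn ℝ (Metric.cthickening γ Q) f) {M : ℝ} (hM : 0 ≤ M)
    (hfM : LipschitzLp p M (Metric.cthickening γ Q) f) {x y : Vec d} (hx : x ∈ Q) (hy : y ∈ Q) :
    ballAvg f γ x ≤ ballAvg f γ y + inner ℝ (meanGrad f γ y) (x - y) +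
      √d / γ * M * normLp p (x - y) ^ 2 := by
  have hg := ballAvg_gradient_inequality hd hf hγ hcvx hy hx
  have h0 := normLp_nonneg p hp (x - y)
  have hle := norm_le_normLp hp hp2 (x - y)
  have h1 := inner_meanGrad_sub_le hd hf.continuous hγ (D := M * normLp p (x - y)) (by positivity)
    (x := x) (y := y) (fun e => by
      have he : ‖(e : Vec d)‖ ≤ 1 := (norm_eq_of_mem_sphere e).le
      have := hfM _ (add_smul_mem_cthickening hy he hγ.le) _
        (add_smul_mem_cthickening hx he hγ.le)
      rwa [add_sub_add_right_eq_sub] at this) (x - y)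
  have h2 : √d / γ * (M * normLp p (x - y)) * ‖x - y‖ ≤
      √d / γ * (M * normLp p (x - y)) * normLp p (x - y) :=
    mul_le_mul_of_nonneg_left hle (by positivity)
  rw [inner_sub_left] at h1
  rw [← neg_sub x y, inner_neg_right] at hg
  have h3 : √d / γ * (M * normLp p (x - y)) * normLp p (x - y) =
    √d / γ * M * normLp p (x - y) ^ 2 := by ring
  linarith

/-- Same argument with both gradients bounded by K: a model with no quadratic term, for the regime
where smoothness does not help. -/
theorem ballAvg_le_add_normLp (hd : 0 < d) {p : ℝ≥0∞} (hp : 1 ≤ p) (hp2 : p ≤ 2)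
    {Q : Set (Vec d)} {f : Vec d → ℝ} {K : NNReal} (hf : LipschitzWith K f) {γ : ℝ} (hγ : 0 < γ)
    (hcvx : ConvexOn ℝ (Metric.cthickening γ Q) f) {x y : Vec d} (hx : x ∈ Q) (hy : y ∈ Q) :
    ballAvg f γ x ≤ ballAvg f γ y + inner ℝ (meanGrad f γ y) (x - y) +
      2 * K * normLp p (x - y) := by
  have hg := ballAvg_gradient_inequality hd hf hγ hcvx hy hx
  have hle := mul_le_mul_of_nonneg_left (norm_le_normLp hp hp2 (x - y)) K.coe_nonneg
  have h1 := (abs_le.1 (abs_inner_meanGrad_le hd hf hγ.ne' x (x - y))).2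
  have h2 := (abs_le.1 (abs_inner_meanGrad_le hd hf hγ.ne' y (x - y))).1
  rw [← neg_sub x y, inner_neg_right] at hg
  linarith

theorem zoGrad_congr {Q : Set (Vec d)} {f f' : Vec d → ℝ} {γ : ℝ} (hγ : 0 ≤ γ)
    (h : EqOn f f' (Metric.cthickening γ Q)) {y : Vec d} (hy : y ∈ Q) (e : Sph d) :
    zoGrad f γ y e = zoGrad f' γ y e := by
  have he : ‖(e : Vec d)‖ ≤ 1 := (norm_eq_of_mem_sphere e).le
  have h1 := h (add_smul_mem_cthickening hy he hγ)
  have h2 := h (add_smul_mem_cthickening hy (u := -(e : Vec d)) (by rwa [norm_neg]) hγ)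
  rw [smul_neg, ← sub_eq_add_neg] at h2
  rw [zoGrad, zoGrad, h1, h2]

/-- Accuracy of the gradient-free method with constant parameters. -/
theorem output_expected_gap (hd : 0 < d) {p : ℝ≥0∞} (hp : 1 ≤ p) (hp2 : p ≤ 2) (π : Params)
    (hpa : p ≤ π.proxExp) {M M₂ μ ε R σ N : ℝ} (hM : 0 < M) (hM₂ : 0 < M₂) (hμ : 0 < μ)
    (hε : 0 < ε) (hσ : 0 < σ)
    (hLN : 8 * (√d / (ε / (2 * M₂)) * M) ≤ σ ∧ N = 0 ∨ N = 2 * M₂)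
    {n B m : ℕ} (hn : 0 < n) (hB : 0 < B) (hm : 1 ≤ m) (hdm : (d : ℝ) ^ 2 ≤ 4 ^ (m - 1))
    (hπn : ∀ s, π.iters s = n) (hπB : ∀ s, π.batch s = B)
    (hπβ : ∀ s, π.reg s = μ * (n * (n + 1)) / 16)
    (hσβ : ∀ v : Vec d, σ / 2 * normLp p v ^ 2 ≤
      μ * (n * (n + 1)) / 16 * (π.proxExp.toReal - 1) / 4 * normLp π.proxExp v ^ 2)
    (hnoise : 2 * n * (((d : ℝ) ^ (1 - 1 / p.toReal)) ^ 2 * (23520 * m ^ 2 * M₂ ^ 2) / B + N ^ 2)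
      / σ ≤ ε / 8)
    (hS : 2 * (μ * R ^ 2) ≤ ε * 8 ^ π.stages) (hS0 : 0 < π.stages)
    {Q : Set (Vec d)} {f : Vec d → ℝ} {x₀ u : Vec d} (hQ : IsClosed Q) (hQc : Convex ℝ Q)
    (hcvx : ConvexOn ℝ (Metric.cthickening (ε / (2 * M₂)) Q) f)
    (hfM : LipschitzLp p M (Metric.cthickening (ε / (2 * M₂)) Q) f)
    (hfM₂ : LipschitzLp 2 M₂ (Metric.cthickening (ε / (2 * M₂)) Q) f)
    (hsc : StrongConvexLp p μ Q f) (hx₀ : x₀ ∈ Q) (hu : u ∈ Q) (hmin : IsMinOn f Q u)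
    (hR : normLp p (x₀ - u) ≤ R) {Ω : Type*} [MeasurableSpace Ω] {P : Measure Ω}
    [IsProbabilityMeasure P] {e : ℕ × ℕ × ℕ → Ω → Sph d} (he : ∀ i, Measurable (e i))
    (hlaw : ∀ i, P.map (e i) = unifSphere d) (hind : iIndepFun e P) :
    Integrable (fun ω => f (output Q f (ε / (2 * M₂)) x₀ π fun s k j => e (s, k, j) ω)) P ∧
      (∫ ω, f (output Q f (ε / (2 * M₂)) x₀ π fun s k j => e (s, k, j) ω) ∂P) - f u ≤ ε := by
  set γ := ε / (2 * M₂) with hγdef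
  have hγ : 0 < γ := by positivity
  have hLip : LipschitzOnWith ⟨M₂, hM₂.le⟩ f (Metric.cthickening γ Q) :=
    LipschitzOnWith.of_dist_le_mul fun x hx y hy => by
      rw [Real.dist_eq, dist_eq_norm]
      exact hfM₂ y hy x hx
  -- Outside Q_γ nothing is known about f. The method evaluates f only in Q_γ, so f may be replaced
  -- by a globally Lipschitz extension.
  obtain ⟨f', hf', hff'⟩ := hLip.extend_real
  have hsub : Q ⊆ Metric.cthickening γ Q := Metric.self_subset_cthickening Q
  have hcvx' : ConvexOn ℝ (Metric.cthickening γ Q) f' := hcvx.congr hff'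
  have hfM' : LipschitzLp p M (Metric.cthickening γ Q) f' := fun x hx y hy => by
    rw [← hff' hx, ← hff' hy]; exact hfM x hx y hy
  have hsc' : StrongConvexLp p μ Q f' := ⟨hQc, fun x hx y hy t h0 h1 => by
    rw [← hff' (hsub hx), ← hff' (hsub hy), ← hff' (hsub (hQc hx hy h0 (by linarith) (by ring)))]
    exact hsc.2 x hx y hy t h0 h1⟩
  have hmin' : IsMinOn f' Q u := fun x hx => by
    have := hmin hx
    simp only [mem_ofPred_eq] at this ⊢
    rwa [← hff' (hsub hx), ← hff' (hsub hu)]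
  have hmain : (∫ ω, f' (output Q f' γ x₀ π fun s k j => ω (s, k, j)) ∂dirLaw (ℕ × ℕ × ℕ) d) -
      f' u ≤ ε := by
    have hKγ : M₂ * γ ≤ ε / 2 := by rw [hγdef]; field_simp; rfl
    rcases hLN with ⟨hL, hN⟩ | hN
    · exact restarted_expected_gap (N := N) hd hp hp2 π hpa hQ hQc hf' hγ hcvx'
        (L := √d / γ * M) (by positivity) hσ hL hμ hKγ hε
        (fun x hx y hy => by
          rw [hN, zero_mul, add_zero]
          exact ballAvg_le_of_lipschitzLp hd hp hp2 hf' hγ hcvx' hM.le hfM' hx hy)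
        hn hB hm hdm hπn hπB hπβ hσβ hnoise hsc' hx₀ hu hmin' hR hS hS0
    · exact restarted_expected_gap (N := N) hd hp hp2 π hpa hQ hQc hf' hγ hcvx'
        (L := 0) le_rfl hσ (by linarith) hμ hKγ hε
        (fun x hx y hy => by
          rw [zero_mul, add_zero, hN]
          exact ballAvg_le_add_normLp hd hp hp2 hf' hγ hcvx' hx hy)
        hn hB hm hdm hπn hπB hπβ hσβ hnoise hsc' hx₀ hu hmin' hR hS hS0
  have hout : ∀ ω, f (output Q f γ x₀ π fun s k j => e (s, k, j) ω) =
      f' (output Q f' γ x₀ π fun s k j => e (s, k, j) ω) := fun ω => by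
    have h1 := restarted_congr_oracle hQ hQc hx₀ π
      (fun y hy θ => zoGrad_congr hγ.le hff' hy θ) (fun s k j => e (s, k, j) ω) π.stages
    rw [output, output, h1]
    exact hff' (hsub (restarted_mem hQ hQc hx₀ π _ _))
  have hgc : Continuous (zoGrad f' γ).uncurry := continuous_zoGrad hf'.continuous γ
  have hc : Continuous fun ω : ℕ × ℕ × ℕ → Sph d =>
      f' (output Q f' γ x₀ π fun s k j => ω (s, k, j)) :=
    hf'.continuous.comp (continuous_restarted hQ hQc hx₀ π hgc π.stages)
  have hem : AEMeasurable (fun ω i => e i ω) P := (measurable_pi_iff.2 he).aemeasurable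
  have hmap := map_eq_dirLaw hd he hlaw hind
  have hint := integrable_dirLaw_of_continuous hd hc
  rw [← hmap] at hint hmain
  rw [integral_map hem hc.aestronglyMeasurable] at hmain
  simp only [hout]
  rw [hff' (hsub hu)]
  exact ⟨hint.comp_aemeasurable hem, hmain⟩

/-! ### Choice of the parameters and complexity count. -/

theorem toReal_two_div_of_conjugate {p q : ℝ≥0∞} (hp : 1 ≤ p)
    (hpq : p⁻¹ + q⁻¹ = 1) : (2 / q).toReal = 2 * (1 - 1 / p.toReal) := by
  have hq : q⁻¹ ≠ ∞ := by
    intro h; rw [h, add_top] at hpq; exact ENNReal.top_ne_one hpq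
  have hpi : p⁻¹ ≠ ∞ := by
    rw [ne_eq, ENNReal.inv_eq_top]; exact (zero_lt_one.trans_le hp).ne'
  have h := congrArg ENNReal.toReal hpq
  rw [ENNReal.toReal_add hpi hq, ENNReal.toReal_inv p, ENNReal.toReal_one] at h
  rw [div_eq_mul_inv, ENNReal.toReal_mul, one_div]
  simp only [ENNReal.toReal_ofNat]
  linarith

/-- A constant lower bound suffices: the logarithms actually incurred are charged to Λ^k. -/
theorem half_le_minQLog {p q : ℝ≥0∞} (hpq : p⁻¹ + q⁻¹ = 1) (hd : 2 ≤ d) :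
    1 / 2 ≤ minQLog q d := by
  have hlog : (1 / 2 : ℝ) ≤ Real.log d := by
    have h1 : Real.log 2 ≤ Real.log d := Real.log_le_log (by norm_num) (by exact_mod_cast hd)
    linarith [Real.log_two_gt_d9]
  have hq : (1 : ℝ≥0∞) ≤ q := by
    rw [← ENNReal.inv_le_inv, inv_one, ← hpq]
    exact le_add_self
  unfold minQLog
  have h : ENNReal.ofReal (1 / 2) ≤ min q (ENNReal.ofReal (Real.log d)) := by
    refine le_min (le_trans ?_ hq) (ENNReal.ofReal_le_ofReal hlog)
    rw [← ENNReal.ofReal_one]; exact ENNReal.ofReal_le_ofReal (by norm_num)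
  have ht : min q (ENNReal.ofReal (Real.log d)) ≠ ∞ :=
    ne_top_of_le_ne_top ENNReal.ofReal_ne_top (min_le_right _ _)
  calc (1 / 2 : ℝ) = (ENNReal.ofReal (1 / 2)).toReal := by
        rw [ENNReal.toReal_ofReal (by norm_num)]
    _ ≤ _ := ENNReal.toReal_mono ht h

/-- An exponent for the prox function adapted to `p` and to the dimension. -/
theorem exists_proxExp (hd : 2 ≤ d) {p : ℝ≥0∞} (hp : 1 ≤ p) (hp2 : p ≤ 2) :
    ∃ a : ℝ≥0∞, 1 < a ∧ a ≤ 2 ∧ p ≤ a ∧ ∀ β : ℝ, 0 ≤ β → ∀ v : Vec d,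
      β / (16 * (1 + Real.log d)) / 2 * normLp p v ^ 2 ≤
        β * (a.toReal - 1) / 4 * normLp a v ^ 2 := by
  have hd1 : (1 : ℝ) ≤ d := by exact_mod_cast (by omega : 1 ≤ d)
  have hlog : 0 ≤ Real.log d := Real.log_nonneg hd1
  set l := 1 + Real.log d with hl
  have hl1 : 1 ≤ l := by linarith
  have hpt : p ≠ ∞ := ne_top_of_le_ne_top (by simp) hp2
  have hθ1 := one_le_toReal hp hpt
  have hθ2 : p.toReal ≤ 2 := by simpa using ENNReal.toReal_mono (by simp) hp2
  -- Keeping r - 1 ≥ 1/l secures the convexity modulus, while r exceeds p so little that d^{1/p-1/r}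
  -- ≤ e; then e² ≤ 8 compares the squared norms.
  set r := max p.toReal (1 + 1 / l) with hr
  have hil : 0 < 1 / l := by positivity
  have hil1 : 1 / l ≤ 1 := by rw [div_le_one (by linarith)]; exact hl1
  have hr1 : 1 + 1 / l ≤ r := le_max_right _ _
  have hr2 : r ≤ 2 := max_le hθ2 (by linarith)
  have har : (ENNReal.ofReal r).toReal = r := ENNReal.toReal_ofReal (by linarith)
  have ha1 : 1 < ENNReal.ofReal r := by
    rw [← ENNReal.ofReal_one]; exact (ENNReal.ofReal_lt_ofReal_iff (by linarith)).2 (by linarith)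
  have hpa : p ≤ ENNReal.ofReal r := by
    rw [← ENNReal.ofReal_toReal hpt]; exact ENNReal.ofReal_le_ofReal (le_max_left _ _)
  refine ⟨ENNReal.ofReal r, ha1, ?_, hpa, fun β hβ v => ?_⟩
  · simpa using ENNReal.ofReal_le_ofReal hr2
  rw [har]
  have hle := normLp_le_card_rpow_mul hp hpa ENNReal.ofReal_ne_top v
  rw [har] at hle
  have hexp : 1 / p.toReal - 1 / r ≤ 1 / l := by
    rcases le_total (1 + 1 / l) p.toReal with h | h
    · rw [hr, max_eq_left h, sub_self]; exact hil.le
    · have hr' : r = 1 + 1 / l := max_eq_right h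
      have h1 : 1 / p.toReal ≤ 1 := by rw [div_le_one (by linarith)]; exact hθ1
      have h2 : 1 - 1 / l ≤ 1 / r := by
        rw [hr', le_div_iff₀ (by linarith)]; nlinarith
      linarith
  have hpow : (d : ℝ) ^ (1 / p.toReal - 1 / r) ≤ Real.exp 1 := by
    rw [Real.rpow_def_of_pos (by linarith)]
    refine Real.exp_le_exp.2 ?_
    calc Real.log d * (1 / p.toReal - 1 / r) ≤ Real.log d * (1 / l) := by gcongr
      _ ≤ 1 := by rw [mul_one_div, div_le_one (by linarith)]; linarith
  have hn := normLp_nonneg _ ha1.le v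
  have hsq : normLp p v ^ 2 ≤ 8 * normLp (ENNReal.ofReal r) v ^ 2 := by
    have h1 : normLp p v ≤ 2.7182818286 * normLp (ENNReal.ofReal r) v :=
      hle.trans (mul_le_mul_of_nonneg_right (hpow.trans Real.exp_one_lt_d9.le) hn)
    have h2 := pow_le_pow_left₀ (normLp_nonneg p hp v) h1 2
    rw [mul_pow] at h2
    refine h2.trans (mul_le_mul_of_nonneg_right (by norm_num) (sq_nonneg _))
  calc β / (16 * l) / 2 * normLp p v ^ 2
      ≤ β / (16 * l) / 2 * (8 * normLp (ENNReal.ofReal r) v ^ 2) := by gcongr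
    _ = β * (1 / l) / 4 * normLp (ENNReal.ofReal r) v ^ 2 := by field
    _ ≤ _ := by gcongr; linarith

/-- The number of iterations and the batch size of a stage. -/
theorem exists_iters_batch {l c μ ε M M₂ v : ℝ} (hl : 1 ≤ l) (hc : 0 < c) (hμ : 0 < μ) (hε : 0 < ε)
    (hM : 0 < M) (hM₂ : 0 < M₂) (hv : 0 ≤ v) :
    ∃ (n B : ℕ) (N : ℝ), 0 < n ∧ 0 < B ∧
      (8 * (c / (ε / (2 * M₂)) * M) ≤ μ * (n * (n + 1)) / 16 / (16 * l) ∧ N = 0 ∨ N = 2 * M₂) ∧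
      2 * n * (v / B + N ^ 2) / (μ * (n * (n + 1)) / 16 / (16 * l)) ≤ ε / 8 ∧
      (n : ℝ) ≤ √(4096 * l * c * (M * M₂) / (μ * ε)) + 1 ∧
      (n * B : ℝ) ≤ 2 * (4096 * l * (v + 4 * M₂ ^ 2) / (μ * ε)) + 1 := by
  set I := √(4096 * l * c * (M * M₂) / (μ * ε)) with hI
  set T := 4096 * l * (v + 4 * M₂ ^ 2) / (μ * ε) with hT
  have hIpos : 0 < I := Real.sqrt_pos.2 (by positivity)
  have hIsq : I ^ 2 = 4096 * l * c * (M * M₂) / (μ * ε) := Real.sq_sqrt (by positivity)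
  have hTpos : 0 < T := by positivity
  have hTe : T * (μ * ε) = 4096 * l * (v + 4 * M₂ ^ 2) := by rw [hT]; field_simp
  -- With σ = μn(n+1)/(256 l) the noise term is 512 l w/(μ(n+1)); the target ε/8 turns 512 into
  -- 4096. The same number arises as 8·2·256 in the smoothness requirement 8L ≤ σ.
  have hnoise : ∀ (n : ℕ) (w : ℝ), 0 < n → 4096 * l * w ≤ μ * ε * (n + 1) →
      2 * n * w / (μ * (n * (n + 1)) / 16 / (16 * l)) ≤ ε / 8 := by
    intro n w hn hw
    have hn' : (0 : ℝ) < n := by exact_mod_cast hn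
    have e : 2 * n * w / (μ * (n * (n + 1)) / 16 / (16 * l)) =
        4096 * l * w / (8 * (μ * (n + 1))) := by field
    rw [e, div_le_div_iff₀ (by positivity) (by norm_num)]
    nlinarith
  -- I is the accelerated iteration count, T the sample budget per stage. If I ≤ T, the budget is
  -- spread over ⌈I⌉ batches. Otherwise ⌈T⌉ steps with one sample each already suffice under the
  -- Lipschitz model N = 2M₂.
  rcases le_total I T with h | h
  · have hn : 0 < ⌈I⌉₊ := Nat.ceil_pos.2 hIpos
    have hn' : (0 : ℝ) < (⌈I⌉₊ : ℕ) := by exact_mod_cast hn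
    have hB : 0 < ⌈T / (⌈I⌉₊ : ℕ)⌉₊ := Nat.ceil_pos.2 (by positivity)
    have hnI := Nat.le_ceil I
    have hnI' := (Nat.ceil_lt_add_one hIpos.le).le
    have hBT := Nat.le_ceil (T / (⌈I⌉₊ : ℕ))
    have hBT' := (Nat.ceil_lt_add_one (by positivity : 0 ≤ T / (⌈I⌉₊ : ℕ))).le
    set n := ⌈I⌉₊
    set B := ⌈T / n⌉₊
    have hB' : (0 : ℝ) < B := by exact_mod_cast hB
    rw [div_le_iff₀ hn'] at hBT
    refine ⟨n, B, 0, hn, hB, .inl ⟨?_, rfl⟩, hnoise n _ hn ?_, hnI', ?_⟩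
    · have e : 8 * (c / (ε / (2 * M₂)) * M) = I ^ 2 * μ / 256 / l := by
        rw [hIsq]; field
      rw [e, show μ * (n * (n + 1)) / 16 / (16 * l) = (n * (n + 1)) * μ / 256 / l by
        field]
      gcongr
      nlinarith
    · have h1 : 4096 * l * (v / B + 0 ^ 2) = 4096 * l * v / B := by ring
      rw [h1, div_le_iff₀ hB']
      have h2 : 4096 * l * v ≤ T * (μ * ε) := by
        rw [hTe]; gcongr; nlinarith [sq_nonneg M₂]
      have h3 : T * (μ * ε) ≤ B * n * (μ * ε) := by gcongr
      have h4 : 0 ≤ μ * ε * B := by positivity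
      nlinarith
    · calc (n * B : ℝ) ≤ n * (T / n + 1) := by gcongr
        _ = T + n := by field_simp
        _ ≤ _ := by linarith
  · have hn : 0 < ⌈T⌉₊ := Nat.ceil_pos.2 hTpos
    have hnT := Nat.le_ceil T
    have hnT' := (Nat.ceil_lt_add_one hTpos.le).le
    refine ⟨⌈T⌉₊, 1, 2 * M₂, hn, one_pos, .inr rfl, hnoise _ _ hn ?_, by linarith, ?_⟩
    · have h1 : 4096 * l * (v / (1 : ℕ) + (2 * M₂) ^ 2) = T * (μ * ε) := by
        rw [hTe, Nat.cast_one]; ring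
      rw [h1]
      have : 0 < μ * ε := by positivity
      nlinarith
    · rw [Nat.cast_one, mul_one]; linarith

/-- For weak parameters the starting point is already accurate enough. -/
theorem gap_le_of_lipschitzLp {p : ℝ≥0∞} (hp : 1 ≤ p) (hp2 : p ≤ 2) {M M₂ μ ε : ℝ} (hM : 0 < M)
    (hM₂ : 0 < M₂) (hμ : 0 < μ) (h : M * M₂ ≤ μ * ε / 2 ∨ M₂ ^ 2 ≤ μ * ε / 2) {Q : Set (Vec d)}
    {f : Vec d → ℝ} (hfM : LipschitzLp p M Q f) (hfM₂ : LipschitzLp 2 M₂ Q f)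
    (hsc : StrongConvexLp p μ Q f) {x u : Vec d} (hx : x ∈ Q) (hu : u ∈ Q) (hmin : IsMinOn f Q u) :
    f x - f u ≤ ε := by
  have hg := hsc.growth hμ.le hu hmin hx
  have h1 := (le_abs_self _).trans (hfM u hu x hx)
  have h2 := (le_abs_self _).trans (hfM₂ u hu x hx)
  have h3 := norm_le_normLp hp hp2 (x - u)
  rw [normLp_two] at h2
  set r := normLp p (x - u) with hr
  have hr0 : 0 ≤ r := normLp_nonneg p hp _
  have h2' : f x - f u ≤ M₂ * r := h2.trans (by gcongr)
  -- Quadratic growth against a linear bound A r forces r ≤ 2A/μ; the Euclidean Lipschitz bound then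
  -- controls the gap.
  have key : ∀ A : ℝ, 0 < A → f x - f u ≤ A * r → f x - f u ≤ M₂ * (2 * A / μ) := by
    intro A hA hfA
    have hrA : r ≤ 2 * A / μ := by
      rcases hr0.eq_or_lt with h0 | h0
      · rw [← h0]; positivity
      · rw [le_div_iff₀ hμ]
        have : μ / 2 * r * r ≤ A * r := by linarith [sq r]
        linarith [le_of_mul_le_mul_right this h0]
    exact h2'.trans (by gcongr)
  rcases h with h | h
  · refine (key M hM h1).trans ?_
    rw [show M₂ * (2 * M / μ) = 2 * (M * M₂) / μ by ring, div_le_iff₀ hμ]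
    linarith
  · refine (key M₂ hM₂ h2').trans ?_
    rw [show M₂ * (2 * M₂ / μ) = 2 * M₂ ^ 2 / μ by ring, div_le_iff₀ hμ]
    linarith

/-- The choice m = ⌈log₂ d⌉ + 1 meets the tail requirement d² ≤ 4^{m-1} of the moment bound. -/
theorem four_pow_clog (d : ℕ) : (d : ℝ) ^ 2 ≤ 4 ^ (Nat.clog 2 d + 1 - 1) := by
  rw [Nat.add_sub_cancel, show (4 : ℝ) = 2 ^ 2 by norm_num, ← pow_mul, mul_comm, pow_mul]
  have h : (d : ℝ) ≤ 2 ^ Nat.clog 2 d := by exact_mod_cast Nat.le_pow_clog (by norm_num) d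
  gcongr

theorem clog_add_one_le (hd : 2 ≤ d) : ((Nat.clog 2 d + 1 : ℕ) : ℝ) ≤ 2 * Real.log d + 2 := by
  have hlt := Nat.pow_pred_clog_lt_self (b := 2) (by norm_num) (x := d) (by omega)
  have hpos : 0 < Nat.clog 2 d := Nat.clog_pos (by norm_num) hd
  obtain ⟨k, hk⟩ : ∃ k, Nat.clog 2 d = k + 1 := ⟨Nat.clog 2 d - 1, by omega⟩
  rw [hk] at hlt ⊢
  have h1 : (2 : ℝ) ^ k ≤ d := by exact_mod_cast hlt.le
  have h2 := Real.log_le_log (by positivity) h1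
  rw [Real.log_pow] at h2
  have h3 : (0 : ℝ) ≤ k := Nat.cast_nonneg k
  push_cast
  nlinarith [Real.log_two_gt_d9]

/-- The number of iterations of the restarted method. -/
theorem iters_le {d : ℕ} (hd1 : (1 : ℝ) ≤ d) {l Λ X Z S n : ℝ} (hl1 : 1 ≤ l) (hlΛ : l ≤ 2 * Λ)
    (hΛ1 : 1 ≤ Λ) (hX0 : 0 < X) (hZ : 0 < Z) (hXZ : Z / 2 < X) (hS1 : S ≤ 3 * Λ)
    (hn : 0 ≤ n) (hnI : n ≤ √(4096 * l * √d * X / Z) + 1) :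
    S * n ≤ 10 ^ 12 * ((d : ℝ) ^ (1 / 4 : ℝ) * √X / √Z) * Λ ^ 4 := by
  -- This lower bound makes the square root at least 1, so the + 1 from rounding up is absorbed.
  have hX : 1 / 2 ≤ X / Z := by
    rw [le_div_iff₀ (by positivity)]; linarith
  have hsd : 1 ≤ √(d : ℝ) := Real.one_le_sqrt.2 hd1
  have hI1 : 1 ≤ √(4096 * l * √d * X / Z) := by
    rw [Real.one_le_sqrt]
    have e : 4096 * l * √d * X / Z = 4096 * (l * √d) * (X / Z) := by ring
    rw [e]
    have : 1 ≤ l * √d := one_le_mul_of_one_le_of_one_le hl1 hsd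
    nlinarith
  have hI : √(4096 * l * √d * X / Z) ≤
      128 * Λ * ((d : ℝ) ^ (1 / 4 : ℝ) * √X / √Z) := by
    refine Real.sqrt_le_iff.2 ⟨by positivity, ?_⟩
    have h4 : ((d : ℝ) ^ (1 / 4 : ℝ)) ^ 2 = √d := by
      rw [← Real.rpow_natCast, ← Real.rpow_mul (by linarith), Real.sqrt_eq_rpow]; norm_num
    rw [mul_pow, div_pow, mul_pow, mul_pow, h4, Real.sq_sqrt (by positivity),
      Real.sq_sqrt (by positivity)]
    rw [show 4096 * l * √d * X / Z = 4096 * l * (√d * X / Z) by ring]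
    refine mul_le_mul_of_nonneg_right ?_ (by positivity)
    have : Λ ≤ Λ ^ 2 := by nlinarith
    linarith
  set J := (d : ℝ) ^ (1 / 4 : ℝ) * √X / √Z with hJ
  have hJ0 : 0 ≤ J := by positivity
  calc S * n ≤ 3 * Λ * (2 * (128 * Λ * J)) := by gcongr; linarith
    _ = 768 * J * Λ ^ 2 := by ring
    _ ≤ 10 ^ 12 * J * Λ ^ 4 := by
      gcongr
      · norm_num
      · norm_num

/-- The number of oracle calls of the restarted method. -/
theorem calls_le {l Λ X Z S κ m w nB : ℝ} (hlΛ : l ≤ 2 * Λ)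
    (hΛ1 : 1 ≤ Λ) (hκ1 : 1 ≤ κ) (hm0 : 0 ≤ m) (hmΛ : m ≤ 4 * Λ) (hw : 1 / 2 ≤ w) (hZ : 0 < Z)
    (hXZ : Z / 2 ≤ X) (hS1 : S ≤ 3 * Λ) (hnB0 : 0 ≤ nB)
    (hnB : nB ≤ 2 * (4096 * l * (κ ^ 2 * (23520 * m ^ 2 * X) + 4 * X) / Z) + 1) :
    S * (2 * nB) ≤ 10 ^ 12 * (w * κ ^ 2 * X / Z) * Λ ^ 4 := by
  have hκ2 : 1 ≤ κ ^ 2 := one_le_pow₀ hκ1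
  generalize κ ^ 2 = κ2 at *
  set Y := X / Z with hY
  have hY1 : 1 / 2 ≤ Y := by
    rw [hY, le_div_iff₀ (by positivity)]; linarith
  have hTe : 4096 * l * (κ2 * (23520 * m ^ 2 * X) + 4 * X) / Z =
      4096 * l * (κ2 * (23520 * m ^ 2) + 4) * Y := by rw [hY]; ring
  rw [hTe] at hnB
  have hΛ2 : 1 ≤ Λ ^ 2 := one_le_pow₀ hΛ1
  have hm2 : m ^ 2 ≤ 16 * Λ ^ 2 := by
    have := pow_le_pow_left₀ (by linarith : (0 : ℝ) ≤ m) hmΛ 2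
    rw [mul_pow] at this; linarith
  have hin : κ2 * (23520 * m ^ 2) + 4 ≤ 376324 * (κ2 * Λ ^ 2) := by
    have h1 : κ2 * (23520 * m ^ 2) ≤ κ2 * (23520 * (16 * Λ ^ 2)) := by gcongr
    have h2 : 1 ≤ κ2 * Λ ^ 2 := one_le_mul_of_one_le_of_one_le hκ2 hΛ2
    linarith
  have hT : 4096 * l * (κ2 * (23520 * m ^ 2) + 4) * Y ≤
      4096 * (2 * Λ) * (376324 * (κ2 * Λ ^ 2)) * Y := by gcongr
  have hbig : 1 ≤ 4096 * (2 * Λ) * (376324 * (κ2 * Λ ^ 2)) * Y := by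
    have h2 : 1 ≤ κ2 * Λ ^ 2 := one_le_mul_of_one_le_of_one_le hκ2 hΛ2
    have h3 : 1 ≤ Λ * (κ2 * Λ ^ 2) := one_le_mul_of_one_le_of_one_le hΛ1 h2
    nlinarith
  have hnB' : nB ≤ 3 * (4096 * (2 * Λ) * (376324 * (κ2 * Λ ^ 2)) * Y) := by linarith
  calc S * (2 * nB)
      ≤ 3 * Λ * (2 * (3 * (4096 * (2 * Λ) * (376324 * (κ2 * Λ ^ 2)) * Y))) := by gcongr
    _ = 110982463488 * (1 / 2 * (κ2 * Y)) * Λ ^ 4 := by ring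
    _ ≤ 10 ^ 12 * (w * (κ2 * Y)) * Λ ^ 4 := by gcongr; norm_num
    _ = _ := by rw [hY]; ring

end ZO

/-! ### The complexity theorem. -/

theorem theorem4 :
    ∃ C : ℝ, 0 < C ∧ ∃ k : ℕ,
      ∀ (d : ℕ) (p q : ℝ≥0∞) (M M₂ μ ε R : ℝ),
        2 ≤ d → 1 ≤ p → p ≤ 2 → p⁻¹ + q⁻¹ = 1 →
        0 < M → 0 < M₂ → 0 < μ → 0 < ε → 0 < R → ε / R ^ 2 ≤ μ →
        ∃ π : ZO.Params,
          (ZO.numIters π : ℝ) ≤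
            C * ((d : ℝ) ^ (1 / 4 : ℝ) * √(M * M₂) / √(μ * ε)) *
              Real.log (2 * d * (μ * R ^ 2 / ε)) ^ k ∧
          (ZO.numCalls π : ℝ) ≤
            C * (ZO.minQLog q d * (d : ℝ) ^ (2 / q).toReal * M₂ ^ 2 / (μ * ε)) *
              Real.log (2 * d * (μ * R ^ 2 / ε)) ^ k ∧
          ∀ (Q : Set (ZO.Vec d)) (f : ZO.Vec d → ℝ) (x₀ xstar : ZO.Vec d),
            IsClosed Q → Convex ℝ Q →
            ConvexOn ℝ (Metric.cthickening (ε / (2 * M₂)) Q) f →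
            ZO.LipschitzLp p M (Metric.cthickening (ε / (2 * M₂)) Q) f →
            ZO.LipschitzLp 2 M₂ (Metric.cthickening (ε / (2 * M₂)) Q) f →
            ZO.StrongConvexLp p μ Q f →
            x₀ ∈ Q → xstar ∈ Q → IsMinOn f Q xstar →
            ZO.normLp p (x₀ - xstar) ≤ R →
            ∀ (Ω : Type*) [MeasurableSpace Ω] (P : Measure Ω) [IsProbabilityMeasure P]
              (e : ℕ × ℕ × ℕ → Ω → ZO.Sph d),
              (∀ i, Measurable (e i)) →
              (∀ i, P.map (e i) = ZO.unifSphere d) →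
              iIndepFun e P →
              Integrable (fun ω => f (ZO.output Q f (ε / (2 * M₂)) x₀ π
                fun s k j => e (s, k, j) ω)) P ∧
              (∫ ω, f (ZO.output Q f (ε / (2 * M₂)) x₀ π
                fun s k j => e (s, k, j) ω) ∂P) - f xstar ≤ ε := by
  refine ⟨10 ^ 12, by norm_num, 4, ?_⟩
  intro d p q M M₂ μ ε R hd hp hp2 hpq hM hM₂ hμ hε hR hμR
  have hd1 : (1 : ℝ) ≤ d := by exact_mod_cast (by omega : 1 ≤ d)
  have hd2 : (2 : ℝ) ≤ d := by exact_mod_cast hd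
  have hd0 : 0 < d := by omega
  have hρ : 1 ≤ μ * R ^ 2 / ε := by
    rw [one_le_div hε]; rwa [div_le_iff₀ (by positivity)] at hμR
  have hlogd : 0 ≤ Real.log d := Real.log_nonneg hd1
  have hlogρ : 0 ≤ Real.log (μ * R ^ 2 / ε) := Real.log_nonneg hρ
  set Λ := Real.log (2 * d * (μ * R ^ 2 / ε)) with hΛ
  have hΛe : Λ = Real.log 2 + Real.log d + Real.log (μ * R ^ 2 / ε) := by
    rw [hΛ, Real.log_mul (by positivity) (by positivity), Real.log_mul (by norm_num)
      (by positivity)]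
  have hlog2 : Real.log 2 ≤ Real.log d := Real.log_le_log (by norm_num) hd2
  have hΛ1 : 1 ≤ Λ := by linarith [Real.log_two_gt_d9]
  have hl1 : 1 ≤ 1 + Real.log d := by linarith
  have hlΛ : 1 + Real.log d ≤ 2 * Λ := by linarith [Real.log_two_gt_d9]
  have hq := ZO.half_le_minQLog hpq hd
  -- In the weak case a claimed bound may be less than one iteration or call, so the method with
  -- zero stages must do: it returns x₀, already ε-optimal.
  by_cases hweak : M * M₂ ≤ μ * ε / 2 ∨ M₂ ^ 2 ≤ μ * ε / 2
  · refine ⟨⟨2, by norm_num, le_rfl, 0, fun _ => 0, fun _ => 1, fun _ => one_pos, fun _ => 1,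
      fun _ => one_pos⟩, ?_, ?_, ?_⟩
    · rw [ZO.numIters, Finset.range_zero, Finset.sum_empty, Nat.cast_zero]; positivity
    · rw [ZO.numCalls, Finset.range_zero, Finset.sum_empty, Nat.cast_zero]; positivity
    · intro Q f x₀ u _ _ _ hfM hfM₂ hsc hx₀ hu hmin _ Ω _ P _ e _ _ _
      have hsub : Q ⊆ Metric.cthickening (ε / (2 * M₂)) Q := Metric.self_subset_cthickening Q
      refine ⟨integrable_const (f x₀), ?_⟩
      change (∫ _ω, f x₀ ∂P) - f u ≤ ε
      rw [integral_const, probReal_univ, one_smul]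
      exact ZO.gap_le_of_lipschitzLp hp hp2 hM hM₂ hμ hweak
        (fun x hx y hy => hfM x (hsub hx) y (hsub hy))
        (fun x hx y hy => hfM₂ x (hsub hx) y (hsub hy)) hsc hx₀ hu hmin
  push Not at hweak
  obtain ⟨hX1, hX2⟩ := hweak
  obtain ⟨a, ha, ha2, hpa, hprox⟩ := ZO.exists_proxExp (d := d) hd hp hp2
  set l := 1 + Real.log d with hl
  set m := Nat.clog 2 d + 1 with hm
  set κ : ℝ := (d : ℝ) ^ (1 - 1 / p.toReal) with hκ
  have hκ1 : 1 ≤ κ := by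
    refine Real.one_le_rpow hd1 ?_
    have := ZO.one_le_toReal hp (ne_top_of_le_ne_top (by simp) hp2)
    rw [sub_nonneg, div_le_one (by linarith)]; exact this
  have hκq : (d : ℝ) ^ (2 / q).toReal = κ ^ 2 := by
    rw [ZO.toReal_two_div_of_conjugate hp hpq, hκ, ← Real.rpow_natCast,
      ← Real.rpow_mul (by linarith)]
    congr 1; push_cast; ring
  obtain ⟨n, B, N, hn, hB, hLN, hnoise, hnI, hnB⟩ := ZO.exists_iters_batch (l := l) (c := √d)
    (v := κ ^ 2 * (23520 * m ^ 2 * M₂ ^ 2)) hl1 (by positivity) hμ hε hM hM₂ (by positivity)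
  have hn' : (0 : ℝ) < n := by exact_mod_cast hn
  -- Since e ≤ 8, the rounded logarithm covers μR²/ε. The additional stage supplies the factor 2 and
  -- guarantees at least one stage when the logarithm is 0.
  set S := ⌈Real.log (μ * R ^ 2 / ε)⌉₊ + 1 with hS
  have hS1 : (S : ℝ) ≤ 3 * Λ := by
    have := (Nat.ceil_lt_add_one hlogρ).le
    rw [hS]; push_cast; linarith [Real.log_two_gt_d9]
  have hS8 : 2 * (μ * R ^ 2) ≤ ε * 8 ^ S := by
    have h1 : μ * R ^ 2 / ε ≤ 8 ^ ⌈Real.log (μ * R ^ 2 / ε)⌉₊ := by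
      calc μ * R ^ 2 / ε = Real.exp (Real.log (μ * R ^ 2 / ε)) :=
            (Real.exp_log (by positivity)).symm
        _ ≤ Real.exp (⌈Real.log (μ * R ^ 2 / ε)⌉₊ : ℕ) := Real.exp_le_exp.2 (Nat.le_ceil _)
        _ = Real.exp 1 ^ ⌈Real.log (μ * R ^ 2 / ε)⌉₊ := by rw [← Real.exp_nat_mul, mul_one]
        _ ≤ _ := by gcongr; linarith [Real.exp_one_lt_d9]
    rw [div_le_iff₀ hε] at h1
    rw [hS, pow_succ (8 : ℝ)]
    nlinarith
  refine ⟨⟨a, ha, ha2, S, fun _ => n, fun _ => B, fun _ => hB,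
    fun _ => μ * (n * (n + 1)) / 16, fun _ => by positivity⟩, ?_, ?_, ?_⟩
  · have e : ((ZO.numIters ⟨a, ha, ha2, S, fun _ => n, fun _ => B, fun _ => hB,
        fun _ => μ * (n * (n + 1)) / 16, fun _ => by positivity⟩ : ℕ) : ℝ) = S * n := by
      simp [ZO.numIters]
    rw [e]
    exact ZO.iters_le hd1 hl1 hlΛ hΛ1 (by positivity) (by positivity) hX1 hS1 hn'.le hnI
  · have e : ((ZO.numCalls ⟨a, ha, ha2, S, fun _ => n, fun _ => B, fun _ => hB,
        fun _ => μ * (n * (n + 1)) / 16, fun _ => by positivity⟩ : ℕ) : ℝ) = S * (2 * (n * B)) := by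
      simp [ZO.numCalls]; ring
    rw [e, hκq]
    have hmΛ : (m : ℝ) ≤ 4 * Λ := by
      have := ZO.clog_add_one_le hd
      linarith
    exact ZO.calls_le hlΛ hΛ1 hκ1 (by positivity) hmΛ hq (by positivity) hX2.le hS1
      (by positivity) hnB
  · intro Q f x₀ u hQ hQc hcvx hfM hfM₂ hsc hx₀ hu hmin hRx Ω _ P _ e he hlaw hind
    exact ZO.output_expected_gap hd0 hp hp2 _ hpa hM hM₂ hμ hε (by positivity) hLN hn hB
      (by omega : 1 ≤ m) (ZO.four_pow_clog d) (fun _ => rfl) (fun _ => rfl) (fun _ => rfl)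
      (fun v => hprox _ (by positivity) v) hnoise hS8 (Nat.succ_pos _) hQ hQc hcvx hfM hfM₂ hsc hx₀
      hu hmin hRx he hlaw hind
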